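/- **Setting.** Let $N\ge 1$ be an integer, $\beta,g\ge 0$, $0\le s\le 1$, $R>0$. On $\mathbb R^2$ put $x^\perp=(-x_2,x_1)$, $|x|_R=\max\{|x|,R\}$ and $$\mathbf a_N(x)=N^{s/2-1}\,\frac{x^\perp}{|x|_R^{1+s}} .$$ For $u_1,\dots,u_N:\mathbb R^2\to\mathbb C$ write $\rho=\sum_{j}|u_j|^2$, $J=\sum_j \mathrm i\,(u_j\nabla\overline{u_j}-\overline{u_j}\nabla u_j)$, $\mathbf a_N[\rho]=\mathbf a_N*\rho$, $\mathbf a_N^2[\rho]=|\mathbf a_N|^2*\rho$. For an integer $m\ge 2$ and $T>0$, a solution of class $H^m$ on $[0,T]$ of the effective equation is a family $u_1,\dots,u_N\in C([0,T],H^m(\mathbb R^2))$, with $\{u_j(0)\}_{j=1}^N$ orthonormal in $L^2(\mathbb R^2)$, such that on $[0,T]$, with $\partial_t$ taken in $L^2(\mathbb R^2)$, for $j=1,\dots,N$, $$\mathrm i\,\partial_t u_j=\big(-\mathrm i\nabla+\beta\,\mathbf a_N[\rho]\big)^2u_j+gN\,\mathbf a_N^2[\rho]\,u_j-\Big[\beta\,\mathbf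 a_N*\big(2\beta\,\mathbf a_N[\rho]\rho+J\big)\Big]u_j .$$ (In the last bracket the convolution is taken with the scalar product of vector fields.) Let $$H_{N,R}=\sum_{j=1}^N\Big(-\mathrm i\nabla_j+\beta\sum_{k\ne j}\mathbf a_N(x_j-x_k)\Big)^2+\frac g2\,N\sum_{j=1}^N\sum_{k\neq j}|\mathbf a_N(x_j-x_k)|^2,$$ let $\Psi_N(0)=\bigwedge_{j=1}^N u_j(0)=\frac1{\sqrt{N!}}\sum_{\sigma\in S_N}\operatorname{sgn}(\sigma)\prod_{j=1}^N u_{\sigma(j)}(0,x_j)$, and let $\langle\Psi_N(0),H_{N,R}\Psi_N(0)\rangle$ be understood as a quadratic form. **Lemma 3.2 (kinetic energy bounds).** There is $\beta_*>0$ such that for every $g\ge 0$ and every $C>0$ there is a constant $C'>0$, depending only on $g$ and $C$, with the following property. Let $0\le\beta\le\beta_*$, $N\ge 1$, $0\le s\le 1/2$, $0\le r\le 1/2$, $R=N^{-r}$, $m\geq 2$, $T>0$, and let $\{u_j\}_{j=1}^N$ be a solution of class $H^m$ on $[0,T]$ of the effective equation. If $$\langle\Psi_N(0),H_{N,R}\Psi_N(0)\rangle\le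 C N,$$ then for all $t\in[0,T]$ $$\sum_{j=1}^N\int_{\mathbb R^2}|\nabla u_j(t)|^2\le C'N\qquad\text{and}\qquad \int_{\mathbb R^2}\rho(t)^2\le C'N .$$ -/

import Mathlib

open MeasureTheory Filter Topology
open scoped ContDiff

noncomputable section

namespace ChernSimonsHartree

/-! ### Weak derivatives and Sobolev spaces -/

/-- `g` is a weak derivative of `f` in the direction `v`: both are locally integrable and
`∫ (∂ᵥ φ) f = - ∫ φ g` for all smooth compactly supported test functions `φ`. -/
def HasWeakDeriv {E : Type*} [NormedAddCommGroup E] [NormedSpace ℝ E] [MeasureSpace E]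
    (v : E) (f g : E → ℂ) : Prop :=
  LocallyIntegrable f ∧ LocallyIntegrable g ∧
    ∀ φ : E → ℝ, ContDiff ℝ ∞ φ → HasCompactSupport φ →
      ∫ x, (fderiv ℝ φ x v) • f x = - ∫ x, φ x • g x

open Classical in
/-- The weak derivative of `f` in the direction `v` (unique up to null sets if it exists;
the value is `0` by convention if there is none). -/
def weakDeriv {E : Type*} [NormedAddCommGroup E] [NormedSpace ℝ E] [MeasureSpace E]
    (v : E) (f : E → ℂ) : E → ℂ :=
  if h : ∃ g, HasWeakDeriv v f g then h.choose else 0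

/-- The component `-i ∂ᵥ + a` of a covariant derivative, `a` a real-valued function. -/
def covDeriv {E : Type*} [NormedAddCommGroup E] [NormedSpace ℝ E] [MeasureSpace E]
    (v : E) (a : E → ℝ) (f : E → ℂ) : E → ℂ :=
  fun x => -Complex.I * weakDeriv v f x + (a x : ℂ) * f x

/-- The plane with its Euclidean norm and Lebesgue measure. -/
abbrev Plane : Type := EuclideanSpace ℝ (Fin 2)

/-- The Hilbert space of square-integrable complex functions on the plane. -/
abbrev L2Plane : Type := Lp ℂ 2 (volume : Measure Plane)

/-- The standard basis vectors of the plane. -/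
def e (k : Fin 2) : Plane := EuclideanSpace.single k 1

/-- Membership in the Sobolev space `H^m` of the plane: all weak derivatives up to order `m`
exist and are square-integrable. -/
def MemH : ℕ → (Plane → ℂ) → Prop
  | 0, f => MemLp f 2
  | m + 1, f => MemLp f 2 ∧ ∀ k : Fin 2,
      (∃ g, HasWeakDeriv (e k) f g) ∧ MemH m (weakDeriv (e k) f)

/-- The `H^m` norm of an element of `H^m` (as the sum of the `L²` norms of all iterated partial
weak derivatives of order at most `m`, counted with multiplicity). -/
def normH : ℕ → (Plane → ℂ) → ENNReal
  | 0, f => eLpNorm f 2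
  | m + 1, f => eLpNorm f 2 + ∑ k : Fin 2, normH m (weakDeriv (e k) f)

/-- `t ↦ u t` is a continuous curve in `H^m` on the set `I` of times. -/
def ContinuousInH (m : ℕ) (I : Set ℝ) (u : ℝ → L2Plane) : Prop :=
  (∀ t ∈ I, MemH m (u t)) ∧
    ∀ t ∈ I, Tendsto (fun τ => normH m (fun x => u τ x - u t x)) (𝓝[I] t) (𝓝 0)

/-! ### The vector potential -/

/-- `x^⊥ = (-x₂, x₁)`. -/
def perp (x : Plane) : Plane := !₂[-x 1, x 0]

/-- `a_R(x) = x^⊥ / |x|_R^{1+s}` with `|x|_R = max {|x|, R}`. -/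
def aR (s R : ℝ) (x : Plane) : Plane := ((max ‖x‖ R) ^ (1 + s))⁻¹ • perp x

/-- `a_N(x) = N^{s/2-1} a_R(x)`. -/
def aN (N : ℕ) (s R : ℝ) (x : Plane) : Plane := (N : ℝ) ^ (s / 2 - 1) • aR s R x

/-! ### The effective equation -/

/-- The density `ρ = ∑ⱼ |uⱼ|²`. -/
def density {N : ℕ} (u : Fin N → Plane → ℂ) (x : Plane) : ℝ := ∑ j, ‖u j x‖ ^ 2

/-- The current `J = ∑ⱼ i (uⱼ ∇ūⱼ - ūⱼ ∇uⱼ)`, a real vector field (`∇ū` is the conjugate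
of `∇u`; each summand is real, so taking the real part only changes its type). -/
def current {N : ℕ} (u : Fin N → Plane → ℂ) (x : Plane) : Plane :=
  WithLp.toLp 2 fun k => ∑ j, (Complex.I *
    (u j x * starRingEnd ℂ (weakDeriv (e k) (u j) x)
      - starRingEnd ℂ (u j x) * weakDeriv (e k) (u j) x)).re

/-- `a_N[ρ] = a_N * ρ`. -/
def potA {N : ℕ} (s R : ℝ) (u : Fin N → Plane → ℂ) (x : Plane) : Plane :=
  ∫ y, density u y • aN N s R (x - y)

/-- `a_N²[ρ] = |a_N|² * ρ`. -/
def potA2 {N : ℕ} (s R : ℝ) (u : Fin N → Plane → ℂ) (x : Plane) : ℝ :=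
  ∫ y, density u y * ‖aN N s R (x - y)‖ ^ 2

/-- `a_N * (2 β a_N[ρ] ρ + J)`, the convolution being taken with the scalar product of the
two vector fields. -/
def potJ {N : ℕ} (β s R : ℝ) (u : Fin N → Plane → ℂ) (x : Plane) : ℝ :=
  ∫ y, inner ℝ (aN N s R (x - y)) ((2 * β * density u y) • potA s R u y + current u y)

/-- The right-hand side of the effective equation for the `j`-th orbital,
`(-i∇ + β a_N[ρ])² uⱼ + g N a_N²[ρ] uⱼ - (β a_N * (2 β a_N[ρ] ρ + J)) uⱼ`. -/
def effectiveRHS {N : ℕ} (β g s R : ℝ) (u : Fin N → Plane → ℂ) (j : Fin N) (x : Plane) : ℂ :=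
  (∑ k : Fin 2, covDeriv (e k) (fun y => β * potA s R u y k)
      (covDeriv (e k) (fun y => β * potA s R u y k) (u j)) x)
    + ((g * N * potA2 s R u x : ℝ) : ℂ) * u j x
    - ((β * potJ β s R u x : ℝ) : ℂ) * u j x

/-- `u = (u₁, …, u_N)` is a solution of class `H^m` on `[0, T]` of the effective equation:
`uⱼ ∈ C([0,T], H^m)`, the initial data are orthonormal in `L²`, and
`i ∂ₜ uⱼ = (right-hand side)` at every time, `∂ₜ` being the derivative in `L²`
(one-sided at the endpoints). -/
structure IsSolution {N : ℕ} (β g s R : ℝ) (m : ℕ) (T : ℝ) (u : Fin N → ℝ → L2Plane) :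
    Prop where
  orthonormal_init : Orthonormal ℂ (fun j => u j 0)
  continuous : ∀ j, ContinuousInH m (Set.Icc 0 T) (u j)
  equation : ∀ t ∈ Set.Icc 0 T, ∀ j, ∃ w : L2Plane,
    HasDerivWithinAt (u j) w (Set.Icc 0 T) t ∧
      ∀ᵐ x, Complex.I * w x = effectiveRHS β g s R (fun l => ⇑(u l t)) j x

/-- The kinetic energy `∑ⱼ ∫ |∇uⱼ|²`. -/
def kinetic {N : ℕ} (u : Fin N → Plane → ℂ) : ℝ :=
  ∑ j, ∫ x, ∑ k : Fin 2, ‖weakDeriv (e k) (u j) x‖ ^ 2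

/-! ### The microscopic model -/

/-- The Slater determinant `(N!)^{-1/2} ∑_σ sgn(σ) ∏ⱼ u_{σ(j)}(xⱼ)`. -/
def slater {N : ℕ} (u : Fin N → Plane → ℂ) (X : Fin N → Plane) : ℂ :=
  ((Real.sqrt (N.factorial : ℝ))⁻¹ : ℝ) *
    ∑ σ : Equiv.Perm (Fin N), ((Equiv.Perm.sign σ : ℤ) : ℂ) * ∏ j, u (σ j) (X j)

/-- The energy `⟨Ψ, H_{N,R} Ψ⟩` (the quadratic form) of the Hamiltonian
`∑ⱼ (-i∇ⱼ + β ∑_{l ≠ j} a_N(xⱼ - x_l))² + (g/2) N ∑ⱼ ∑_{l ≠ j} |a_N(xⱼ - x_l)|²`. -/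
def microEnergy {N : ℕ} (β g s R : ℝ) (Ψ : (Fin N → Plane) → ℂ) : ℝ :=
  (∑ j : Fin N, ∫ X : Fin N → Plane, ∑ k : Fin 2,
      ‖covDeriv (Pi.single j (e k))
        (fun Y : Fin N → Plane => β * ∑ l ∈ Finset.univ.erase j, aN N s R (Y j - Y l) k) Ψ X‖ ^ 2)
    + g / 2 * N * ∑ j : Fin N, ∑ l ∈ Finset.univ.erase j,
        ∫ X : Fin N → Plane, ‖aN N s R (X j - X l)‖ ^ 2 * ‖Ψ X‖ ^ 2

end ChernSimonsHartree

end

noncomputable section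

set_option linter.unusedSectionVars false

namespace ChernSimonsHartree

/-! ### Weak derivatives -/

section WeakDeriv

variable {E : Type*} [NormedAddCommGroup E] [NormedSpace ℝ E] [MeasureSpace E]

/-! The effective equation is a Hamiltonian flow. Its right-hand side is `H u_j` with one symmetric
operator `H` for all orbitals, so the Gram matrix of the orbitals is constant
(`IsSolution.orthonormal`). The vector `H u` is also half the `L²` gradient of the energy `E = ∑
‖(-i∇ + β a_N[ρ]) u_j‖² + (gN/2) ∫ ρ (|a_N|² * ρ)`, so `E` is constant (`IsSolution.energyL_eq`). It
remains to compare the kinetic energy `K` with the microscopic energy at time `0`, and with `E` at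
times `0` and `t`.

All comparisons use two quantities: a uniform bound `B` on `(|a_N| * ρ)²` and a bound `Q` on the
pair energy `∫ ρ (|a_N|² * ρ)`. For `s ≤ 1/2` one has `|a_N|² ≤ N⁻² max(1, √N/|x|)`. The singular
part, cut off at `√N`, has integral `2πN`, whatever the value of `R`. With `∫ ρ = N` this gives `B =
2 + (4π/N) ∫ ρ²` and `Q = 1 + (4π/N) ∫ ρ²` (`lintegral_mul_enorm_aN_sq_le`,
`lintegral_lintegral_aN_sq_le`). For orthonormal orbitals the Lieb-Thirring inequality `∫ ρ² ≤ 2K`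
(`lintegral_density_sq_le`, by Rumin's method) turns this into `N B ≤ 2N + 32K` and `Q ≤ 1 + 32K/N`.

For a Slater determinant, the expectation of a nonnegative function of at most three particles is at
most `3! = 6` times that in the symmetrized product state. Hence the microscopic energy is at least
`K/2 - 6β²(Q + NB)` (`microEnergy_slater_ge`). For small `β` the `K` on the right is absorbed, so
`K(0) = O(N)`. Then `E(0) = O(N)`, and `K(t) ≤ 2E + 2β² N B(t)` with a second absorption gives `K(t)
= O(N)` (`energyL_bounds`). The bound on `∫ ρ²` is Lieb-Thirring once more.

The technical work is the differentiation of `E` for curves whose time derivative exists only in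
`L²`; see `hasDerivWithinAt_norm_covL_sq`. -/

theorem hasWeakDeriv_weakDeriv {v : E} {f : E → ℂ} (h : ∃ g, HasWeakDeriv v f g) :
    HasWeakDeriv v f (weakDeriv v f) := by
  rw [weakDeriv, dif_pos h]
  exact h.choose_spec

theorem HasWeakDeriv.congr {v : E} {f g f' g' : E → ℂ} (h : HasWeakDeriv v f g)
    (hf : f =ᵐ[volume] f') (hg : g =ᵐ[volume] g') : HasWeakDeriv v f' g' := by
  obtain ⟨h1, h2, h3⟩ := h
  refine ⟨h1.congr hf, h2.congr hg, fun φ hφ hc => ?_⟩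
  have e1 : ∫ x, (fderiv ℝ φ x v) • f' x = ∫ x, (fderiv ℝ φ x v) • f x :=
    integral_congr_ae (by filter_upwards [hf] with x hx; simp [hx])
  have e2 : ∫ x, φ x • g' x = ∫ x, φ x • g x :=
    integral_congr_ae (by filter_upwards [hg] with x hx; simp [hx])
  rw [e1, e2, h3 φ hφ hc]

variable [BorelSpace E] [FiniteDimensional ℝ E]

theorem integrable_fderiv_smul {v : E} {f : E → ℂ} (hf : LocallyIntegrable f) {φ : E → ℝ}
    (hφ : ContDiff ℝ ∞ φ) (hc : HasCompactSupport φ) :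
    Integrable fun x => (fderiv ℝ φ x v) • f x := by
  refine hf.integrable_smul_left_of_hasCompactSupport ?_ (hc.fderiv_apply ℝ v)
  exact (hφ.continuous_fderiv (by simp)).clm_apply continuous_const

theorem HasWeakDeriv.add {v : E} {f g f' g' : E → ℂ} (h : HasWeakDeriv v f g)
    (h' : HasWeakDeriv v f' g') : HasWeakDeriv v (fun x => f x + f' x) (fun x => g x + g' x) := by
  obtain ⟨h1, h2, h3⟩ := h
  obtain ⟨h1', h2', h3'⟩ := h'
  refine ⟨h1.add h1', h2.add h2', fun φ hφ hc => ?_⟩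
  simp only [smul_add]
  rw [integral_add (integrable_fderiv_smul h1 hφ hc) (integrable_fderiv_smul h1' hφ hc),
    integral_add (h2.integrable_smul_left_of_hasCompactSupport hφ.continuous hc)
      (h2'.integrable_smul_left_of_hasCompactSupport hφ.continuous hc), h3 φ hφ hc, h3' φ hφ hc]
  ring

theorem HasWeakDeriv.const_mul {v : E} {f g : E → ℂ} (h : HasWeakDeriv v f g) (c : ℂ) :
    HasWeakDeriv v (fun x => c * f x) (fun x => c * g x) := by
  obtain ⟨h1, h2, h3⟩ := h
  refine ⟨h1.smul c, h2.smul c, fun φ hφ hc => ?_⟩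
  have := h3 φ hφ hc
  simp only [mul_comm c, ← smul_mul_assoc, integral_mul_const, this, neg_mul]

theorem HasWeakDeriv.sub {v : E} {f g f' g' : E → ℂ} (h : HasWeakDeriv v f g)
    (h' : HasWeakDeriv v f' g') : HasWeakDeriv v (fun x => f x - f' x) (fun x => g x - g' x) := by
  simpa [sub_eq_add_neg] using h.add (h'.const_mul (-1))

theorem HasWeakDeriv.zero (v : E) : HasWeakDeriv v (fun _ => 0) (fun _ => 0) :=
  ⟨locallyIntegrable_zero, locallyIntegrable_zero, by simp⟩

theorem HasWeakDeriv.sum {ι : Type*} {v : E} {f g : ι → E → ℂ} (s : Finset ι)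
    (h : ∀ i ∈ s, HasWeakDeriv v (f i) (g i)) :
    HasWeakDeriv v (fun x => ∑ i ∈ s, f i x) (fun x => ∑ i ∈ s, g i x) := by
  classical
  induction s using Finset.induction_on with
  | empty => simpa using HasWeakDeriv.zero v
  | insert a s ha ih =>
    simp only [Finset.sum_insert ha]
    exact (h a (by simp)).add (ih fun i hi => h i (by simp [hi]))

theorem HasWeakDeriv.ae_unique {v : E} {f g g' : E → ℂ} (h : HasWeakDeriv v f g)
    (h' : HasWeakDeriv v f g') : g =ᵐ[volume] g' := by
  refine ae_eq_of_integral_contDiff_smul_eq h.2.1 h'.2.1 fun φ hφ hc => ?_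
  have := (h.2.2 φ hφ hc).symm.trans (h'.2.2 φ hφ hc)
  simpa using this

/-- `weakDeriv` is an arbitrary choice, so it is only ever used through this identification with a
known derivative. -/
theorem HasWeakDeriv.weakDeriv_ae_eq {v : E} {f g : E → ℂ} (h : HasWeakDeriv v f g) :
    weakDeriv v f =ᵐ[volume] g :=
  (hasWeakDeriv_weakDeriv ⟨g, h⟩).ae_unique h

end WeakDeriv

/-! ### Weak derivatives and the Fourier transform on the plane -/

/-- Compact support of the test function can be dropped: multiply by the cutoff `χ(x/(n+1))` and let
`n → ∞`. The derivative of the cutoff carries a factor `1/(n+1)`, and all products are dominated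
since both factors are in `L²`. -/
theorem HasWeakDeriv.integral_of_memLp_real {v : Plane} {f g : Plane → ℂ} (h : HasWeakDeriv v f g)
    (hf : MemLp f 2) (hg : MemLp g 2) {ψ : Plane → ℝ} (hψ : ContDiff ℝ ∞ ψ) (h0 : MemLp ψ 2)
    (h1 : MemLp (fun x => fderiv ℝ ψ x v) 2) :
    ∫ x, (fderiv ℝ ψ x v) • f x = - ∫ x, ψ x • g x := by
  let χ : ContDiffBump (0 : Plane) := ⟨1, 2, by norm_num, by norm_num⟩
  have hχ : ContDiff ℝ ∞ χ := χ.contDiff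
  have hcont : Continuous fun x => fderiv ℝ χ x v :=
    (hχ.continuous_fderiv (by simp)).clm_apply continuous_const
  obtain ⟨C, hC⟩ : ∃ C, ∀ x, ‖fderiv ℝ χ x v‖ ≤ C :=
    hcont.bounded_above_of_compact_support (χ.hasCompactSupport.fderiv_apply ℝ v)
  have hC0 : 0 ≤ C := (norm_nonneg _).trans (hC 0)
  let c : ℕ → ℝ := fun n => (1 / ((n : ℝ) + 1))
  have hc0 : ∀ n, 0 < c n := fun n => by positivity
  have hc1 : ∀ n, c n ≤ 1 := fun n => by
    simp only [c]; rw [div_le_one (by positivity)]; linarith [(Nat.cast_nonneg n : (0 : ℝ) ≤ n)]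
  have hct : Tendsto c atTop (𝓝 0) := tendsto_one_div_add_atTop_nhds_zero_nat
  let ψn : ℕ → Plane → ℝ := fun n x => χ (c n • x) * ψ x
  have hψd : Differentiable ℝ ψ := hψ.differentiable (by simp)
  have hχd : Differentiable ℝ χ := hχ.differentiable (by simp)
  have hd : ∀ n x, fderiv ℝ (ψn n) x v
      = χ (c n • x) * fderiv ℝ ψ x v + ψ x * (c n * fderiv ℝ χ (c n • x) v) := by
    intro n x
    have e1 : HasFDerivAt (fun x => χ (c n • x))
        ((fderiv ℝ χ (c n • x)).comp (c n • ContinuousLinearMap.id ℝ Plane)) x :=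
      (hχd _).hasFDerivAt.comp x ((hasFDerivAt_id x).const_smul (c n))
    have e2 := e1.mul (hψd x).hasFDerivAt
    have e3 := e2.fderiv
    change fderiv ℝ (ψn n) x = _ at e3
    rw [e3]
    simp
  have key : ∀ n, ∫ x, (fderiv ℝ (ψn n) x v) • f x = - ∫ x, ψn n x • g x := by
    intro n
    refine h.2.2 _ ((hχ.comp (contDiff_const_smul (c n))).mul hψ) ?_
    refine HasCompactSupport.mul_right ?_
    exact χ.hasCompactSupport.comp_homeomorph (Homeomorph.smulOfNeZero (c n) (hc0 n).ne')
  have hχlim : ∀ x, Tendsto (fun n => χ (c n • x)) atTop (𝓝 1) := by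
    intro x
    have : Tendsto (fun n => χ (c n • x)) atTop (𝓝 (χ 0)) := by
      refine (hχ.continuous.tendsto 0).comp ?_
      simpa using hct.smul_const x
    rwa [χ.one_of_mem_closedBall (by simp [χ])] at this
  have hmulint : ∀ {p : Plane → ℝ} {q : Plane → ℂ}, MemLp p 2 → MemLp q 2 →
      Integrable fun x => ‖p x‖ * ‖q x‖ := fun hp hq => hp.norm.integrable_mul hq.norm
  have l1 : Tendsto (fun n => ∫ x, (fderiv ℝ (ψn n) x v) • f x) atTop
      (𝓝 (∫ x, (fderiv ℝ ψ x v) • f x)) := by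
    refine tendsto_integral_of_dominated_convergence
      (fun x => ‖fderiv ℝ ψ x v‖ * ‖f x‖ + C * (‖ψ x‖ * ‖f x‖)) ?_ ?_ ?_ ?_
    · intro n
      have : AEStronglyMeasurable (fun x => fderiv ℝ (ψn n) x v) := by
        simp only [hd]
        refine AEStronglyMeasurable.add (AEStronglyMeasurable.mul ?_ h1.1)
          (h0.1.mul (AEStronglyMeasurable.const_mul ?_ _))
        · exact (hχ.continuous.comp (continuous_const_smul _)).aestronglyMeasurable
        · exact (hcont.comp (continuous_const_smul _)).aestronglyMeasurable
      exact this.smul hf.1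
    · exact (hmulint h1 hf).add ((hmulint h0 hf).const_mul C)
    · intro n
      refine Eventually.of_forall fun x => ?_
      rw [norm_smul, hd]
      have a1 : ‖χ (c n • x) * fderiv ℝ ψ x v‖ ≤ ‖fderiv ℝ ψ x v‖ := by
        rw [norm_mul, Real.norm_of_nonneg χ.nonneg]
        exact mul_le_of_le_one_left (norm_nonneg _) χ.le_one
      have a2 : ‖ψ x * (c n * fderiv ℝ χ (c n • x) v)‖ ≤ ‖ψ x‖ * C := by
        rw [norm_mul, norm_mul, Real.norm_of_nonneg (hc0 n).le]
        gcongr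
        calc c n * ‖fderiv ℝ χ (c n • x) v‖ ≤ 1 * C :=
              mul_le_mul (hc1 n) (hC _) (norm_nonneg _) zero_le_one
          _ = C := one_mul C
      calc _ ≤ (‖fderiv ℝ ψ x v‖ + ‖ψ x‖ * C) * ‖f x‖ := by
            gcongr; exact (norm_add_le _ _).trans (add_le_add a1 a2)
        _ = _ := by ring
    · refine Eventually.of_forall fun x => ?_
      refine Tendsto.smul_const ?_ _
      simp only [hd]
      have a1 : Tendsto (fun n => χ (c n • x) * fderiv ℝ ψ x v) atTop (𝓝 (1 * fderiv ℝ ψ x v)) :=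
        (hχlim x).mul_const _
      have a2 : Tendsto (fun n => c n * fderiv ℝ χ (c n • x) v) atTop (𝓝 0) := by
        refine squeeze_zero_norm (a := fun n => c n * C) (fun n => ?_) (by simpa using hct.mul_const C)
        rw [norm_mul, Real.norm_of_nonneg (hc0 n).le]
        exact mul_le_mul_of_nonneg_left (hC _) (hc0 n).le
      simpa using a1.add (a2.const_mul (ψ x))
  have l2 : Tendsto (fun n => - ∫ x, ψn n x • g x) atTop (𝓝 (- ∫ x, ψ x • g x)) := by
    refine Tendsto.neg ?_
    refine tendsto_integral_of_dominated_convergence (fun x => ‖ψ x‖ * ‖g x‖) ?_ ?_ ?_ ?_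
    · intro n
      exact ((hχ.continuous.comp (continuous_const_smul _)).aestronglyMeasurable.mul h0.1).smul hg.1
    · exact hmulint h0 hg
    · intro n
      refine Eventually.of_forall fun x => ?_
      rw [norm_smul, norm_mul, Real.norm_of_nonneg χ.nonneg]
      gcongr
      exact mul_le_of_le_one_left (norm_nonneg _) χ.le_one
    · refine Eventually.of_forall fun x => ?_
      refine Tendsto.smul_const ?_ _
      simpa using (hχlim x).mul_const (ψ x)
  simp only [key] at l1
  exact tendsto_nhds_unique l1 l2

open scoped SchwartzMap FourierTransform LineDeriv

/-- Test functions in `HasWeakDeriv` are real, so real and imaginary parts are treated separately.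
The outcome says that the weak derivative is the derivative as a tempered distribution. -/
theorem HasWeakDeriv.integral_schwartz {v : Plane} {f g : Plane → ℂ} (h : HasWeakDeriv v f g)
    (hf : MemLp f 2) (hg : MemLp g 2) (φ : 𝓢(Plane, ℂ)) :
    ∫ x, (∂_{v} φ) x • f x = - ∫ x, φ x • g x := by
  have hφ : ContDiff ℝ ∞ φ := φ.smooth'
  have hφd : Differentiable ℝ φ := hφ.differentiable (by simp)
  have hm : MemLp φ 2 := φ.memLp 2
  have hm' : MemLp (∂_{v} φ : 𝓢(Plane, ℂ)) 2 := SchwartzMap.memLp (∂_{v} φ : 𝓢(Plane, ℂ)) 2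
  have hre : ∀ x, fderiv ℝ (fun y => (φ y).re) x v = ((∂_{v} φ) x).re := by
    intro x
    have := (Complex.reCLM.hasFDerivAt.comp x (hφd x).hasFDerivAt).fderiv
    simp only [Function.comp_def, Complex.reCLM_apply] at this
    rw [this]
    simp [SchwartzMap.lineDerivOp_apply_eq_fderiv]
  have him : ∀ x, fderiv ℝ (fun y => (φ y).im) x v = ((∂_{v} φ) x).im := by
    intro x
    have := (Complex.imCLM.hasFDerivAt.comp x (hφd x).hasFDerivAt).fderiv
    simp only [Function.comp_def, Complex.imCLM_apply] at this
    rw [this]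
    simp [SchwartzMap.lineDerivOp_apply_eq_fderiv]
  have A := h.integral_of_memLp_real hf hg (ψ := fun y => (φ y).re)
    (Complex.reCLM.contDiff.comp hφ) hm.re (by simp only [hre]; exact hm'.re)
  have B := h.integral_of_memLp_real hf hg (ψ := fun y => (φ y).im)
    (Complex.imCLM.contDiff.comp hφ) hm.im (by simp only [him]; exact hm'.im)
  simp only [hre] at A
  simp only [him] at B
  have split : ∀ {p q : Plane → ℂ}, MemLp p 2 → MemLp q 2 →
      ∫ x, p x • q x = (∫ x, (p x).re • q x) + Complex.I * ∫ x, (p x).im • q x := by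
    intro p q hp hq
    have i1 : Integrable fun x => (p x).re • q x := memLp_one_iff_integrable.1 (hq.smul hp.re)
    have i2 : Integrable fun x => (p x).im • q x := memLp_one_iff_integrable.1 (hq.smul hp.im)
    rw [← integral_const_mul, ← integral_add i1 (i2.const_mul _)]
    congr 1 with x
    conv_lhs => rw [← Complex.re_add_im (p x)]
    simp only [smul_eq_mul, Complex.real_smul]
    ring
  rw [split hm' hf, split hm hg, A, B]
  ring

/-- This is the Fourier rule for tempered distributions. It is kept in tested form because the
multiplier is unbounded and its product with `𝓕 f` is not known beforehand to lie in `L²`. -/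
theorem HasWeakDeriv.fourier_schwartz {v : Plane} {f g : L2Plane} (h : HasWeakDeriv v f g)
    (φ : 𝓢(Plane, ℂ)) :
    ∫ x, φ x • (𝓕 g : L2Plane) x
      = ∫ x, φ x • ((2 * Real.pi * Complex.I) * ((inner ℝ x v : ℝ) : ℂ) * (𝓕 f : L2Plane) x) := by
  have hfg : (∂_{v} (f : 𝓢'(Plane, ℂ)) : 𝓢'(Plane, ℂ)) = (g : 𝓢'(Plane, ℂ)) := by
    ext φ
    have := h.integral_schwartz (Lp.memLp f) (Lp.memLp g) φ
    rw [TemperedDistribution.lineDerivOp_apply_apply, map_neg,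
      Lp.toTemperedDistribution_apply, Lp.toTemperedDistribution_apply, this, neg_neg]
  have hF := TemperedDistribution.fourier_lineDerivOp_eq (f : 𝓢'(Plane, ℂ)) v
  rw [hfg, Lp.fourier_toTemperedDistribution_eq, Lp.fourier_toTemperedDistribution_eq] at hF
  have h3 := DFunLike.congr_fun hF φ
  have htg : (fun x : Plane => (inner ℝ x v : ℝ)).HasTemperateGrowth := by fun_prop
  have e1 : ((2 * Real.pi * Complex.I) • TemperedDistribution.smulLeftCLM ℂ
      (fun x : Plane => ((inner ℝ x v : ℝ) : ℂ)) ((𝓕 f : L2Plane) : 𝓢'(Plane, ℂ))) φ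
      = (2 * Real.pi * Complex.I) • ((𝓕 f : L2Plane) : 𝓢'(Plane, ℂ))
        (SchwartzMap.smulLeftCLM ℂ (fun x : Plane => (inner ℝ x v : ℝ)) φ) := by
    rw [← SchwartzMap.smulLeftCLM_ofReal ℂ htg]
    rfl
  rw [e1, Lp.toTemperedDistribution_apply, Lp.toTemperedDistribution_apply] at h3
  rw [h3, ← integral_smul]
  congr 1 with x
  rw [SchwartzMap.smulLeftCLM_apply_apply htg]
  simp only [smul_eq_mul, Complex.real_smul]
  ring

/-- The Fourier transform turns weak derivatives into multiplications. -/
theorem HasWeakDeriv.fourier_ae {v : Plane} {f g : L2Plane} (h : HasWeakDeriv v f g) :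
    ∀ᵐ p : Plane, (𝓕 g : L2Plane) p
      = (2 * Real.pi * Complex.I) * ((inner ℝ p v : ℝ) : ℂ) * (𝓕 f : L2Plane) p := by
  have hcont : Continuous fun p : Plane => (2 * Real.pi * Complex.I) * ((inner ℝ p v : ℝ) : ℂ) := by
    fun_prop
  refine ae_eq_of_integral_contDiff_smul_eq ?_ ?_ fun φ hφ hc => ?_
  · exact (Lp.memLp _).locallyIntegrable (by norm_num)
  · exact ((Lp.memLp (𝓕 f : L2Plane)).locallyIntegrable (by norm_num)).continuous_smul hcont
  · have hc' : HasCompactSupport (fun x => (φ x : ℂ)) :=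
      HasCompactSupport.comp_left (g := fun t : ℝ => (t : ℂ)) hc Complex.ofReal_zero
    have hφ' : ContDiff ℝ ∞ (fun x => (φ x : ℂ)) :=
      (Complex.ofRealCLM.contDiff (n := ∞)).comp hφ
    exact h.fourier_schwartz (hc'.toSchwartzMap hφ')

/-- Integration by parts for square-integrable functions with square-integrable weak derivatives. -/
theorem HasWeakDeriv.inner_eq_neg {v : Plane} {f f' g g' : L2Plane} (hf : HasWeakDeriv v f f')
    (hg : HasWeakDeriv v g g') : inner ℂ f' g = - inner ℂ f g' := by
  rw [← Lp.inner_fourier_eq, ← Lp.inner_fourier_eq f, L2.inner_def, L2.inner_def, ← integral_neg]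
  refine integral_congr_ae ?_
  filter_upwards [hf.fourier_ae, hg.fourier_ae] with p h1 h2
  rw [h1, h2]
  simp [Complex.conj_ofNat]
  ring

/-! ### The kinetic Lieb-Thirring inequality -/

theorem continuous_neg_inner : Continuous fun p : Plane × Plane => (-innerₗ Plane) p.1 p.2 := by
  simp only [LinearMap.neg_apply, innerₗ_apply_apply]
  fun_prop

/-- The `L²` inverse transform is not defined by an integral. On `L¹ ∩ L²` it agrees with the
integral because in both cases the transform can be moved onto a test function. This gives
low-frequency parts with a value at every point, as Bessel's inequality below requires. -/
theorem Lp_fourierInv_ae_eq {f : Plane → ℂ} (h2 : MemLp f 2) (h1 : Integrable f) :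
    (𝓕⁻ (h2.toLp f) : L2Plane) =ᵐ[volume] (𝓕⁻ f : Plane → ℂ) := by
  have hcont : Continuous (𝓕⁻ f : Plane → ℂ) :=
    VectorFourier.fourierIntegral_continuous Real.continuous_fourierChar
      continuous_neg_inner h1
  refine ae_eq_of_integral_contDiff_smul_eq
    ((Lp.memLp _).locallyIntegrable (by norm_num)) hcont.locallyIntegrable fun φ hφ hc => ?_
  have hc' : HasCompactSupport (fun x => (φ x : ℂ)) :=
      HasCompactSupport.comp_left (g := fun t : ℝ => (t : ℂ)) hc Complex.ofReal_zero
  have hφ' : ContDiff ℝ ∞ (fun x => (φ x : ℂ)) :=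
      (Complex.ofRealCLM.contDiff (n := ∞)).comp hφ
  let ψ : 𝓢(Plane, ℂ) := hc'.toSchwartzMap hφ'
  have e1 : ((𝓕⁻ (h2.toLp f) : L2Plane) : 𝓢'(Plane, ℂ)) ψ = ∫ x, (𝓕⁻ ψ : 𝓢(Plane, ℂ)) x • f x := by
    rw [← Lp.fourierInv_toTemperedDistribution_eq, TemperedDistribution.fourierInv_apply,
      Lp.toTemperedDistribution_apply]
    refine integral_congr_ae ?_
    filter_upwards [h2.coeFn_toLp] with x hx
    rw [hx]
  rw [Lp.toTemperedDistribution_apply] at e1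
  have e2 : ∫ x, (𝓕⁻ ψ : 𝓢(Plane, ℂ)) x • f x = ∫ x, ψ x • (𝓕⁻ f : Plane → ℂ) x := by
    rw [SchwartzMap.fourierInv_coe]
    have := VectorFourier.integral_fourierIntegral_smul_eq_flip (μ := (volume : Measure Plane))
      (ν := (volume : Measure Plane)) (L := -innerₗ Plane) (f := ψ) (g := f)
      Real.continuous_fourierChar
      continuous_neg_inner ψ.integrable h1
    have hflip : (-innerₗ Plane).flip = -innerₗ Plane := by
      ext x y; simp [real_inner_comm]
    rw [hflip] at this
    exact this
  rw [e2] at e1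
  exact e1

/-- The part of `𝓕⁻ F` with frequencies at most `r`. -/
def lowFreq (F : Plane → ℂ) (r : ℝ) (x : Plane) : ℂ :=
  ∫ p : Plane, (Metric.closedBall (0 : Plane) r).indicator
    (fun p => Complex.exp (↑(2 * Real.pi * inner ℝ p x) * Complex.I) * F p) p

theorem lowFreq_eq (F : Plane → ℂ) (r : ℝ) :
    lowFreq F r = 𝓕⁻ ((Metric.closedBall (0 : Plane) r).indicator F) := by
  ext x
  rw [Real.fourierInv_eq', lowFreq]
  congr 1 with p
  by_cases hp : p ∈ Metric.closedBall (0 : Plane) r <;> simp [hp]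

theorem memLp_indicator_closedBall {F : Plane → ℂ} (hF : MemLp F 2) (r : ℝ) :
    MemLp ((Metric.closedBall (0 : Plane) r).indicator F) 2 :=
  hF.indicator Metric.isClosed_closedBall.measurableSet

theorem integrable_indicator_closedBall {F : Plane → ℂ} (hF : MemLp F 2) (r : ℝ) :
    Integrable ((Metric.closedBall (0 : Plane) r).indicator F) := by
  rw [integrable_indicator_iff Metric.isClosed_closedBall.measurableSet]
  have : IsFiniteMeasure ((volume : Measure Plane).restrict (Metric.closedBall (0 : Plane) r)) :=
    ⟨by rw [Measure.restrict_apply_univ]; exact measure_closedBall_lt_top⟩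
  exact (hF.restrict _).integrable (by norm_num)

theorem lintegral_enorm_sq (f : L2Plane) : ∫⁻ x, ‖f x‖ₑ ^ 2 = ‖f‖ₑ ^ 2 := by
  rw [Lp.enorm_def]
  have := eLpNorm_nnreal_pow_eq_lintegral (f := f) (μ := volume) (p := 2) (by norm_num)
  norm_num at this
  exact this.symm

/-- Plancherel: the difference has Fourier transform `𝓕 u` restricted to the complement of the ball.
-/
theorem lintegral_enorm_sub_lowFreq (u : L2Plane) (r : ℝ) :
    ∫⁻ x, ‖u x - lowFreq (𝓕 u : L2Plane) r x‖ₑ ^ 2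
      = ∫⁻ p, (Metric.closedBall (0 : Plane) r)ᶜ.indicator (fun p => ‖(𝓕 u : L2Plane) p‖ₑ ^ 2) p := by
  set F : L2Plane := 𝓕 u
  have h2 := memLp_indicator_closedBall (Lp.memLp F) r
  have h1 := integrable_indicator_closedBall (Lp.memLp F) r
  have hlow := Lp_fourierInv_ae_eq h2 h1
  have hsq := lintegral_enorm_sq
  have hu : u = 𝓕⁻ F := (FourierTransform.fourierInv_fourier_eq u).symm
  have e1 : ∫⁻ x, ‖u x - lowFreq F r x‖ₑ ^ 2 = ‖u - 𝓕⁻ (h2.toLp _)‖ₑ ^ 2 := by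
    rw [← hsq]
    refine lintegral_congr_ae ?_
    filter_upwards [hlow, Lp.coeFn_sub u (𝓕⁻ (h2.toLp _))] with x hx hy
    rw [hy, Pi.sub_apply, hx, lowFreq_eq]
  have e2 : ‖u - 𝓕⁻ (h2.toLp _)‖ₑ = ‖F - h2.toLp _‖ₑ := by
    conv_lhs => rw [hu]
    change ‖(Lp.fourierTransformₗᵢ Plane ℂ).symm F - (Lp.fourierTransformₗᵢ Plane ℂ).symm _‖ₑ = _
    rw [← map_sub, ← ofReal_norm, ← ofReal_norm, LinearIsometryEquiv.norm_map]
  rw [e1, e2, ← hsq]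
  refine lintegral_congr_ae ?_
  filter_upwards [h2.coeFn_toLp, Lp.coeFn_sub F (h2.toLp _)] with p hp hq
  rw [hq, Pi.sub_apply, hp]
  by_cases h : p ∈ Metric.closedBall (0 : Plane) r <;> simp [h]

/-- At fixed `x` each low-frequency value is, up to conjugation, the inner product of `F j` with one
plane wave restricted to the ball. The squared norm of that wave is the area `π r²`, and Bessel's
inequality concludes. This is the only use of orthogonality in the Lieb-Thirring inequality. -/
theorem sum_norm_lowFreq_sq_le {N : ℕ} {F : Fin N → L2Plane} (hF : Orthonormal ℂ F) {r : ℝ}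
    (hr : 0 ≤ r) (x : Plane) : ∑ j, ‖lowFreq (F j) r x‖ ^ 2 ≤ Real.pi * r ^ 2 := by
  let G : Plane → ℂ := (Metric.closedBall (0 : Plane) r).indicator
    fun p => Complex.exp (-(↑(2 * Real.pi * inner ℝ p x) * Complex.I))
  have hnorm : ∀ p, ‖G p‖ = (Metric.closedBall (0 : Plane) r).indicator (fun _ => (1 : ℝ)) p := by
    intro p
    by_cases h : p ∈ Metric.closedBall (0 : Plane) r
    · simp only [G, Set.indicator_of_mem h]
      rw [← neg_mul, ← Complex.ofReal_neg, Complex.norm_exp_ofReal_mul_I]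
    · simp [G, h]
  have hGm : MemLp G 2 := by
    have : MemLp ((Metric.closedBall (0 : Plane) r).indicator fun _ => (1 : ℝ)) 2 :=
      memLp_indicator_const 2 Metric.isClosed_closedBall.measurableSet 1
        (Or.inr measure_closedBall_lt_top.ne)
    refine this.mono ?_ (Eventually.of_forall fun p => ?_)
    · refine AEStronglyMeasurable.indicator ?_ Metric.isClosed_closedBall.measurableSet
      exact Continuous.aestronglyMeasurable (by fun_prop)
    · rw [hnorm, Real.norm_of_nonneg (Set.indicator_nonneg (fun _ _ => zero_le_one) p)]
  have hlow : ∀ j, ‖lowFreq (F j) r x‖ = ‖inner ℂ (F j) (hGm.toLp G)‖ := by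
    intro j
    rw [norm_inner_symm, L2.inner_def, lowFreq]
    congr 1
    refine integral_congr_ae ?_
    filter_upwards [hGm.coeFn_toLp] with p hp
    rw [hp]
    by_cases h : p ∈ Metric.closedBall (0 : Plane) r
    · simp only [G, Set.indicator_of_mem h, RCLike.inner_apply, ← Complex.exp_conj, map_neg, map_mul,
        Complex.conj_ofReal, Complex.conj_I, mul_neg, neg_neg]
      ring
    · simp [G, h]
  have hG2 : ‖hGm.toLp G‖ ^ 2 = Real.pi * r ^ 2 := by
    have : ‖hGm.toLp G‖ ^ 2 = ∫ p, ‖G p‖ ^ 2 := by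
      rw [← @inner_self_eq_norm_sq ℂ, L2.inner_def, ← integral_re]
      · refine integral_congr_ae ?_
        filter_upwards [hGm.coeFn_toLp] with p hp
        rw [hp, inner_self_eq_norm_sq]
      · exact L2.integrable_inner _ _
    rw [this]
    have e : ∀ p, ‖G p‖ ^ 2 = (Metric.closedBall (0 : Plane) r).indicator (fun _ => (1 : ℝ)) p := by
      intro p
      rw [hnorm]
      by_cases h : p ∈ Metric.closedBall (0 : Plane) r <;> simp [h]
    simp only [e]
    rw [integral_indicator_const _ Metric.isClosed_closedBall.measurableSet, Measure.real,
      EuclideanSpace.volume_closedBall_fin_two]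
    simp [ENNReal.toReal_ofReal hr, Real.pi_pos.le, mul_comm]
  simp only [hlow]
  rw [← hG2]
  exact hF.sum_inner_products_le _

theorem stronglyMeasurable_lowFreq (F : L2Plane) :
    StronglyMeasurable fun z : Plane × ℝ => lowFreq F z.2 z.1 := by
  refine StronglyMeasurable.integral_prod_right
    (f := fun (z : Plane × ℝ) (p : Plane) => (Metric.closedBall (0 : Plane) z.2).indicator
      (fun p => Complex.exp (↑(2 * Real.pi * inner ℝ p z.1) * Complex.I) * F p) p) ?_
  have : (Function.uncurry fun (z : Plane × ℝ) (p : Plane) =>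
      (Metric.closedBall (0 : Plane) z.2).indicator
      (fun p => Complex.exp (↑(2 * Real.pi * inner ℝ p z.1) * Complex.I) * F p) p)
      = {w : (Plane × ℝ) × Plane | ‖w.2‖ ≤ w.1.2}.indicator
        fun w => Complex.exp (↑(2 * Real.pi * inner ℝ w.2 w.1.1) * Complex.I) * F w.2 := by
    ext ⟨z, p⟩
    by_cases h : ‖p‖ ≤ z.2
    · rw [Set.indicator_of_mem (by exact h), Function.uncurry_apply_pair,
        Set.indicator_of_mem (by simpa using h)]
    · rw [Set.indicator_of_notMem (by exact h), Function.uncurry_apply_pair,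
        Set.indicator_of_notMem (by simpa using h)]
  rw [this]
  refine StronglyMeasurable.indicator ?_ (measurableSet_le (by fun_prop) (by fun_prop))
  refine StronglyMeasurable.mul ?_ ((Lp.stronglyMeasurable F).comp_measurable measurable_snd)
  exact Continuous.stronglyMeasurable (by fun_prop)

theorem lintegral_Ioc_two_mul {r : ℝ} (hr : 0 ≤ r) :
    ∫⁻ t in Set.Ioc 0 r, ENNReal.ofReal (2 * t) = ENNReal.ofReal (r ^ 2) := by
  rw [← ofReal_integral_eq_lintegral_ofReal]
  · rw [← intervalIntegral.integral_of_le hr, intervalIntegral.integral_const_mul, integral_id]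
    congr 1; ring
  · exact (continuous_const.mul continuous_id).integrableOn_Ioc
  · filter_upwards [ae_restrict_mem measurableSet_Ioc] with t ht
    have := ht.1
    simp; linarith

/-- Layer cake: the indicator restricts to `t < ‖p‖`, and `∫ 2t dt` over `(0, ‖p‖]` is `‖p‖²`. -/
theorem lintegral_Ioi_high (c : ENNReal) (p : Plane) :
    ∫⁻ t in Set.Ioi (0 : ℝ), ENNReal.ofReal (2 * t) *
      (Metric.closedBall (0 : Plane) t)ᶜ.indicator (fun _ => c) p ≤ ENNReal.ofReal (‖p‖ ^ 2) * c := by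
  rw [← lintegral_Ioc_two_mul (norm_nonneg p), ← lintegral_mul_const _ (by fun_prop),
    ← lintegral_indicator measurableSet_Ioi, ← lintegral_indicator measurableSet_Ioc]
  refine lintegral_mono fun t => ?_
  by_cases ht : 0 < t
  · rw [Set.indicator_of_mem (show t ∈ Set.Ioi 0 from ht)]
    by_cases hp : t < ‖p‖
    · rw [Set.indicator_of_mem (show t ∈ Set.Ioc 0 ‖p‖ from ⟨ht, hp.le⟩)]
      gcongr
      exact Set.indicator_le_self _ _ _
    · rw [Set.indicator_of_notMem (by simpa using hp)]
      simp
  · rw [Set.indicator_of_notMem (by simpa using ht)]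
    simp

theorem lintegral_high_le (u : L2Plane) :
    ∫⁻ x, ∫⁻ t in Set.Ioi (0 : ℝ), ENNReal.ofReal (2 * t) *
      ‖u x - lowFreq (𝓕 u : L2Plane) t x‖ₑ ^ 2
      ≤ ∫⁻ p, ENNReal.ofReal (‖p‖ ^ 2) * ‖(𝓕 u : L2Plane) p‖ₑ ^ 2 := by
  set F : L2Plane := 𝓕 u with hFdef
  have m1 : Measurable fun z : Plane × ℝ => ENNReal.ofReal (2 * z.2) * ‖u z.1 - lowFreq F z.2 z.1‖ₑ ^ 2 := by
    have a : Measurable fun z : Plane × ℝ => u z.1 :=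
      (Lp.stronglyMeasurable u).measurable.comp measurable_fst
    have b := (stronglyMeasurable_lowFreq F).measurable
    have c := ((a.sub b).enorm.pow_const 2)
    exact Measurable.mul (by fun_prop) c
  rw [lintegral_lintegral_swap m1.aemeasurable]
  have m2 : Measurable fun z : ℝ × Plane => ENNReal.ofReal (2 * z.1) *
      (Metric.closedBall (0 : Plane) z.1)ᶜ.indicator (fun p => ‖F p‖ₑ ^ 2) z.2 := by
    refine Measurable.mul (by fun_prop) ?_
    have : (fun z : ℝ × Plane => (Metric.closedBall (0 : Plane) z.1)ᶜ.indicator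
        (fun p => ‖F p‖ₑ ^ 2) z.2)
        = {z : ℝ × Plane | z.1 < ‖z.2‖}.indicator fun z => ‖F z.2‖ₑ ^ 2 := by
      ext ⟨t, p⟩
      by_cases h : t < ‖p‖
      · rw [Set.indicator_of_mem (by simpa using h), Set.indicator_of_mem (by exact h)]
      · rw [Set.indicator_of_notMem (by simpa using h), Set.indicator_of_notMem (by exact h)]
    rw [this]
    refine Measurable.indicator ?_ (measurableSet_lt (by fun_prop) (by fun_prop))
    exact ((Lp.stronglyMeasurable F).measurable.comp measurable_snd).enorm.pow_const 2
  calc ∫⁻ t in Set.Ioi (0 : ℝ), ∫⁻ x, ENNReal.ofReal (2 * t) * ‖u x - lowFreq F t x‖ₑ ^ 2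
      = ∫⁻ t in Set.Ioi (0 : ℝ), ∫⁻ p, ENNReal.ofReal (2 * t) *
        (Metric.closedBall (0 : Plane) t)ᶜ.indicator (fun p => ‖F p‖ₑ ^ 2) p := by
        congr 1 with t
        rw [lintegral_const_mul' _ _ ENNReal.ofReal_ne_top,
          lintegral_const_mul' _ _ ENNReal.ofReal_ne_top, lintegral_enorm_sub_lowFreq]
    _ = ∫⁻ p, ∫⁻ t in Set.Ioi (0 : ℝ), ENNReal.ofReal (2 * t) *
        (Metric.closedBall (0 : Plane) t)ᶜ.indicator (fun p => ‖F p‖ₑ ^ 2) p :=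
        lintegral_lintegral_swap m2.aemeasurable
    _ ≤ _ := by
        refine lintegral_mono fun p => ?_
        refine le_trans (le_of_eq ?_) (lintegral_Ioi_high (‖F p‖ₑ ^ 2) p)
        congr 1 with t

/-- The factor `4π²` comes from the convention `exp(-2πi⟨x,p⟩)` for the Fourier transform. -/
theorem lintegral_norm_sq_fourier {u : L2Plane} {w : Fin 2 → L2Plane}
    (hw : ∀ k, HasWeakDeriv (e k) u (w k)) :
    ∫⁻ p, ENNReal.ofReal (‖p‖ ^ 2) * ‖(𝓕 u : L2Plane) p‖ₑ ^ 2
      = ENNReal.ofReal ((4 * Real.pi ^ 2)⁻¹ * ∑ k, ‖w k‖ ^ 2) := by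
  set F : L2Plane := 𝓕 u with hFdef
  have h1 : ∀ k, ∫⁻ p : Plane, ENNReal.ofReal (4 * Real.pi ^ 2 * (p k) ^ 2) * ‖F p‖ₑ ^ 2
      = ENNReal.ofReal (‖w k‖ ^ 2) := by
    intro k
    have e1 : ‖w k‖ = ‖(𝓕 (w k) : L2Plane)‖ := (Lp.norm_fourier_eq _).symm
    rw [e1, ENNReal.ofReal_pow (norm_nonneg _), ofReal_norm, ← lintegral_enorm_sq]
    refine lintegral_congr_ae ?_
    filter_upwards [(hw k).fourier_ae] with p hp
    rw [hp, enorm_mul, mul_pow]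
    congr 1
    rw [← ofReal_norm, ← ENNReal.ofReal_pow (norm_nonneg _)]
    congr 1
    have : inner ℝ p (e k) = p k := by
      simp [e, EuclideanSpace.inner_single_right]
    rw [this]
    have h4 : ‖(2 * Real.pi * Complex.I : ℂ)‖ = 2 * Real.pi := by
      simp [Real.pi_pos.le]
    rw [norm_mul, h4, Complex.norm_real, mul_pow, Real.norm_eq_abs, sq_abs]
    ring
  rw [ENNReal.ofReal_mul (by positivity), ENNReal.ofReal_sum_of_nonneg (fun _ _ => by positivity)]
  simp only [← h1]
  have hm : Measurable fun p => ‖F p‖ₑ ^ 2 := (Lp.stronglyMeasurable F).measurable.enorm.pow_const 2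
  have hm' : ∀ k : Fin 2, Measurable fun p : Plane =>
      ENNReal.ofReal (4 * Real.pi ^ 2 * (p k) ^ 2) * ‖F p‖ₑ ^ 2 := fun k =>
    Measurable.mul (by fun_prop) hm
  rw [← lintegral_finsetSum _ (fun k _ => hm' k),
    ← lintegral_const_mul' _ _ ENNReal.ofReal_ne_top]
  congr 1 with p
  rw [← Finset.sum_mul, ← ENNReal.ofReal_sum_of_nonneg (fun _ _ => by positivity), ← mul_assoc,
    ← ENNReal.ofReal_mul (by positivity)]
  congr 2
  rw [EuclideanSpace.norm_sq_eq, ← Finset.mul_sum]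
  have := Real.pi_pos.ne'
  simp
  field_simp

/-- Rumin's argument at a point. With `r² = ρ/(4π)`, the low-frequency part at any scale `t ≤ r`
carries at most `π t² ≤ ρ/4`. Since `ρ ≤ 2·high + 2·low`, the high part is at least `ρ/4`.
Integrating `2t dt` over `(0, r]` gives `r² ρ/4 = ρ²/(16π)`. -/
theorem ofReal_density_sq_le {N : ℕ} {u : Fin N → L2Plane} (ho : Orthonormal ℂ u) (x : Plane) :
    ENNReal.ofReal (density (fun j => u j) x ^ 2) ≤ ENNReal.ofReal (16 * Real.pi) *
      ∑ j, ∫⁻ t in Set.Ioi (0 : ℝ), ENNReal.ofReal (2 * t) *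
        ‖u j x - lowFreq (𝓕 (u j) : L2Plane) t x‖ₑ ^ 2 := by
  have hF : Orthonormal ℂ fun j => (𝓕 (u j) : L2Plane) :=
    ho.comp_linearIsometryEquiv (Lp.fourierTransformₗᵢ Plane ℂ)
  set ρ := density (fun j => u j) x with hρ
  have hρ0 : 0 ≤ ρ := Finset.sum_nonneg fun _ _ => by positivity
  have hpi := Real.pi_pos
  have hm : ∀ j, Measurable fun t : ℝ => ENNReal.ofReal (2 * t) *
      ‖u j x - lowFreq (𝓕 (u j) : L2Plane) t x‖ₑ ^ 2 := fun j =>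
    Measurable.mul (by fun_prop) ((measurable_const.sub
      ((stronglyMeasurable_lowFreq _).measurable.comp measurable_prodMk_left)).enorm.pow_const 2)
  rw [← lintegral_finsetSum _ fun j _ => hm j]
  let r := Real.sqrt (ρ / (4 * Real.pi))
  have hr : 0 ≤ r := Real.sqrt_nonneg _
  have hr2 : r ^ 2 = ρ / (4 * Real.pi) := Real.sq_sqrt (by positivity)
  have key : ∀ t ∈ Set.Ioc 0 r, ρ / 4 ≤ ∑ j, ‖u j x - lowFreq (𝓕 (u j) : L2Plane) t x‖ ^ 2 := by
    intro t ht
    have h1 := sum_norm_lowFreq_sq_le hF ht.1.le x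
    have h2 : ρ ≤ 2 * ∑ j, ‖u j x - lowFreq (𝓕 (u j) : L2Plane) t x‖ ^ 2
        + 2 * ∑ j, ‖lowFreq (𝓕 (u j) : L2Plane) t x‖ ^ 2 := by
      rw [hρ, density, Finset.mul_sum, Finset.mul_sum, ← Finset.sum_add_distrib]
      refine Finset.sum_le_sum fun j _ => ?_
      have a := norm_add_le (u j x - lowFreq (𝓕 (u j) : L2Plane) t x)
        (lowFreq (𝓕 (u j) : L2Plane) t x)
      rw [sub_add_cancel] at a
      have b := norm_nonneg (u j x)
      nlinarith [sq_nonneg (‖u j x - lowFreq (𝓕 (u j) : L2Plane) t x‖ -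
        ‖lowFreq (𝓕 (u j) : L2Plane) t x‖)]
    have h3 : Real.pi * t ^ 2 ≤ ρ / 4 := by
      have : t ^ 2 ≤ r ^ 2 := pow_le_pow_left₀ ht.1.le ht.2 2
      calc Real.pi * t ^ 2 ≤ Real.pi * r ^ 2 := by gcongr
        _ = ρ / 4 := by rw [hr2]; field_simp
    linarith
  calc ENNReal.ofReal (ρ ^ 2)
      = ENNReal.ofReal (16 * Real.pi) * (ENNReal.ofReal (r ^ 2) * ENNReal.ofReal (ρ / 4)) := by
        rw [← ENNReal.ofReal_mul (by positivity), ← ENNReal.ofReal_mul (by positivity), hr2]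
        congr 1; field_simp; ring
    _ = ENNReal.ofReal (16 * Real.pi) *
        ∫⁻ t in Set.Ioc 0 r, ENNReal.ofReal (2 * t) * ENNReal.ofReal (ρ / 4) := by
        rw [lintegral_mul_const _ (by fun_prop), lintegral_Ioc_two_mul hr]
    _ ≤ ENNReal.ofReal (16 * Real.pi) * ∫⁻ t in Set.Ioc 0 r, ∑ j, ENNReal.ofReal (2 * t) *
        ‖u j x - lowFreq (𝓕 (u j) : L2Plane) t x‖ₑ ^ 2 := by
        refine mul_le_mul_right (setLIntegral_mono' measurableSet_Ioc fun t ht => ?_) _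
        rw [← Finset.mul_sum]
        gcongr
        refine (ENNReal.ofReal_le_ofReal (key t ht)).trans (le_of_eq ?_)
        rw [ENNReal.ofReal_sum_of_nonneg fun _ _ => by positivity]
        simp [ENNReal.ofReal_pow, ofReal_norm]
    _ ≤ _ := by
        refine mul_le_mul_right (lintegral_mono_set Set.Ioc_subset_Ioi_self) _

/-- The kinetic Lieb-Thirring inequality in two dimensions. -/
theorem lintegral_density_sq_le {N : ℕ} {u : Fin N → L2Plane} (ho : Orthonormal ℂ u)
    {w : Fin N → Fin 2 → L2Plane} (hw : ∀ j k, HasWeakDeriv (e k) (u j) (w j k)) :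
    ∫⁻ x, ENNReal.ofReal (density (fun j => u j) x ^ 2)
      ≤ ENNReal.ofReal (2 * ∑ j, ∑ k, ‖w j k‖ ^ 2) := by
  have hm : ∀ j, Measurable fun x : Plane => ∫⁻ t in Set.Ioi (0 : ℝ), ENNReal.ofReal (2 * t) *
        ‖u j x - lowFreq (𝓕 (u j) : L2Plane) t x‖ₑ ^ 2 := by
    intro j
    refine Measurable.lintegral_prod_right' (f := fun z : Plane × ℝ => ENNReal.ofReal (2 * z.2) *
        ‖u j z.1 - lowFreq (𝓕 (u j) : L2Plane) z.2 z.1‖ₑ ^ 2) ?_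
    have a : Measurable fun z : Plane × ℝ => u j z.1 :=
      (Lp.stronglyMeasurable (u j)).measurable.comp measurable_fst
    exact Measurable.mul (by fun_prop)
      ((a.sub (stronglyMeasurable_lowFreq _).measurable).enorm.pow_const 2)
  calc _ ≤ ∫⁻ x, ENNReal.ofReal (16 * Real.pi) *
      ∑ j, ∫⁻ t in Set.Ioi (0 : ℝ), ENNReal.ofReal (2 * t) *
        ‖u j x - lowFreq (𝓕 (u j) : L2Plane) t x‖ₑ ^ 2 :=
        lintegral_mono fun x => ofReal_density_sq_le ho x
    _ = ENNReal.ofReal (16 * Real.pi) * ∑ j, ∫⁻ x, ∫⁻ t in Set.Ioi (0 : ℝ), ENNReal.ofReal (2 * t) *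
        ‖u j x - lowFreq (𝓕 (u j) : L2Plane) t x‖ₑ ^ 2 := by
        rw [lintegral_const_mul' _ _ ENNReal.ofReal_ne_top, lintegral_finsetSum _ fun j _ => hm j]
    _ ≤ ENNReal.ofReal (16 * Real.pi) *
        ∑ j, ENNReal.ofReal ((4 * Real.pi ^ 2)⁻¹ * ∑ k, ‖w j k‖ ^ 2) := by
        gcongr with j
        exact (lintegral_high_le (u j)).trans (lintegral_norm_sq_fourier (hw j)).le
    _ ≤ _ := by
        rw [← ENNReal.ofReal_sum_of_nonneg fun _ _ => by positivity,
          ← ENNReal.ofReal_mul (by positivity)]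
        refine ENNReal.ofReal_le_ofReal ?_
        rw [← Finset.mul_sum, ← mul_assoc]
        have h0 : 0 ≤ ∑ j, ∑ k, ‖w j k‖ ^ 2 := by positivity
        -- The constant obtained is `16π/(4π²) = 4/π`, which is below `2` because `π > 3`.
        refine mul_le_mul_of_nonneg_right ?_ h0
        have := Real.pi_gt_three
        field_simp
        nlinarith

/-! ### Bounds on the vector potential -/

theorem norm_perp (x : Plane) : ‖perp x‖ = ‖x‖ := by
  simp only [perp, EuclideanSpace.norm_eq, Fin.sum_univ_two]
  simp [add_comm]

/-- The kernel `√N / |x|` cut off at distance `√N`. -/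
def tailKernel (N : ℕ) (x : Plane) : ENNReal :=
  (Metric.closedBall (0 : Plane) (√N)).indicator (fun x => ENNReal.ofReal (√N / ‖x‖)) x

theorem measurable_tailKernel (N : ℕ) : Measurable (tailKernel N) := by
  refine Measurable.indicator ?_ Metric.isClosed_closedBall.measurableSet
  exact (measurable_const.div measurable_norm).ennreal_ofReal

/-- In polar coordinates the Jacobian cancels `1/r`, leaving `2π · √N · √N`. -/
theorem lintegral_tailKernel (N : ℕ) :
    ∫⁻ x, tailKernel N x = ENNReal.ofReal (2 * Real.pi * N) := by
  let f : ℝ → ℝ := (Set.Iic (√N)).indicator fun r => √N / r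
  have h0 : ∀ r : ℝ, r ∈ Set.Ioi (0 : ℝ) → r ^ (2 - 1) • f r = (Set.Iic (√N)).indicator (fun _ => √N) r := by
    intro r hr
    have hr' : r ≠ 0 := (ne_of_gt hr)
    by_cases h : r ≤ √N
    · simp only [f, Set.indicator_of_mem (show r ∈ Set.Iic (√N) from h)]
      simp; field_simp
    · simp only [f, Set.indicator_of_notMem (show r ∉ Set.Iic (√N) from h)]
      simp
  have hdim : Module.finrank ℝ Plane = 2 := by simp
  have hS : Set.Ioi (0 : ℝ) ∩ Set.Iic (√N) = Set.Ioc 0 (√N) := rfl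
  have hint : Integrable (fun x : Plane => f ‖x‖) := by
    rw [integrable_fun_norm_addHaar, hdim, integrableOn_congr_fun h0 measurableSet_Ioi, IntegrableOn,
      integrable_indicator_iff measurableSet_Iic, IntegrableOn,
      Measure.restrict_restrict measurableSet_Iic, Set.inter_comm, hS]
    exact integrableOn_const measure_Ioc_lt_top.ne
  have hval : ∫ x : Plane, f ‖x‖ = 2 * Real.pi * N := by
    rw [integral_fun_norm_addHaar, hdim, setIntegral_congr_fun measurableSet_Ioi h0,
      setIntegral_indicator measurableSet_Iic, hS, setIntegral_const]
    have : (volume : Measure Plane).real (Metric.ball 0 1) = Real.pi := by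
      rw [Measure.real, EuclideanSpace.volume_ball_fin_two]
      simp [Real.pi_pos.le]
    rw [this]
    simp
    rw [mul_assoc]
  have h1 : ∀ x, tailKernel N x = ENNReal.ofReal (f ‖x‖) := by
    intro x
    by_cases h : ‖x‖ ≤ √N
    · simp only [f, tailKernel, Set.indicator_of_mem (show ‖x‖ ∈ Set.Iic (√N) from h)]
      rw [Set.indicator_of_mem (by simpa using h)]
    · simp only [f, tailKernel, Set.indicator_of_notMem (show ‖x‖ ∉ Set.Iic (√N) from h)]
      rw [Set.indicator_of_notMem (by simpa using h)]
      simp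
  simp only [h1]
  rw [← ofReal_integral_eq_lintegral_ofReal hint, hval]
  refine Eventually.of_forall fun x => ?_
  simp only [f]
  exact Set.indicator_apply_nonneg fun _ => by positivity

/-- Since `|x|_R ≥ |x|`, the cutoff `R` can be dropped, and `N^{s/2-1} |x|^{-s} = N⁻¹ (√N/|x|)^s`.
The square has exponent `2s ≤ 1`, so it is at most `1` or at most `√N/|x|`. This is the decisive use
of `s ≤ 1/2`. -/
theorem norm_aN_sq_le {N : ℕ} (hN : 1 ≤ N) {s : ℝ} (hs0 : 0 ≤ s) (hs : s ≤ 1 / 2) (R : ℝ) {x : Plane}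
    (hx : x ≠ 0) : ‖aN N s R x‖ ^ 2 ≤ ((N : ℝ) ^ 2)⁻¹ * max 1 (√N / ‖x‖) := by
  have hN0 : (0 : ℝ) < N := by exact_mod_cast hN
  have hx0 : 0 < ‖x‖ := norm_pos_iff.2 hx
  have h1 : ‖aN N s R x‖ ≤ (N : ℝ)⁻¹ * (√N / ‖x‖) ^ s := by
    have e1 : ‖aN N s R x‖ = (N : ℝ) ^ (s / 2 - 1) * (((max ‖x‖ R) ^ (1 + s))⁻¹ * ‖x‖) := by
      have hm : 0 ≤ max ‖x‖ R := hx0.le.trans (le_max_left _ _)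
      rw [aN, aR, norm_smul, norm_smul, norm_perp, Real.norm_of_nonneg (by positivity),
        Real.norm_of_nonneg (by positivity)]
    have e2 : ((max ‖x‖ R) ^ (1 + s))⁻¹ * ‖x‖ ≤ (‖x‖ ^ s)⁻¹ := by
      have : ‖x‖ ^ (1 + s) ≤ (max ‖x‖ R) ^ (1 + s) :=
        Real.rpow_le_rpow hx0.le (le_max_left _ _) (by linarith)
      calc _ ≤ (‖x‖ ^ (1 + s))⁻¹ * ‖x‖ := by gcongr
        _ = (‖x‖ ^ s)⁻¹ := by
          rw [Real.rpow_add hx0, Real.rpow_one]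
          have : 0 < ‖x‖ ^ s := Real.rpow_pos_of_pos hx0 s
          field_simp
    rw [e1]
    calc _ ≤ (N : ℝ) ^ (s / 2 - 1) * (‖x‖ ^ s)⁻¹ := by gcongr
      _ = (N : ℝ)⁻¹ * (√N / ‖x‖) ^ s := by
        rw [Real.div_rpow (Real.sqrt_nonneg _) hx0.le, Real.sqrt_eq_rpow, ← Real.rpow_mul hN0.le,
          Real.rpow_sub_one hN0.ne', show 1 / 2 * s = s / 2 by ring]
        ring
  have h2 : ((√N / ‖x‖) ^ s) ^ 2 ≤ max 1 (√N / ‖x‖) := by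
    have ht : 0 ≤ √N / ‖x‖ := by positivity
    rw [← Real.rpow_natCast, ← Real.rpow_mul ht]
    rcases le_total (√N / ‖x‖) 1 with h | h
    · exact (Real.rpow_le_one ht h (by positivity)).trans (le_max_left _ _)
    · refine le_trans ?_ (le_max_right _ _)
      calc _ ≤ (√N / ‖x‖) ^ (1 : ℝ) := Real.rpow_le_rpow_of_exponent_le h (by push_cast; linarith)
        _ = _ := Real.rpow_one _
  calc _ ≤ ((N : ℝ)⁻¹ * (√N / ‖x‖) ^ s) ^ 2 := by gcongr
    _ = ((N : ℝ) ^ 2)⁻¹ * ((√N / ‖x‖) ^ s) ^ 2 := by ring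
    _ ≤ _ := by gcongr

theorem aN_zero (N : ℕ) (s R : ℝ) : aN N s R 0 = 0 := by
  have : perp 0 = 0 := by rw [← norm_eq_zero, norm_perp, norm_zero]
  simp [aN, aR, this]

/-- Beyond distance `√N` the maximum in the previous bound equals `1`, so the singular part may be
cut off there and becomes integrable. -/
theorem enorm_aN_sq_le {N : ℕ} (hN : 1 ≤ N) {s : ℝ} (hs0 : 0 ≤ s) (hs : s ≤ 1 / 2) (R : ℝ)
    (x : Plane) : ‖aN N s R x‖ₑ ^ 2 ≤ ((N : ENNReal) ^ 2)⁻¹ * (1 + tailKernel N x) := by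
  rcases eq_or_ne x 0 with rfl | hx
  · simp [aN_zero]
  have hN0 : (0 : ℝ) < N := by exact_mod_cast hN
  have h := norm_aN_sq_le hN hs0 hs R hx
  have e1 : ((N : ENNReal) ^ 2)⁻¹ = ENNReal.ofReal (((N : ℝ) ^ 2)⁻¹) := by
    rw [ENNReal.ofReal_inv_of_pos (by positivity), ENNReal.ofReal_pow hN0.le, ENNReal.ofReal_natCast]
  rw [← ofReal_norm, ← ENNReal.ofReal_pow (norm_nonneg _), e1]
  refine (ENNReal.ofReal_le_ofReal h).trans ?_
  rw [ENNReal.ofReal_mul (by positivity)]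
  refine mul_le_mul_right ?_ _
  rw [ENNReal.ofReal_max, ENNReal.ofReal_one]
  refine max_le le_self_add ?_
  by_cases hb : ‖x‖ ≤ √N
  · rw [tailKernel, Set.indicator_of_mem (by simpa using hb)]
    exact le_add_self
  · refine le_trans ?_ le_self_add
    rw [← ENNReal.ofReal_one]
    refine ENNReal.ofReal_le_ofReal ?_
    rw [div_le_one (norm_pos_iff.2 hx)]
    exact (not_le.1 hb).le

theorem enorm_aN_le {N : ℕ} (hN : 1 ≤ N) {s : ℝ} (hs0 : 0 ≤ s) (hs : s ≤ 1 / 2) (R : ℝ)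
    (x : Plane) : ‖aN N s R x‖ₑ ≤ (N : ENNReal)⁻¹ * (1 + tailKernel N x ^ (1 / 2 : ℝ)) := by
  have h := enorm_aN_sq_le hN hs0 hs R x
  rw [← ENNReal.rpow_le_rpow_iff (z := 2) (by norm_num)]
  have e2 : ∀ a : ENNReal, a ^ (2 : ℝ) = a ^ 2 := fun a => by norm_num
  rw [e2, e2, mul_pow, ← ENNReal.inv_pow]
  refine h.trans (mul_le_mul_right ?_ _)
  set k := tailKernel N x
  have e3 : k = (k ^ (1 / 2 : ℝ)) ^ 2 := by
    rw [← e2, ← ENNReal.rpow_mul]; norm_num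
  calc 1 + k = 1 + (k ^ (1 / 2 : ℝ)) ^ 2 := by rw [← e3]
    _ ≤ 1 + (k ^ (1 / 2 : ℝ)) ^ 2 + 2 * k ^ (1 / 2 : ℝ) := le_self_add
    _ = _ := by ring

theorem lintegral_mul_sq_le {α : Type*} [MeasurableSpace α] {μ : Measure α} {f g : α → ENNReal}
    (hf : AEMeasurable f μ) (hg : AEMeasurable g μ) :
    (∫⁻ x, f x * g x ∂μ) ^ 2 ≤ (∫⁻ x, f x ^ 2 ∂μ) * ∫⁻ x, g x ^ 2 ∂μ := by
  have h := ENNReal.lintegral_mul_le_Lp_mul_Lq μ (p := 2) (q := 2)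
    (Real.HolderConjugate.two_two) hf hg
  have e2 : ∀ a : ENNReal, a ^ (2 : ℝ) = a ^ 2 := fun a => by norm_num
  simp only [e2, Pi.mul_apply] at h
  calc _ ≤ ((∫⁻ x, f x ^ 2 ∂μ) ^ (1 / 2 : ℝ) * (∫⁻ x, g x ^ 2 ∂μ) ^ (1 / 2 : ℝ)) ^ 2 := by gcongr
    _ = _ := by
      rw [mul_pow, ← e2, ← e2, ← ENNReal.rpow_mul, ← ENNReal.rpow_mul]
      norm_num

theorem ennreal_add_sq_le (a b : ENNReal) : (a + b) ^ 2 ≤ 2 * (a ^ 2 + b ^ 2) := by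
  have := ENNReal.rpow_add_le_mul_rpow_add_rpow a b (p := 2) (by norm_num)
  norm_num at this
  exact this

/-- A uniform bound on the vector potential generated by a density. -/
theorem lintegral_mul_enorm_aN_sq_le {N : ℕ} (hN : 1 ≤ N) {s : ℝ} (hs0 : 0 ≤ s) (hs : s ≤ 1 / 2)
    (R : ℝ) {ρ : Plane → ENNReal} (hρ : AEMeasurable ρ) (hmass : ∫⁻ y, ρ y ≤ N) (x : Plane) :
    (∫⁻ y, ρ y * ‖aN N s R (x - y)‖ₑ) ^ 2
      ≤ 2 + ENNReal.ofReal (4 * Real.pi / N) * ∫⁻ y, ρ y ^ 2 := by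
  have hN0 : (0 : ℝ) < N := by exact_mod_cast hN
  have hN1 : (N : ENNReal) ≠ 0 := by exact_mod_cast (by omega : N ≠ 0)
  have hN2 : (N : ENNReal) ≠ ⊤ := ENNReal.natCast_ne_top N
  set κ : Plane → ENNReal := fun y => tailKernel N (x - y) ^ (1 / 2 : ℝ)
  have hκ : Measurable κ :=
    ((measurable_tailKernel N).comp (measurable_const.sub measurable_id)).pow_const _
  have h1 : ∫⁻ y, ρ y * ‖aN N s R (x - y)‖ₑ ≤ (N : ENNReal)⁻¹ * (N + ∫⁻ y, ρ y * κ y) := by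
    calc _ ≤ ∫⁻ y, (N : ENNReal)⁻¹ * (ρ y + ρ y * κ y) := by
          refine lintegral_mono fun y => ?_
          calc _ ≤ ρ y * ((N : ENNReal)⁻¹ * (1 + κ y)) :=
                mul_le_mul_right (enorm_aN_le hN hs0 hs R (x - y)) _
            _ = _ := by ring
      _ = (N : ENNReal)⁻¹ * ((∫⁻ y, ρ y) + ∫⁻ y, ρ y * κ y) := by
          rw [lintegral_const_mul' _ _ (ENNReal.inv_ne_top.2 hN1), lintegral_add_left' hρ]
      _ ≤ _ := by gcongr
  -- Cauchy-Schwarz: `κ²` is the translated tail kernel, of mass `2πN`. The constant part of the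
  -- kernel saw only the total mass of `ρ`.
  have h2 : (∫⁻ y, ρ y * κ y) ^ 2 ≤ (∫⁻ y, ρ y ^ 2) * ENNReal.ofReal (2 * Real.pi * N) := by
    refine (lintegral_mul_sq_le hρ hκ.aemeasurable).trans (le_of_eq ?_)
    congr 1
    rw [← lintegral_tailKernel, ← lintegral_sub_left_eq_self (tailKernel N) x]
    congr 1 with y
    simp only [κ]
    rw [← ENNReal.rpow_natCast, ← ENNReal.rpow_mul]; norm_num
  calc _ ≤ ((N : ENNReal)⁻¹ * (N + ∫⁻ y, ρ y * κ y)) ^ 2 := by gcongr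
    _ = ((N : ENNReal)⁻¹) ^ 2 * (N + ∫⁻ y, ρ y * κ y) ^ 2 := mul_pow _ _ _
    _ ≤ ((N : ENNReal)⁻¹) ^ 2 *
        (2 * ((N : ENNReal) ^ 2 + (∫⁻ y, ρ y ^ 2) * ENNReal.ofReal (2 * Real.pi * N))) := by
        gcongr
        refine (ennreal_add_sq_le _ _).trans ?_
        gcongr
    _ = 2 * ((N : ENNReal)⁻¹ * N) ^ 2
        + (((N : ENNReal)⁻¹) ^ 2 * 2 * ENNReal.ofReal (2 * Real.pi * N)) * ∫⁻ y, ρ y ^ 2 := by ring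
    _ = _ := by
        rw [ENNReal.inv_mul_cancel hN1 hN2, one_pow, mul_one]
        congr 2
        rw [← ENNReal.ofReal_natCast, ← ENNReal.ofReal_inv_of_pos hN0, ← ENNReal.ofReal_pow (by positivity),
          ← ENNReal.ofReal_ofNat, ← ENNReal.ofReal_mul (by positivity), ← ENNReal.ofReal_mul (by positivity)]
        congr 1
        field_simp
        norm_num

/-- A bound on the pair interaction of a density. -/
theorem lintegral_lintegral_aN_sq_le {N : ℕ} (hN : 1 ≤ N) {s : ℝ} (hs0 : 0 ≤ s) (hs : s ≤ 1 / 2)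
    (R : ℝ) {ρ : Plane → ENNReal} (hρ : Measurable ρ) (hmass : ∫⁻ y, ρ y ≤ N) :
    ∫⁻ x, ∫⁻ y, ρ x * ρ y * ‖aN N s R (x - y)‖ₑ ^ 2
      ≤ 1 + ENNReal.ofReal (4 * Real.pi / N) * ∫⁻ y, ρ y ^ 2 := by
  have hN0 : (0 : ℝ) < N := by exact_mod_cast hN
  have hN1 : (N : ENNReal) ≠ 0 := by exact_mod_cast (by omega : N ≠ 0)
  have hN2 : (N : ENNReal) ≠ ⊤ := ENNReal.natCast_ne_top N
  have hk := measurable_tailKernel N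
  have hk' : Measurable fun z : Plane × Plane => tailKernel N (z.1 - z.2) :=
    hk.comp (measurable_fst.sub measurable_snd)
  have hpt : ∀ x y, ρ x * ρ y * ‖aN N s R (x - y)‖ₑ ^ 2 ≤ ((N : ENNReal) ^ 2)⁻¹ *
      (ρ x * ρ y + (ρ x ^ 2 * tailKernel N (x - y) + ρ y ^ 2 * tailKernel N (x - y))) := by
    intro x y
    -- Applied to the singular part only. In each resulting term the kernel can be integrated in the
    -- variable on which the density no longer depends.
    have hab : ρ x * ρ y ≤ ρ x ^ 2 + ρ y ^ 2 := by
      rcases le_total (ρ x) (ρ y) with h | h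
      · exact (mul_le_mul_left h _).trans ((sq (ρ y)).symm.le.trans le_add_self)
      · exact (mul_le_mul_right h _).trans ((sq (ρ x)).symm.le.trans le_self_add)
    calc _ ≤ ρ x * ρ y * (((N : ENNReal) ^ 2)⁻¹ * (1 + tailKernel N (x - y))) :=
          mul_le_mul_right (enorm_aN_sq_le hN hs0 hs R (x - y)) _
      _ = ((N : ENNReal) ^ 2)⁻¹ * (ρ x * ρ y + ρ x * ρ y * tailKernel N (x - y)) := by ring
      _ ≤ ((N : ENNReal) ^ 2)⁻¹ *
          (ρ x * ρ y + (ρ x ^ 2 + ρ y ^ 2) * tailKernel N (x - y)) := by gcongr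
      _ = _ := by ring
  have i1 : ∫⁻ x, ∫⁻ y, ρ x * ρ y ≤ (N : ENNReal) ^ 2 := by
    have : ∀ x, ∫⁻ y, ρ x * ρ y = ρ x * ∫⁻ y, ρ y := fun x => lintegral_const_mul _ hρ
    simp only [this]
    rw [lintegral_mul_const _ hρ, sq]
    gcongr
  have i2 : ∫⁻ x, ∫⁻ y, ρ x ^ 2 * tailKernel N (x - y)
      = (∫⁻ x, ρ x ^ 2) * ENNReal.ofReal (2 * Real.pi * N) := by
    rw [← lintegral_mul_const _ (hρ.pow_const 2)]
    congr 1 with x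
    have hkx : Measurable fun y => tailKernel N (x - y) :=
      hk.comp (measurable_const.sub measurable_id)
    rw [lintegral_const_mul _ hkx,
      lintegral_sub_left_eq_self (tailKernel N) x, lintegral_tailKernel]
  have i3 : ∫⁻ x, ∫⁻ y, ρ y ^ 2 * tailKernel N (x - y)
      = (∫⁻ x, ρ x ^ 2) * ENNReal.ofReal (2 * Real.pi * N) := by
    rw [lintegral_lintegral_swap
      ((((hρ.comp measurable_snd).pow_const 2).mul hk').aemeasurable)]
    rw [← lintegral_mul_const _ (hρ.pow_const 2)]
    congr 1 with y
    have hky : Measurable fun x => tailKernel N (x - y) :=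
      hk.comp (measurable_id.sub measurable_const)
    rw [lintegral_const_mul _ hky,
      lintegral_sub_right_eq_self (tailKernel N) y, lintegral_tailKernel]
  have m1 : Measurable fun z : Plane × Plane => ρ z.1 * ρ z.2 :=
    (hρ.comp measurable_fst).mul (hρ.comp measurable_snd)
  have m2 : Measurable fun z : Plane × Plane => ρ z.1 ^ 2 * tailKernel N (z.1 - z.2) :=
    ((hρ.comp measurable_fst).pow_const 2).mul hk'
  have m3 : Measurable fun z : Plane × Plane => ρ z.2 ^ 2 * tailKernel N (z.1 - z.2) :=
    ((hρ.comp measurable_snd).pow_const 2).mul hk'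
  calc _ ≤ ∫⁻ x, ∫⁻ y, ((N : ENNReal) ^ 2)⁻¹ * (ρ x * ρ y +
        (ρ x ^ 2 * tailKernel N (x - y) + ρ y ^ 2 * tailKernel N (x - y))) :=
        lintegral_mono fun x => lintegral_mono fun y => hpt x y
    _ = ((N : ENNReal) ^ 2)⁻¹ * ((∫⁻ x, ∫⁻ y, ρ x * ρ y) +
        ((∫⁻ x, ∫⁻ y, ρ x ^ 2 * tailKernel N (x - y)) +
          ∫⁻ x, ∫⁻ y, ρ y ^ 2 * tailKernel N (x - y))) := by
        have m4 : Measurable fun z : Plane × Plane =>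
            ρ z.1 ^ 2 * tailKernel N (z.1 - z.2) + ρ z.2 ^ 2 * tailKernel N (z.1 - z.2) := m2.add m3
        have m5 : Measurable fun z : Plane × Plane => ρ z.1 * ρ z.2 +
            (ρ z.1 ^ 2 * tailKernel N (z.1 - z.2) + ρ z.2 ^ 2 * tailKernel N (z.1 - z.2)) := m1.add m4
        rw [← lintegral_prod _ m1.aemeasurable, ← lintegral_prod _ m2.aemeasurable,
          ← lintegral_prod _ m3.aemeasurable, ← lintegral_add_left m2, ← lintegral_add_left m1,
          ← lintegral_const_mul _ m5, lintegral_prod _ (m5.const_mul _).aemeasurable]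
    _ ≤ ((N : ENNReal) ^ 2)⁻¹ * ((N : ENNReal) ^ 2 +
        ((∫⁻ x, ρ x ^ 2) * ENNReal.ofReal (2 * Real.pi * N) +
          (∫⁻ x, ρ x ^ 2) * ENNReal.ofReal (2 * Real.pi * N))) := by
        rw [i2, i3]; gcongr
    _ = ((N : ENNReal) ^ 2)⁻¹ * (N : ENNReal) ^ 2 + (2 * (((N : ENNReal) ^ 2)⁻¹ *
        ENNReal.ofReal (2 * Real.pi * N))) * ∫⁻ x, ρ x ^ 2 := by ring
    _ = _ := by
        rw [ENNReal.inv_mul_cancel (by simpa using hN1) (by simp)]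
        congr 2
        rw [← ENNReal.ofReal_natCast, ← ENNReal.ofReal_pow (by positivity),
          ← ENNReal.ofReal_inv_of_pos (by positivity), ← ENNReal.ofReal_mul (by positivity),
          ← ENNReal.ofReal_ofNat, ← ENNReal.ofReal_mul (by positivity)]
        congr 1
        field_simp
        norm_num

/-! ### Slater determinants -/

section Insert

variable {n : ℕ} {G : Type*} [NormedAddCommGroup G]

theorem integrable_insertNth {F : (Fin (n + 1) → Plane) → G} (hF : Integrable F) (i : Fin (n + 1)) :
    Integrable fun z : Plane × (Fin n → Plane) => F (i.insertNth z.1 z.2) :=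
  ((volume_preserving_piFinSuccAbove (fun _ => Plane) i).symm).integrable_comp_of_integrable hF

theorem integral_insertNth [NormedSpace ℝ G] (F : (Fin (n + 1) → Plane) → G) (i : Fin (n + 1)) :
    ∫ X, F X = ∫ z : Plane × (Fin n → Plane), F (i.insertNth z.1 z.2) :=
  (((volume_preserving_piFinSuccAbove (fun _ => Plane) i).symm).integral_comp' F).symm

end Insert

/-- A product of one-particle functions, one of which has zero mean, is orthogonal to any function
that does not depend on the corresponding variable. -/
theorem integral_smul_prod_eq_zero {N : ℕ} {W : (Fin N → Plane) → ℝ} (i : Fin N)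
    (hW : ∀ X x, W (Function.update X i x) = W X) (F : Fin N → Plane → ℂ) (hF : ∫ x, F i x = 0) :
    ∫ X, W X • ∏ j, F j (X j) = 0 := by
  cases N with
  | zero => exact i.elim0
  | succ n =>
    by_cases hint : Integrable fun X : Fin (n + 1) → Plane => W X • ∏ j, F j (X j)
    swap
    · exact integral_undef hint
    rw [integral_insertNth _ i, Measure.volume_eq_prod, integral_prod_symm _ (integrable_insertNth hint i)]
    have : ∀ (x : Plane) (Y : Fin n → Plane),
        W (i.insertNth x Y) • ∏ j, F j ((i.insertNth x Y : Fin (n + 1) → Plane) j)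
          = F i x * (W (i.insertNth 0 Y) • ∏ j, F (i.succAbove j) (Y j)) := by
      intro x Y
      rw [← hW (i.insertNth 0 Y) x, Fin.update_insertNth, Fin.prod_univ_succAbove _ i]
      simp only [Fin.insertNth_apply_same, Fin.insertNth_apply_succAbove]
      rw [mul_smul_comm]
    simp only [this, integral_mul_const, hF, zero_mul, integral_zero]

/-- The map `τ ↦ σ⁻¹ τ` sends these permutations bijectively to those fixing every point off `S`,
that is, to the permutations of `S`. -/
theorem card_perm_agree_off {N : ℕ} (S : Finset (Fin N)) (σ : Equiv.Perm (Fin N)) :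
    (Finset.univ.filter fun τ : Equiv.Perm (Fin N) => ∀ i, i ∉ S → σ i = τ i).card
      = S.card.factorial := by
  classical
  have h1 : (Finset.univ.filter fun τ : Equiv.Perm (Fin N) => ∀ i, i ∉ S → σ i = τ i).card
      = Fintype.card {f : Equiv.Perm (Fin N) // ∀ a, ¬ a ∈ S → f a = a} := by
    rw [Fintype.card_subtype]
    refine Finset.card_bij (fun τ _ => σ⁻¹ * τ) ?_ ?_ ?_
    · intro τ hτ
      simp only [Finset.mem_filter, Finset.mem_univ, true_and] at hτ ⊢
      intro i hi
      rw [Equiv.Perm.mul_apply, ← hτ i hi]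
      simp
    · intro a _ b _ h
      exact mul_left_cancel h
    · intro b hb
      simp only [Finset.mem_filter, Finset.mem_univ, true_and] at hb
      refine ⟨σ * b, ?_, by simp⟩
      simp only [Finset.mem_filter, Finset.mem_univ, true_and]
      intro i hi
      rw [Equiv.Perm.mul_apply, hb i hi]
  rw [h1, ← Fintype.card_congr (Equiv.Perm.subtypeEquivSubtypePerm (fun a => a ∈ S)),
    Fintype.card_perm, Fintype.card_coe]

theorem integrable_norm_sq (f : L2Plane) : Integrable fun x => ‖f x‖ ^ 2 :=
  (Lp.memLp f).integrable_norm_pow (by norm_num)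

theorem integral_norm_sq (f : L2Plane) : ∫ x, ‖f x‖ ^ 2 = ‖f‖ ^ 2 := by
  rw [← @inner_self_eq_norm_sq ℂ, L2.inner_def, ← integral_re (L2.integrable_inner _ _)]
  simp only [inner_self_eq_norm_sq]

theorem integrable_conj_mul (f g : L2Plane) : Integrable fun x => starRingEnd ℂ (f x) * g x := by
  have := L2.integrable_inner (𝕜 := ℂ) f g
  simpa [RCLike.inner_apply, mul_comm] using this

theorem integral_conj_mul (f g : L2Plane) :
    ∫ x, starRingEnd ℂ (f x) * g x = inner ℂ f g := by
  rw [L2.inner_def]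
  simp [RCLike.inner_apply, mul_comm]

theorem norm_sum_sq_eq {ι : Type*} (s : Finset ι) (z : ι → ℂ) :
    ‖∑ a ∈ s, z a‖ ^ 2 = ∑ a ∈ s, ∑ b ∈ s, (starRingEnd ℂ (z a) * z b).re := by
  have h : ((‖∑ a ∈ s, z a‖ ^ 2 : ℝ) : ℂ) = starRingEnd ℂ (∑ a ∈ s, z a) * ∑ a ∈ s, z a := by
    rw [← Complex.normSq_eq_norm_sq, Complex.normSq_eq_conj_mul_self]
  rw [map_sum, Finset.sum_mul_sum] at h
  have h2 := congrArg Complex.re h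
  rw [Complex.ofReal_re] at h2
  rw [h2, Complex.re_sum]
  exact Finset.sum_congr rfl fun a _ => Complex.re_sum _ _

/-- The antisymmetrized sum of products of the functions `f σ j`. -/
theorem integral_mul_norm_sum_sq {N : ℕ} {f : Equiv.Perm (Fin N) → Fin N → L2Plane}
    {W : (Fin N → Plane) → ℝ} (hWm : Measurable W) {C : ℝ} (hWb : ∀ X, ‖W X‖ ≤ C) :
    ∫ X, W X * ‖∑ σ : Equiv.Perm (Fin N), ((Equiv.Perm.sign σ : ℤ) : ℂ) * ∏ j, f σ j (X j)‖ ^ 2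
      = ∑ σ : Equiv.Perm (Fin N), ∑ τ : Equiv.Perm (Fin N),
        ((Equiv.Perm.sign σ : ℤ) : ℝ) * ((Equiv.Perm.sign τ : ℤ) : ℝ) *
          (∫ X, W X • ∏ j, (starRingEnd ℂ (f σ j (X j)) * f τ j (X j))).re := by
  have hint : ∀ σ τ, Integrable fun X : Fin N → Plane =>
      W X • ∏ j, (starRingEnd ℂ (f σ j (X j)) * f τ j (X j)) := by
    intro σ τ
    have h1 : Integrable fun X : Fin N → Plane =>
        ∏ j, (starRingEnd ℂ (f σ j (X j)) * f τ j (X j)) :=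
      Integrable.fintype_prod fun j => integrable_conj_mul (f σ j) (f τ j)
    exact h1.bdd_smul C hWm.aestronglyMeasurable (Eventually.of_forall hWb)
  have hpt : ∀ X, W X * ‖∑ σ : Equiv.Perm (Fin N),
      ((Equiv.Perm.sign σ : ℤ) : ℂ) * ∏ j, f σ j (X j)‖ ^ 2
      = ∑ σ : Equiv.Perm (Fin N), ∑ τ : Equiv.Perm (Fin N),
        ((Equiv.Perm.sign σ : ℤ) : ℝ) * ((Equiv.Perm.sign τ : ℤ) : ℝ) *
          (W X • ∏ j, (starRingEnd ℂ (f σ j (X j)) * f τ j (X j))).re := by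
    intro X
    rw [norm_sum_sq_eq, Finset.mul_sum]
    refine Finset.sum_congr rfl fun σ _ => ?_
    rw [Finset.mul_sum]
    refine Finset.sum_congr rfl fun τ _ => ?_
    rw [Finset.prod_mul_distrib, map_mul, map_prod, Complex.real_smul, Complex.re_ofReal_mul]
    have : starRingEnd ℂ ((Equiv.Perm.sign σ : ℤ) : ℂ) * (∏ j, starRingEnd ℂ (f σ j (X j))) *
        (((Equiv.Perm.sign τ : ℤ) : ℂ) * ∏ j, f τ j (X j))
        = ((((Equiv.Perm.sign σ : ℤ) : ℝ) * ((Equiv.Perm.sign τ : ℤ) : ℝ) : ℝ) : ℂ) *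
          ((∏ j, starRingEnd ℂ (f σ j (X j))) * ∏ j, f τ j (X j)) := by
      rw [map_intCast]
      push_cast
      ring
    rw [this, Complex.re_ofReal_mul]
    ring
  simp only [hpt]
  have hint' : ∀ σ τ, Integrable fun X : Fin N → Plane =>
      ((Equiv.Perm.sign σ : ℤ) : ℝ) * ((Equiv.Perm.sign τ : ℤ) : ℝ) *
      (W X • ∏ j, (starRingEnd ℂ (f σ j (X j)) * f τ j (X j))).re :=
    fun σ τ => (hint σ τ).re.const_mul _
  rw [integral_finsetSum _ fun σ _ => integrable_finsetSum _ fun τ _ => hint' σ τ]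
  refine Finset.sum_congr rfl fun σ _ => ?_
  rw [integral_finsetSum _ fun τ _ => hint' σ τ]
  refine Finset.sum_congr rfl fun τ _ => ?_
  rw [integral_const_mul]
  congr 1
  exact integral_re (hint σ τ)

theorem norm_slater_sq {N : ℕ} (u : Fin N → Plane → ℂ) (X : Fin N → Plane) :
    ‖slater u X‖ ^ 2 = ((N.factorial : ℝ))⁻¹ *
      ‖∑ σ : Equiv.Perm (Fin N), ((Equiv.Perm.sign σ : ℤ) : ℂ) * ∏ j, u (σ j) (X j)‖ ^ 2 := by
  rw [slater, norm_mul, mul_pow, Complex.norm_real, norm_inv, Real.norm_of_nonneg (Real.sqrt_nonneg _),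
    inv_pow, Real.sq_sqrt (by positivity)]

theorem orthonormal_integral_conj_mul {N : ℕ} {u : Fin N → L2Plane} (ho : Orthonormal ℂ u)
    (i j : Fin N) : ∫ x, starRingEnd ℂ (u i x) * u j x = if i = j then 1 else 0 := by
  rw [integral_conj_mul]
  exact orthonormal_iff_ite.1 ho i j

theorem abs_sign_mul_sign {N : ℕ} (σ τ : Equiv.Perm (Fin N)) :
    |((Equiv.Perm.sign σ : ℤ) : ℝ) * ((Equiv.Perm.sign τ : ℤ) : ℝ)| = 1 := by
  rcases Int.units_eq_one_or (Equiv.Perm.sign σ) with h | h <;>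
    rcases Int.units_eq_one_or (Equiv.Perm.sign τ) with h' | h' <;> simp [h, h']

/-- The expectation of a nonnegative function of few variables in a Slater determinant is bounded
by its expectation in the symmetrized product state. -/
theorem integral_mul_norm_slater_sq_le {N : ℕ} {u : Fin N → L2Plane} (ho : Orthonormal ℂ u)
    {W : (Fin N → Plane) → ℝ} (hWm : Measurable W) (hW0 : ∀ X, 0 ≤ W X) {C : ℝ}
    (hWb : ∀ X, W X ≤ C) (S : Finset (Fin N))
    (hWS : ∀ i, i ∉ S → ∀ X x, W (Function.update X i x) = W X) :
    ∫ X, W X * ‖slater (fun j => u j) X‖ ^ 2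
      ≤ (N.factorial : ℝ)⁻¹ * S.card.factorial *
        ∑ σ : Equiv.Perm (Fin N), ∫ X, W X * ∏ j, ‖u (σ j) (X j)‖ ^ 2 := by
  have hWb' : ∀ X, ‖W X‖ ≤ C := fun X => by rw [Real.norm_of_nonneg (hW0 X)]; exact hWb X
  set I : Equiv.Perm (Fin N) → ℝ := fun σ => ∫ X, W X * ∏ j, ‖u (σ j) (X j)‖ ^ 2 with hI
  have hI0 : ∀ σ, 0 ≤ I σ := fun σ => integral_nonneg fun X =>
    mul_nonneg (hW0 X) (Finset.prod_nonneg fun _ _ => by positivity)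
  have hIint : ∀ σ : Equiv.Perm (Fin N), Integrable fun X : Fin N → Plane =>
      W X * ∏ j, ‖u (σ j) (X j)‖ ^ 2 := by
    intro σ
    have h1 : Integrable fun X : Fin N → Plane => ∏ j, ‖u (σ j) (X j)‖ ^ 2 :=
      Integrable.fintype_prod fun j => integrable_norm_sq (u (σ j))
    exact h1.bdd_mul hWm.aestronglyMeasurable (Eventually.of_forall hWb')
  have e1 : ∫ X, W X * ‖slater (fun j => u j) X‖ ^ 2 = (N.factorial : ℝ)⁻¹ *
      ∫ X, W X * ‖∑ σ : Equiv.Perm (Fin N), ((Equiv.Perm.sign σ : ℤ) : ℂ) *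
        ∏ j, u (σ j) (X j)‖ ^ 2 := by
    rw [← integral_const_mul]
    congr 1 with X
    rw [norm_slater_sq]
    ring
  rw [e1, integral_mul_norm_sum_sq (f := fun σ j => u (σ j)) hWm hWb', mul_assoc]
  refine mul_le_mul_of_nonneg_left ?_ (by positivity)
  -- If `σ` and `τ` differ at an index off `S`, integrating the corresponding variable gives zero by
  -- orthogonality. Otherwise the product is bounded by the mean of its two product densities.
  have hterm : ∀ σ τ : Equiv.Perm (Fin N),
      ((Equiv.Perm.sign σ : ℤ) : ℝ) * ((Equiv.Perm.sign τ : ℤ) : ℝ) *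
        (∫ X, W X • ∏ j, (starRingEnd ℂ (u (σ j) (X j)) * u (τ j) (X j))).re
      ≤ if ∀ i, i ∉ S → σ i = τ i then (I σ + I τ) / 2 else 0 := by
    intro σ τ
    split_ifs with h
    · refine (le_abs_self _).trans ?_
      rw [abs_mul, abs_sign_mul_sign, one_mul]
      refine (Complex.abs_re_le_norm _).trans ((norm_integral_le_integral_norm _).trans ?_)
      rw [hI]
      simp only
      rw [← integral_add (hIint σ) (hIint τ), ← integral_div]
      refine integral_mono_of_nonneg (Eventually.of_forall fun X => norm_nonneg _)
        (((hIint σ).add (hIint τ)).div_const 2) (Eventually.of_forall fun X => ?_)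
      simp only [norm_smul, Real.norm_of_nonneg (hW0 X), norm_prod, norm_mul, RCLike.norm_conj,
        Finset.prod_mul_distrib, Finset.prod_pow]
      nlinarith [mul_nonneg (hW0 X) (sq_nonneg ((∏ j, ‖u (σ j) (X j)‖) - ∏ j, ‖u (τ j) (X j)‖))]
    · push Not at h
      obtain ⟨i, hi, hne⟩ := h
      have := integral_smul_prod_eq_zero i (hWS i hi)
        (fun j x => starRingEnd ℂ (u (σ j) x) * u (τ j) x)
        (by rw [orthonormal_integral_conj_mul ho, if_neg hne])
      rw [this]
      simp
  refine (Finset.sum_le_sum fun σ _ => Finset.sum_le_sum fun τ _ => hterm σ τ).trans (le_of_eq ?_)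
  -- Splitting the mean lets each half be summed first over the other permutation, which has `|S|!`
  -- admissible values.
  have hsplit : ∀ σ τ : Equiv.Perm (Fin N), (if ∀ i, i ∉ S → σ i = τ i then (I σ + I τ) / 2 else 0)
      = (if ∀ i, i ∉ S → σ i = τ i then I σ / 2 else 0) +
        (if ∀ i, i ∉ S → τ i = σ i then I τ / 2 else 0) := by
    intro σ τ
    have : (∀ i, i ∉ S → τ i = σ i) ↔ (∀ i, i ∉ S → σ i = τ i) :=
      ⟨fun h i hi => (h i hi).symm, fun h i hi => (h i hi).symm⟩
    simp only [this]
    split_ifs <;> ring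
  simp only [hsplit, Finset.sum_add_distrib]
  have hA : ∑ σ : Equiv.Perm (Fin N), ∑ τ : Equiv.Perm (Fin N),
      (if ∀ i, i ∉ S → σ i = τ i then I σ / 2 else 0) = (S.card.factorial : ℝ) * ∑ σ, I σ / 2 := by
    rw [Finset.mul_sum]
    refine Finset.sum_congr rfl fun σ _ => ?_
    rw [← Finset.sum_filter, Finset.sum_const, card_perm_agree_off, nsmul_eq_mul]
  rw [Finset.sum_comm (f := fun σ τ : Equiv.Perm (Fin N) =>
    if ∀ i, i ∉ S → τ i = σ i then I τ / 2 else 0), hA, ← mul_add, ← Finset.sum_add_distrib]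
  congr 1
  exact Finset.sum_congr rfl fun σ _ => by ring

/-- The variables `Y m` are independent with densities `g m`. Off-diagonal pairs give products of
means, the diagonal gives second moments, and adding the nonnegative diagonal products of means
completes the square. -/
theorem integral_sum_sq_mul_prod_le {n : ℕ} {f : Plane → ℝ} (hf : Measurable f)
    (hf0 : ∀ x, 0 ≤ f x) {C : ℝ} (hfb : ∀ x, f x ≤ C) {g : Fin n → Plane → ℝ}
    (hg : ∀ m, Integrable (g m)) (hg0 : ∀ m x, 0 ≤ g m x) (hg1 : ∀ m, ∫ x, g m x = 1) :
    ∫ Y : Fin n → Plane, (∑ l, f (Y l)) ^ 2 * ∏ m, g m (Y m)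
      ≤ (∑ l, ∫ y, f y ^ 2 * g l y) + (∑ l, ∫ y, f y * g l y) ^ 2 := by
  have hb : ∀ x, ‖f x‖ ≤ C := fun x => by rw [Real.norm_of_nonneg (hf0 x)]; exact hfb x
  have hfg : ∀ m, Integrable fun y => f y * g m y := fun m =>
    (hg m).bdd_mul hf.aestronglyMeasurable (Eventually.of_forall hb)
  have hffg : ∀ m, Integrable fun y => f y * (f y * g m y) := fun m =>
    (hfg m).bdd_mul hf.aestronglyMeasurable (Eventually.of_forall hb)
  -- With `f (Y k) * f (Y l)` distributed over the factors, the integrand is a product of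
  -- one-variable functions even when `k = l`, where one factor receives `f` twice.
  let Q : Fin n → Fin n → Fin n → Plane → ℝ := fun k l m y =>
    (if k = m then f y else 1) * ((if l = m then f y else 1) * g m y)
  have hQint : ∀ k l m, Integrable (Q k l m) := by
    intro k l m
    simp only [Q]
    split_ifs
    · exact hffg m
    · simpa using hfg m
    · simpa using hfg m
    · simpa using hg m
  have hprod : ∀ k l (Y : Fin n → Plane),
      ∏ m, Q k l m (Y m) = f (Y k) * f (Y l) * ∏ m, g m (Y m) := by
    intro k l Y
    simp only [Q, Finset.prod_mul_distrib]
    rw [Finset.prod_ite_eq, Finset.prod_ite_eq]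
    simp [mul_assoc]
  have e1 : ∫ Y : Fin n → Plane, (∑ l, f (Y l)) ^ 2 * ∏ m, g m (Y m)
      = ∑ k, ∑ l, ∏ m, ∫ y, Q k l m y := by
    have : ∀ Y : Fin n → Plane, (∑ l, f (Y l)) ^ 2 * ∏ m, g m (Y m)
        = ∑ k, ∑ l, ∏ m, Q k l m (Y m) := by
      intro Y
      rw [sq, Finset.sum_mul_sum, Finset.sum_mul]
      refine Finset.sum_congr rfl fun k _ => ?_
      rw [Finset.sum_mul]
      exact Finset.sum_congr rfl fun l _ => (hprod k l Y).symm
    simp only [this]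
    have hi : ∀ k l, Integrable fun Y : Fin n → Plane => ∏ m, Q k l m (Y m) :=
      fun k l => Integrable.fintype_prod (hQint k l)
    rw [integral_finsetSum _ fun k _ => integrable_finsetSum _ fun l _ => hi k l]
    refine Finset.sum_congr rfl fun k _ => ?_
    rw [integral_finsetSum _ fun l _ => hi k l]
    exact Finset.sum_congr rfl fun l _ => integral_fintype_prod_volume_eq_prod _
  have hval : ∀ k l, ∏ m, ∫ y, Q k l m y ≤ (if k = l then ∫ y, f y ^ 2 * g k y else 0) +
      (∫ y, f y * g k y) * ∫ y, f y * g l y := by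
    intro k l
    have h0 : ∀ m, 0 ≤ ∫ y, f y * g m y := fun m =>
      integral_nonneg fun y => mul_nonneg (hf0 y) (hg0 m y)
    by_cases hkl : k = l
    · subst hkl
      rw [Finset.prod_eq_single_of_mem k (Finset.mem_univ _)]
      · simp only [Q, if_true]
        have : ∀ y, f y * (f y * g k y) = f y ^ 2 * g k y := fun y => by ring
        simp only [this]
        linarith [mul_nonneg (h0 k) (h0 k)]
      · intro m _ hm
        simp only [Q, if_neg hm.symm, one_mul, hg1]
    · rw [if_neg hkl, zero_add]
      refine le_of_eq ?_
      have : ∀ m, ∫ y, Q k l m y = (if k = m then ∫ y, f y * g m y else 1) *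
          (if l = m then ∫ y, f y * g m y else 1) := by
        intro m
        simp only [Q]
        by_cases h1 : k = m
        · subst h1
          simp [Ne.symm hkl]
        · by_cases h2 : l = m
          · subst h2; simp [h1]
          · simp [h1, h2, hg1]
      simp only [this, Finset.prod_mul_distrib]
      rw [Finset.prod_ite_eq, Finset.prod_ite_eq]
      simp
  rw [e1]
  refine (Finset.sum_le_sum fun k _ => Finset.sum_le_sum fun l _ => hval k l).trans (le_of_eq ?_)
  simp only [Finset.sum_add_distrib]
  congr 1
  · simp
  · rw [sq, Finset.sum_mul_sum]

theorem memLp_prod {N : ℕ} (f : Fin N → L2Plane) :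
    MemLp (fun X : Fin N → Plane => ∏ j, f j (X j)) 2 := by
  have hm : AEStronglyMeasurable fun X : Fin N → Plane => ∏ j, f j (X j) := by
    refine Measurable.aestronglyMeasurable ?_
    exact Finset.measurable_prod _ fun j _ =>
      (Lp.stronglyMeasurable (f j)).measurable.comp (measurable_pi_apply j)
  rw [memLp_two_iff_integrable_sq_norm hm]
  simp only [norm_prod, ← Finset.prod_pow]
  exact Integrable.fintype_prod fun j => integrable_norm_sq (f j)

theorem memLp_sum_prod {N : ℕ} (f : Equiv.Perm (Fin N) → Fin N → L2Plane) (c : ℂ) :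
    MemLp (fun X : Fin N → Plane =>
      c * ∑ σ : Equiv.Perm (Fin N), ((Equiv.Perm.sign σ : ℤ) : ℂ) * ∏ j, f σ j (X j)) 2 :=
  (memLp_finsetSum _ fun σ _ => (memLp_prod (f σ)).const_mul _).const_mul c

theorem memLp_slater {N : ℕ} (u : Fin N → L2Plane) : MemLp (slater fun j => u j) 2 :=
  memLp_sum_prod (fun σ j => u (σ j)) _

/-- Freeze `X j = x`. The other particles are independent, so the preceding second-moment bound
applies, and enlarging the sums over `l ≠ j` to all indices produces the full density `ρ`. -/
theorem integral_pair_sq_mul_prod_le {N : ℕ} {v : Fin N → L2Plane} (hv : ∀ m, ‖v m‖ = 1)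
    {h : Plane → ℝ} (hh : Measurable h) (h0 : ∀ x, 0 ≤ h x) {C : ℝ} (hC : ∀ x, h x ≤ C)
    {ρ : Plane → ℝ} (hρ : ∀ x, ρ x = ∑ m, ‖v m x‖ ^ 2) {B : ℝ}
    (hB : ∀ x, (∫ y, h (x - y) * ρ y) ^ 2 ≤ B) (j : Fin N) :
    ∫ X : Fin N → Plane, (∑ l ∈ Finset.univ.erase j, h (X j - X l)) ^ 2 * ∏ m, ‖v m (X m)‖ ^ 2
      ≤ ∫ x, ‖v j x‖ ^ 2 * ((∫ y, h (x - y) ^ 2 * ρ y) + B) := by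
  cases N with
  | zero => exact j.elim0
  | succ n =>
    have hb : ∀ x, ‖h x‖ ≤ C := fun x => by rw [Real.norm_of_nonneg (h0 x)]; exact hC x
    have hsub : ∀ x, Measurable fun y => h (x - y) := fun x =>
      hh.comp (measurable_const.sub measurable_id)
    have i1 : ∀ x m, Integrable fun y => h (x - y) * ‖v m y‖ ^ 2 := fun x m =>
      (integrable_norm_sq (v m)).bdd_mul (hsub x).aestronglyMeasurable
        (Eventually.of_forall fun y => hb _)
    have i2 : ∀ x m, Integrable fun y => h (x - y) ^ 2 * ‖v m y‖ ^ 2 := fun x m => by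
      have := (i1 x m).bdd_mul (hsub x).aestronglyMeasurable (Eventually.of_forall fun y => hb _)
      refine this.congr (Eventually.of_forall fun y => ?_)
      simp only
      ring
    have s1 : ∀ x, ∫ y, h (x - y) * ρ y = ∑ m, ∫ y, h (x - y) * ‖v m y‖ ^ 2 := fun x => by
      simp only [hρ, Finset.mul_sum]
      exact integral_finsetSum _ fun m _ => i1 x m
    have s2 : ∀ x, ∫ y, h (x - y) ^ 2 * ρ y = ∑ m, ∫ y, h (x - y) ^ 2 * ‖v m y‖ ^ 2 := fun x => by
      simp only [hρ, Finset.mul_sum]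
      exact integral_finsetSum _ fun m _ => i2 x m
    have n1 : ∀ x m, 0 ≤ ∫ y, h (x - y) * ‖v m y‖ ^ 2 := fun x m =>
      integral_nonneg fun y => mul_nonneg (h0 _) (by positivity)
    have n2 : ∀ x m, 0 ≤ ∫ y, h (x - y) ^ 2 * ‖v m y‖ ^ 2 := fun x m =>
      integral_nonneg fun y => by positivity
    have hinner : ∀ x, ∫ Y : Fin n → Plane, (∑ l, h (x - Y l)) ^ 2 *
        ∏ m, ‖v (j.succAbove m) (Y m)‖ ^ 2 ≤ (∫ y, h (x - y) ^ 2 * ρ y) + B := by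
      intro x
      refine (integral_sum_sq_mul_prod_le (hsub x) (fun y => h0 _) (fun y => hC _)
        (g := fun m y => ‖v (j.succAbove m) y‖ ^ 2) (fun m => integrable_norm_sq _)
        (fun m y => by positivity) (fun m => by rw [integral_norm_sq, hv, one_pow])).trans ?_
      refine add_le_add ?_ ((pow_le_pow_left₀ ?_ ?_ 2).trans (hB x))
      · rw [s2, Fin.sum_univ_succAbove _ j]
        linarith [n2 x j]
      · exact Finset.sum_nonneg fun m _ => n1 x _
      · rw [s1, Fin.sum_univ_succAbove _ j]
        linarith [n1 x j]
    have hval : ∀ (x : Plane) (Y : Fin n → Plane),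
        (∑ l ∈ Finset.univ.erase j, h ((j.insertNth x Y : Fin (n + 1) → Plane) j
          - (j.insertNth x Y : Fin (n + 1) → Plane) l)) ^ 2 *
          ∏ m, ‖v m ((j.insertNth x Y : Fin (n + 1) → Plane) m)‖ ^ 2
        = ‖v j x‖ ^ 2 * ((∑ l, h (x - Y l)) ^ 2 * ∏ m, ‖v (j.succAbove m) (Y m)‖ ^ 2) := by
      intro x Y
      have : ∑ l ∈ Finset.univ.erase j, h ((j.insertNth x Y : Fin (n + 1) → Plane) j
          - (j.insertNth x Y : Fin (n + 1) → Plane) l) = ∑ l, h (x - Y l) := by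
        have e := Fin.sum_univ_succAbove (fun l => h ((j.insertNth x Y : Fin (n + 1) → Plane) j
          - (j.insertNth x Y : Fin (n + 1) → Plane) l)) j
        rw [← Finset.add_sum_erase _ _ (Finset.mem_univ j)] at e
        have e' := add_left_cancel e
        rw [e']
        simp
      rw [this, Fin.prod_univ_succAbove _ j]
      simp only [Fin.insertNth_apply_same, Fin.insertNth_apply_succAbove]
      ring
    have hsum_meas : Measurable fun X : Fin (n + 1) → Plane =>
        ∑ l ∈ Finset.univ.erase j, h (X j - X l) :=
      Finset.measurable_sum _ fun l _ =>
        hh.comp ((measurable_pi_apply j).sub (measurable_pi_apply l))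
    have hsum_bdd : ∀ X : Fin (n + 1) → Plane,
        ‖(∑ l ∈ Finset.univ.erase j, h (X j - X l)) ^ 2‖ ≤ ((Finset.univ.erase j).card • C) ^ 2 := by
      intro X
      have hn : 0 ≤ ∑ l ∈ Finset.univ.erase j, h (X j - X l) := Finset.sum_nonneg fun l _ => h0 _
      rw [Real.norm_of_nonneg (by positivity)]
      exact pow_le_pow_left₀ hn (Finset.sum_le_card_nsmul _ _ _ fun l _ => hC _) 2
    have hint : Integrable fun X : Fin (n + 1) → Plane =>
        (∑ l ∈ Finset.univ.erase j, h (X j - X l)) ^ 2 * ∏ m, ‖v m (X m)‖ ^ 2 :=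
      (Integrable.fintype_prod fun m => integrable_norm_sq (v m)).bdd_mul
        (hsum_meas.pow_const 2).aestronglyMeasurable (Eventually.of_forall hsum_bdd)
    have hint' := integrable_insertNth hint j
    rw [integral_insertNth _ j, Measure.volume_eq_prod, integral_prod _ hint']
    refine integral_mono_of_nonneg (Eventually.of_forall fun x => integral_nonneg fun Y => ?_) ?_
      (Eventually.of_forall fun x => ?_)
    · exact mul_nonneg (sq_nonneg _) (Finset.prod_nonneg fun _ _ => by positivity)
    · have hq : Measurable fun x => ∫ y, h (x - y) ^ 2 * ρ y := by
        refine StronglyMeasurable.measurable ?_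
        refine StronglyMeasurable.integral_prod_right (f := fun x y => h (x - y) ^ 2 * ρ y) ?_
        refine Measurable.stronglyMeasurable ?_
        simp only [hρ]
        refine Measurable.mul ((hh.comp (measurable_fst.sub measurable_snd)).pow_const 2) ?_
        exact Finset.measurable_sum _ fun m _ =>
          (((Lp.stronglyMeasurable (v m)).measurable.comp measurable_snd).norm.pow_const 2)
      have hρi : Integrable ρ := by
        have : ρ = fun x => ∑ m, ‖v m x‖ ^ 2 := funext hρ
        rw [this]
        exact integrable_finsetSum _ fun m _ => integrable_norm_sq _
      have hρ0 : ∀ x, 0 ≤ ρ x := fun x => by rw [hρ]; positivity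
      have hqb : ∀ x, ‖∫ y, h (x - y) ^ 2 * ρ y‖ ≤ C ^ 2 * ∫ y, ρ y := by
        intro x
        rw [Real.norm_of_nonneg (integral_nonneg fun y => mul_nonneg (sq_nonneg _) (hρ0 y)),
          ← integral_const_mul]
        refine integral_mono_of_nonneg (Eventually.of_forall fun y => mul_nonneg (sq_nonneg _) (hρ0 y))
          (hρi.const_mul _) (Eventually.of_forall fun y => ?_)
        exact mul_le_mul_of_nonneg_right (pow_le_pow_left₀ (h0 _) (hC _) 2) (hρ0 y)
      have := ((integrable_norm_sq (v j)).bdd_mul hq.aestronglyMeasurable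
        (Eventually.of_forall hqb)).add ((integrable_norm_sq (v j)).const_mul B)
      refine this.congr (Eventually.of_forall fun x => ?_)
      simp only [Pi.add_apply]
      ring
    · simp only [hval, integral_const_mul]
      exact mul_le_mul_of_nonneg_left (hinner x) (by positivity)

/-- The expected squared total interaction of a particle with all others, summed over the
particles of a Slater determinant. -/
theorem sum_integral_pair_sq_slater_le {N : ℕ} {u : Fin N → L2Plane} (ho : Orthonormal ℂ u)
    {h : Plane → ℝ} (hh : Measurable h) (h0 : ∀ x, 0 ≤ h x) {C : ℝ} (hC : ∀ x, h x ≤ C) {B Q : ℝ}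
    (hB : ∀ x, (∫ y, h (x - y) * density (fun j => u j) y) ^ 2 ≤ B)
    (hQ : ∫ x, density (fun j => u j) x * ∫ y, h (x - y) ^ 2 * density (fun j => u j) y ≤ Q) :
    ∑ j, ∫ X : Fin N → Plane, (∑ l ∈ Finset.univ.erase j, h (X j - X l)) ^ 2 *
      ‖slater (fun j => u j) X‖ ^ 2 ≤ 6 * (Q + N * B) := by
  set ρ := density (fun j => ⇑(u j)) with hρdef
  have hC0 : 0 ≤ C := (h0 0).trans (hC 0)
  have hb : ∀ x, ‖h x‖ ≤ C := fun x => by rw [Real.norm_of_nonneg (h0 x)]; exact hC x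
  have hΨ : Integrable fun X : Fin N → Plane => ‖slater (fun j => u j) X‖ ^ 2 :=
    (memLp_slater u).integrable_norm_pow (by norm_num)
  have hmeas : ∀ j k : Fin N, Measurable fun X : Fin N → Plane => h (X j - X k) := fun j k =>
    hh.comp ((measurable_pi_apply j).sub (measurable_pi_apply k))
  have hbd : ∀ (j k l : Fin N) (X : Fin N → Plane), h (X j - X k) * h (X j - X l) ≤ C * C :=
    fun j k l X => mul_le_mul (hC _) (hC _) (h0 _) hC0
  have hbd' : ∀ (j k l : Fin N) (X : Fin N → Plane), ‖h (X j - X k) * h (X j - X l)‖ ≤ C * C :=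
    fun j k l X => by rw [Real.norm_of_nonneg (mul_nonneg (h0 _) (h0 _))]; exact hbd j k l X
  have hexp : ∀ (j : Fin N) (X : Fin N → Plane) (p : ℝ),
      (∑ l ∈ Finset.univ.erase j, h (X j - X l)) ^ 2 * p =
      ∑ k ∈ Finset.univ.erase j, ∑ l ∈ Finset.univ.erase j, h (X j - X k) * h (X j - X l) * p := by
    intro j X p
    rw [sq, Finset.sum_mul_sum, Finset.sum_mul]
    exact Finset.sum_congr rfl fun k _ => Finset.sum_mul _ _ _
  have hexpI : ∀ (j : Fin N) (p : (Fin N → Plane) → ℝ), Integrable p →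
      ∫ X : Fin N → Plane, (∑ l ∈ Finset.univ.erase j, h (X j - X l)) ^ 2 * p X =
      ∑ k ∈ Finset.univ.erase j, ∑ l ∈ Finset.univ.erase j,
        ∫ X : Fin N → Plane, h (X j - X k) * h (X j - X l) * p X := by
    intro j p hp
    have hi : ∀ k l : Fin N, Integrable fun X : Fin N → Plane =>
        h (X j - X k) * h (X j - X l) * p X := fun k l =>
      hp.bdd_mul ((hmeas j k).mul (hmeas j l)).aestronglyMeasurable
        (Eventually.of_forall (hbd' j k l))
    simp only [hexp]
    rw [integral_finsetSum _ fun k _ => integrable_finsetSum _ fun l _ => hi k l]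
    exact Finset.sum_congr rfl fun k _ => integral_finsetSum _ fun l _ => hi k l
  have hP : ∀ σ : Equiv.Perm (Fin N), Integrable fun X : Fin N → Plane =>
      ∏ m, ‖u (σ m) (X m)‖ ^ 2 := fun σ =>
    Integrable.fintype_prod fun m => integrable_norm_sq (u (σ m))
  have hstep : ∀ j, ∫ X : Fin N → Plane, (∑ l ∈ Finset.univ.erase j, h (X j - X l)) ^ 2 *
      ‖slater (fun j => u j) X‖ ^ 2 ≤ (N.factorial : ℝ)⁻¹ * 6 * ∑ σ : Equiv.Perm (Fin N),
        ∫ X : Fin N → Plane, (∑ l ∈ Finset.univ.erase j, h (X j - X l)) ^ 2 *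
          ∏ m, ‖u (σ m) (X m)‖ ^ 2 := by
    intro j
    rw [hexpI j _ hΨ]
    simp only [hexpI j _ (hP _)]
    have hswap : ∀ J : Equiv.Perm (Fin N) → Fin N → Fin N → ℝ,
        ∑ σ, ∑ k ∈ Finset.univ.erase j, ∑ l ∈ Finset.univ.erase j, J σ k l
        = ∑ k ∈ Finset.univ.erase j, ∑ l ∈ Finset.univ.erase j, ∑ σ, J σ k l := by
      intro J
      rw [Finset.sum_comm]
      exact Finset.sum_congr rfl fun k _ => Finset.sum_comm
    rw [hswap]
    simp only [Finset.mul_sum (Finset.univ.erase j)]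
    refine Finset.sum_le_sum fun k _ => Finset.sum_le_sum fun l _ => ?_
    classical
    -- Each term of the expanded square depends on at most three variables, whence the factor `3! =
    -- 6`. Coincidences among `j, k, l` only lower it.
    refine (integral_mul_norm_slater_sq_le ho (W := fun X => h (X j - X k) * h (X j - X l))
      ((hmeas j k).mul (hmeas j l)) (fun X => mul_nonneg (h0 _) (h0 _)) (hbd j k l) {j, k, l} ?_).trans ?_
    · intro i hi X x
      simp only [Finset.mem_insert, Finset.mem_singleton, not_or] at hi
      rw [Function.update_of_ne (Ne.symm hi.1), Function.update_of_ne (Ne.symm hi.2.1),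
        Function.update_of_ne (Ne.symm hi.2.2)]
    · refine mul_le_mul_of_nonneg_right (mul_le_mul_of_nonneg_left ?_ (by positivity))
        (Finset.sum_nonneg fun σ _ => integral_nonneg fun X => mul_nonneg
          (mul_nonneg (h0 _) (h0 _)) (Finset.prod_nonneg fun _ _ => by positivity))
      have : (({j, k, l} : Finset (Fin N)).card).factorial ≤ (3).factorial :=
        Nat.factorial_le Finset.card_le_three
      calc ((({j, k, l} : Finset (Fin N)).card.factorial : ℕ) : ℝ) ≤ ((3).factorial : ℕ) := by
            exact_mod_cast this
        _ = 6 := by norm_num [Nat.factorial]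
  have hρm : Measurable ρ := Finset.measurable_sum _ fun m _ =>
    ((Lp.stronglyMeasurable (u m)).measurable.norm.pow_const 2)
  have hρi : Integrable ρ := integrable_finsetSum _ fun m _ => integrable_norm_sq (u m)
  have hρ0 : ∀ x, 0 ≤ ρ x := fun x => Finset.sum_nonneg fun _ _ => by positivity
  have hq : Measurable fun x => ∫ y, h (x - y) ^ 2 * ρ y := by
    refine StronglyMeasurable.measurable ?_
    refine StronglyMeasurable.integral_prod_right (f := fun x y => h (x - y) ^ 2 * ρ y) ?_
    refine Measurable.stronglyMeasurable ?_
    exact Measurable.mul ((hh.comp (measurable_fst.sub measurable_snd)).pow_const 2)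
      (hρm.comp measurable_snd)
  have hqb : ∀ x, ‖∫ y, h (x - y) ^ 2 * ρ y‖ ≤ C ^ 2 * ∫ y, ρ y := by
    intro x
    rw [Real.norm_of_nonneg (integral_nonneg fun y => mul_nonneg (sq_nonneg _) (hρ0 y)),
      ← integral_const_mul]
    refine integral_mono_of_nonneg (Eventually.of_forall fun y => mul_nonneg (sq_nonneg _) (hρ0 y))
      (hρi.const_mul _) (Eventually.of_forall fun y => ?_)
    exact mul_le_mul_of_nonneg_right (pow_le_pow_left₀ (h0 _) (hC _) 2) (hρ0 y)
  have hqi : ∀ j, Integrable fun x => ‖u j x‖ ^ 2 * ((∫ y, h (x - y) ^ 2 * ρ y) + B) := by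
    intro j
    have := ((integrable_norm_sq (u j)).bdd_mul hq.aestronglyMeasurable
        (Eventually.of_forall hqb)).add ((integrable_norm_sq (u j)).const_mul B)
    refine this.congr (Eventually.of_forall fun x => ?_)
    simp only [Pi.add_apply]
    ring
  have htot : ∑ j, ∫ x, ‖u j x‖ ^ 2 * ((∫ y, h (x - y) ^ 2 * ρ y) + B) ≤ Q + N * B := by
    rw [← integral_finsetSum _ fun j _ => hqi j]
    have : ∀ x, ∑ j, ‖u j x‖ ^ 2 * ((∫ y, h (x - y) ^ 2 * ρ y) + B)
        = (ρ x * ∫ y, h (x - y) ^ 2 * ρ y) + B * ρ x := by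
      intro x
      rw [← Finset.sum_mul, hρdef, density]
      ring
    simp only [this]
    have hi : Integrable fun x => ρ x * ∫ y, h (x - y) ^ 2 * ρ y :=
      hρi.mul_bdd hq.aestronglyMeasurable (Eventually.of_forall hqb)
    rw [integral_add hi (hρi.const_mul B), integral_const_mul]
    have hmass : ∫ x, ρ x = N := by
      rw [hρdef]
      simp only [density]
      rw [integral_finsetSum _ fun m _ => integrable_norm_sq (u m)]
      simp [integral_norm_sq, ho.1]
    rw [hmass]
    linarith
  calc _ ≤ ∑ j, (N.factorial : ℝ)⁻¹ * 6 * ∑ σ : Equiv.Perm (Fin N),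
        ∫ X : Fin N → Plane, (∑ l ∈ Finset.univ.erase j, h (X j - X l)) ^ 2 *
          ∏ m, ‖u (σ m) (X m)‖ ^ 2 := Finset.sum_le_sum fun j _ => hstep j
    _ = (N.factorial : ℝ)⁻¹ * 6 * ∑ σ : Equiv.Perm (Fin N), ∑ j,
        ∫ X : Fin N → Plane, (∑ l ∈ Finset.univ.erase j, h (X j - X l)) ^ 2 *
          ∏ m, ‖u (σ m) (X m)‖ ^ 2 := by rw [← Finset.mul_sum, Finset.sum_comm]
    _ ≤ (N.factorial : ℝ)⁻¹ * 6 * ∑ σ : Equiv.Perm (Fin N), (Q + N * B) := by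
        refine mul_le_mul_of_nonneg_left (Finset.sum_le_sum fun σ _ => ?_) (by positivity)
        refine le_trans (Finset.sum_le_sum fun j _ => integral_pair_sq_mul_prod_le
          (v := fun m => u (σ m)) (fun m => ho.1 _) hh h0 hC (ρ := ρ) (fun x => ?_) hB j) ?_
        · rw [hρdef, density]
          exact (Equiv.sum_comp σ fun m => ‖u m x‖ ^ 2).symm
        · rw [Equiv.sum_comp σ fun j => ∫ x, ‖u j x‖ ^ 2 * ((∫ y, h (x - y) ^ 2 * ρ y) + B)]
          exact htot
    _ = 6 * (Q + N * B) := by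
        have : (N.factorial : ℝ) ≠ 0 := by positivity
        rw [Finset.sum_const, Finset.card_univ, Fintype.card_perm, Fintype.card_fin, nsmul_eq_mul]
        field_simp

/-! ### Weak derivatives of Slater determinants -/

theorem memLp_locallyIntegrable {N : ℕ} {f : (Fin N → Plane) → ℂ} (hf : MemLp f 2) :
    LocallyIntegrable f :=
  hf.locallyIntegrable (by norm_num)

/-- By Fubini it suffices to fix all variables but the `i`-th. The test function then restricts to a
one-particle test function, compactly supported because the slice is a closed embedding. -/
theorem hasWeakDeriv_prod {N : ℕ} (f : Fin N → L2Plane) (i : Fin N) {v : Plane} {w : L2Plane}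
    (hw : HasWeakDeriv v (f i) w) :
    HasWeakDeriv (Pi.single i v) (fun X : Fin N → Plane => ∏ j, f j (X j))
      (fun X => ∏ j, (Function.update f i w) j (X j)) := by
  refine ⟨memLp_locallyIntegrable (memLp_prod f), memLp_locallyIntegrable (memLp_prod _),
    fun φ hφ hc => ?_⟩
  have I1 := integrable_fderiv_smul (v := Pi.single i v) (memLp_locallyIntegrable (memLp_prod f))
    hφ hc
  have I2 := (memLp_locallyIntegrable
    (memLp_prod (Function.update f i w))).integrable_smul_left_of_hasCompactSupport hφ.continuous hc
  cases N with
  | zero => exact i.elim0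
  | succ n =>
    rw [integral_insertNth _ i, Measure.volume_eq_prod, integral_prod_symm _ (integrable_insertNth I1 i),
      integral_insertNth _ i, Measure.volume_eq_prod, integral_prod_symm _ (integrable_insertNth I2 i),
      ← integral_neg]
    congr 1 with Y
    have hupd : ∀ x : Plane, (i.insertNth x Y : Fin (n + 1) → Plane)
        = Function.update (i.insertNth (0 : Plane) Y : Fin (n + 1) → Plane) i x := fun x =>
      (Fin.update_insertNth (α := fun _ => Plane) i 0 x Y).symm
    let ι : Plane → Fin (n + 1) → Plane :=
      Function.update (i.insertNth (0 : Plane) Y : Fin (n + 1) → Plane) i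
    have hι : ContDiff ℝ ∞ ι := contDiff_update _ _ _
    have hemb : IsClosedEmbedding ι := by
      refine Function.LeftInverse.isClosedEmbedding (f := fun X => X i) (fun x => ?_)
        (continuous_apply i) hι.continuous
      simp [ι]
    have hd : ∀ x, fderiv ℝ φ (ι x) (Pi.single i v) = fderiv ℝ (fun x => φ (ι x)) x v := by
      intro x
      have h1 : HasFDerivAt φ (fderiv ℝ φ (ι x)) (ι x) :=
        ((hφ.differentiable (by simp)) _).hasFDerivAt
      have h2 := h1.comp x (hasFDerivAt_update (𝕜 := ℝ)
        (i.insertNth (0 : Plane) Y : Fin (n + 1) → Plane) (i := i) x)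
      have h3 := h2.fderiv
      change fderiv ℝ (fun x => φ (ι x)) x = _ at h3
      rw [h3, ContinuousLinearMap.comp_apply]
      congr 1
      ext j
      rcases eq_or_ne j i with rfl | hj
      · simp
      · simp [hj]
    have key := hw.2.2 (fun x => φ (ι x)) (hφ.comp hι) (hc.comp_isClosedEmbedding hemb)
    have e1 : ∀ x : Plane, (fderiv ℝ φ (i.insertNth x Y) (Pi.single i v)) •
        ∏ j, f j ((i.insertNth x Y : Fin (n + 1) → Plane) j)
        = ((fderiv ℝ (fun x => φ (ι x)) x v) • f i x) * ∏ j, f (i.succAbove j) (Y j) := by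
      intro x
      rw [← hd, Fin.prod_univ_succAbove _ i]
      simp only [Fin.insertNth_apply_same, Fin.insertNth_apply_succAbove, ι, ← hupd, smul_mul_assoc]
    have e2 : ∀ x : Plane, φ (i.insertNth x Y) •
        ∏ j, (Function.update f i w) j ((i.insertNth x Y : Fin (n + 1) → Plane) j)
        = (φ (ι x) • w x) * ∏ j, f (i.succAbove j) (Y j) := by
      intro x
      rw [Fin.prod_univ_succAbove _ i]
      simp only [Fin.insertNth_apply_same, Fin.insertNth_apply_succAbove, ι, ← hupd, smul_mul_assoc,
        Function.update_self, Function.update_of_ne (Fin.succAbove_ne i _)]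
    simp only [e1, e2, integral_mul_const, key, neg_mul]

/-- The derivative of the Slater determinant of `u` in the `i`-th variable, `w` being the derivative
of `u`. -/
def slaterDeriv {N : ℕ} (u w : Fin N → L2Plane) (i : Fin N) (X : Fin N → Plane) : ℂ :=
  ((Real.sqrt (N.factorial : ℝ))⁻¹ : ℝ) * ∑ σ : Equiv.Perm (Fin N),
    ((Equiv.Perm.sign σ : ℤ) : ℂ) * ∏ j, (Function.update (fun j => u (σ j)) i (w (σ i))) j (X j)

theorem memLp_slaterDeriv {N : ℕ} (u w : Fin N → L2Plane) (i : Fin N) :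
    MemLp (slaterDeriv u w i) 2 :=
  memLp_sum_prod (fun σ => Function.update (fun j => u (σ j)) i (w (σ i))) _

theorem hasWeakDeriv_slater {N : ℕ} {u w : Fin N → L2Plane} {v : Plane}
    (hw : ∀ j, HasWeakDeriv v (u j) (w j)) (i : Fin N) :
    HasWeakDeriv (Pi.single i v) (slater fun j => u j) (slaterDeriv u w i) :=
  (HasWeakDeriv.sum _ fun σ _ => (hasWeakDeriv_prod (fun j => u (σ j)) i (hw (σ i))).const_mul _).const_mul _

/-- A permutation cannot move exactly one point. After differentiation the `i`-th factors are no
longer orthogonal, so a disagreement elsewhere is needed to kill the cross terms. -/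
theorem perm_exists_ne_of_ne {N : ℕ} {σ τ : Equiv.Perm (Fin N)} (h : σ ≠ τ) (i : Fin N) :
    ∃ j, j ≠ i ∧ σ j ≠ τ j := by
  by_contra! hcon
  apply h
  have h1 : ∀ j, j ≠ i → (τ⁻¹ * σ) j = j := fun j hj => by
    rw [Equiv.Perm.mul_apply, hcon j hj]; simp
  have h2 : (τ⁻¹ * σ) i = i := by
    by_contra hi
    have := h1 _ hi
    exact hi ((τ⁻¹ * σ).injective this)
  have h3 : τ⁻¹ * σ = 1 := by
    ext j
    by_cases hj : j = i
    · subst hj; rw [h2]; rfl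
    · rw [h1 j hj]; rfl
  exact (inv_mul_eq_one.1 h3).symm

theorem integral_norm_slaterDeriv_sq {N : ℕ} {u w : Fin N → L2Plane} (ho : Orthonormal ℂ u)
    (i : Fin N) : ∫ X, ‖slaterDeriv u w i X‖ ^ 2
      = (N.factorial : ℝ)⁻¹ * ∑ σ : Equiv.Perm (Fin N), ‖w (σ i)‖ ^ 2 := by
  let f : Equiv.Perm (Fin N) → Fin N → L2Plane := fun σ =>
    Function.update (fun j => u (σ j)) i (w (σ i))
  have e0 : ∀ X, ‖slaterDeriv u w i X‖ ^ 2 = (N.factorial : ℝ)⁻¹ * (1 *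
      ‖∑ σ : Equiv.Perm (Fin N), ((Equiv.Perm.sign σ : ℤ) : ℂ) * ∏ j, f σ j (X j)‖ ^ 2) := by
    intro X
    rw [slaterDeriv, norm_mul, mul_pow, Complex.norm_real, norm_inv,
      Real.norm_of_nonneg (Real.sqrt_nonneg _), inv_pow, Real.sq_sqrt (by positivity), one_mul]
  simp only [e0]
  rw [integral_const_mul, integral_mul_norm_sum_sq (f := f) (W := fun _ => 1) measurable_const
    (C := 1) (fun _ => by simp)]
  congr 1
  refine Finset.sum_congr rfl fun σ _ => ?_
  have hprod : ∀ τ, ∫ X : Fin N → Plane, (1 : ℝ) • ∏ j, (starRingEnd ℂ (f σ j (X j)) * f τ j (X j))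
      = ∏ j, inner ℂ (f σ j) (f τ j) := by
    intro τ
    simp only [one_smul]
    rw [integral_fintype_prod_volume_eq_prod (fun j x => starRingEnd ℂ (f σ j x) * f τ j x)]
    exact Finset.prod_congr rfl fun j _ => integral_conj_mul _ _
  simp only [hprod]
  rw [Finset.sum_eq_single_of_mem σ (Finset.mem_univ _)]
  · have hs : ((Equiv.Perm.sign σ : ℤ) : ℝ) * ((Equiv.Perm.sign σ : ℤ) : ℝ) = 1 := by
      rcases Int.units_eq_one_or (Equiv.Perm.sign σ) with h | h <;> simp [h]
    rw [hs, one_mul, Finset.prod_eq_single_of_mem i (Finset.mem_univ _)]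
    · simp only [f, Function.update_self]
      rw [inner_self_eq_norm_sq_to_K]
      norm_cast
    · intro j _ hj
      simp only [f, Function.update_of_ne hj]
      rw [inner_self_eq_norm_sq_to_K, ho.1]
      simp
  · intro τ _ hτ
    obtain ⟨j, hj, hne⟩ := perm_exists_ne_of_ne hτ i
    rw [Finset.prod_eq_zero (Finset.mem_univ j)]
    · simp
    · simp only [f, Function.update_of_ne hj]
      exact ho.2 hne.symm

/-- The kinetic energy of a Slater determinant. -/
theorem sum_integral_norm_slaterDeriv_sq {N : ℕ} {u w : Fin N → L2Plane} (ho : Orthonormal ℂ u) :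
    ∑ i, ∫ X, ‖slaterDeriv u w i X‖ ^ 2 = ∑ j, ‖w j‖ ^ 2 := by
  simp only [integral_norm_slaterDeriv_sq ho]
  rw [← Finset.mul_sum, Finset.sum_comm]
  have : ∀ σ : Equiv.Perm (Fin N), ∑ i, ‖w (σ i)‖ ^ 2 = ∑ j, ‖w j‖ ^ 2 := fun σ =>
    Equiv.sum_comp σ fun j => ‖w j‖ ^ 2
  simp only [this]
  have : (N.factorial : ℝ) ≠ 0 := by positivity
  rw [Finset.sum_const, Finset.card_univ, Fintype.card_perm, Fintype.card_fin, nsmul_eq_mul]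
  field_simp

/-! ### The vector potential as a function -/

theorem continuous_aN (N : ℕ) {s R : ℝ} (hs : 0 ≤ s) (hR : 0 < R) : Continuous (aN N s R) := by
  have h1 : Continuous fun x : Plane => max ‖x‖ R := by fun_prop
  have h2 : Continuous perp := by
    unfold perp
    fun_prop
  have h3 : Continuous fun x : Plane => ((max ‖x‖ R) ^ (1 + s))⁻¹ := by
    refine (h1.rpow_const fun x => Or.inr (by linarith)).inv₀ fun x => ?_
    have : 0 < max ‖x‖ R := lt_max_of_lt_right hR
    positivity
  exact (h3.smul h2).const_smul ((N : ℝ) ^ (s / 2 - 1))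

/-- This bound degenerates as `R → 0`. It serves only for boundedness and integrability and enters
no final constant. -/
theorem norm_aN_le {N : ℕ} (hN : 1 ≤ N) {s R : ℝ} (hs : 0 ≤ s) (hs1 : s ≤ 1 / 2) (hR : 0 < R)
    (x : Plane) : ‖aN N s R x‖ ≤ (R ^ s)⁻¹ := by
  have hm : 0 < max ‖x‖ R := lt_max_of_lt_right hR
  have e1 : ‖aN N s R x‖ = (N : ℝ) ^ (s / 2 - 1) * (((max ‖x‖ R) ^ (1 + s))⁻¹ * ‖x‖) := by
    rw [aN, aR, norm_smul, norm_smul, norm_perp, Real.norm_of_nonneg (by positivity),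
      Real.norm_of_nonneg (by positivity)]
  have h1 : (N : ℝ) ^ (s / 2 - 1) ≤ 1 :=
    Real.rpow_le_one_of_one_le_of_nonpos (by exact_mod_cast hN) (by linarith)
  have h2 : ((max ‖x‖ R) ^ (1 + s))⁻¹ * ‖x‖ ≤ (R ^ s)⁻¹ := by
    have : 0 < (max ‖x‖ R) ^ s := by positivity
    have hRs : 0 < R ^ s := by positivity
    calc ((max ‖x‖ R) ^ (1 + s))⁻¹ * ‖x‖ ≤ ((max ‖x‖ R) ^ (1 + s))⁻¹ * max ‖x‖ R := by
          gcongr; exact le_max_left _ _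
      _ = ((max ‖x‖ R) ^ s)⁻¹ := by
          rw [Real.rpow_add hm, Real.rpow_one]
          field_simp
      _ ≤ _ := by
          gcongr
          exact le_max_right _ _
  rw [e1]
  calc _ ≤ 1 * (R ^ s)⁻¹ := mul_le_mul h1 h2 (by positivity) zero_le_one
    _ = _ := one_mul _

/-! ### A lower bound for the microscopic energy -/

theorem norm_neg_I_mul_add_sq_ge (z w : ℂ) (b : ℝ) :
    ‖z‖ ^ 2 / 2 - b ^ 2 * ‖w‖ ^ 2 ≤ ‖-Complex.I * z + (b : ℂ) * w‖ ^ 2 := by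
  have h := norm_sub_le (-Complex.I * z + (b : ℂ) * w) ((b : ℂ) * w)
  rw [add_sub_cancel_right, norm_mul, norm_neg, Complex.norm_I, one_mul, norm_mul, Complex.norm_real,
    Real.norm_eq_abs] at h
  have h2 : ‖z‖ ^ 2 ≤ (‖-Complex.I * z + (b : ℂ) * w‖ + |b| * ‖w‖) ^ 2 :=
    pow_le_pow_left₀ (norm_nonneg _) h 2
  have h3 : (|b| * ‖w‖) ^ 2 = b ^ 2 * ‖w‖ ^ 2 := by rw [mul_pow, sq_abs]
  nlinarith [sq_nonneg (‖-Complex.I * z + (b : ℂ) * w‖ - |b| * ‖w‖)]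

/-- The repulsion is nonnegative and is dropped. For the rest, `|-i∇Ψ + bΨ|² ≥ |∇Ψ|²/2 - |bΨ|²`. The
first term sums to half the kinetic energy of the orbitals, and the second is the squared total
interaction controlled by `sum_integral_pair_sq_slater_le`. -/
theorem microEnergy_slater_ge {N : ℕ} (hN : 1 ≤ N) {β g s R : ℝ} (hg : 0 ≤ g) (hs : 0 ≤ s)
    (hs1 : s ≤ 1 / 2) (hR : 0 < R) {u : Fin N → L2Plane} (ho : Orthonormal ℂ u)
    {w : Fin N → Fin 2 → L2Plane} (hw : ∀ j k, HasWeakDeriv (e k) (u j) (w j k)) {B Q : ℝ}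
    (hB : ∀ x, (∫ y, ‖aN N s R (x - y)‖ * density (fun j => u j) y) ^ 2 ≤ B)
    (hQ : ∫ x, density (fun j => u j) x *
      ∫ y, ‖aN N s R (x - y)‖ ^ 2 * density (fun j => u j) y ≤ Q) :
    (∑ j, ∑ k, ‖w j k‖ ^ 2) / 2 - β ^ 2 * (6 * (Q + N * B))
      ≤ microEnergy β g s R (slater fun j => u j) := by
  have hac := continuous_aN N hs hR
  set Ψ := slater fun j => u j with hΨdef
  have hΨ : MemLp Ψ 2 := memLp_slater u
  have hΨi : Integrable fun X => ‖Ψ X‖ ^ 2 := hΨ.integrable_norm_pow (by norm_num)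
  let D : Fin N → Fin 2 → (Fin N → Plane) → ℂ := fun j k => slaterDeriv u (fun m => w m k) j
  have hD : ∀ j k, HasWeakDeriv (Pi.single j (e k)) Ψ (D j k) := fun j k =>
    hasWeakDeriv_slater (fun m => hw m k) j
  have hDm : ∀ j k, MemLp (D j k) 2 := fun j k => memLp_slaterDeriv _ _ _
  let b : Fin N → Fin 2 → (Fin N → Plane) → ℝ := fun j k Y =>
    β * ∑ l ∈ Finset.univ.erase j, aN N s R (Y j - Y l) k
  let S : Fin N → (Fin N → Plane) → ℝ := fun j X =>
    ∑ l ∈ Finset.univ.erase j, ‖aN N s R (X j - X l)‖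
  have hbS : ∀ j X, ∑ k, (b j k X) ^ 2 ≤ β ^ 2 * (S j X) ^ 2 := by
    intro j X
    have : ∑ k, (b j k X) ^ 2
        = β ^ 2 * ‖∑ l ∈ Finset.univ.erase j, aN N s R (X j - X l)‖ ^ 2 := by
      rw [EuclideanSpace.norm_sq_eq, Finset.mul_sum]
      refine Finset.sum_congr rfl fun k _ => ?_
      simp only [b, mul_pow]
      congr 1
      rw [Real.norm_eq_abs, sq_abs]
      congr 1
      simp
    rw [this]
    gcongr
    exact norm_sum_le _ _
  have hbc : ∀ j k, Continuous (b j k) := by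
    intro j k
    refine continuous_const.mul (continuous_finsetSum _ fun l _ => ?_)
    have : Continuous fun Y : Fin N → Plane => aN N s R (Y j - Y l) :=
      hac.comp ((continuous_apply j).sub (continuous_apply l))
    exact (EuclideanSpace.proj (𝕜 := ℝ) k).continuous.comp this
  have hSm : ∀ j, Continuous (S j) := by
    intro j
    refine continuous_finsetSum _ fun l _ => ?_
    exact (hac.comp ((continuous_apply j).sub (continuous_apply l))).norm
  have hC := norm_aN_le hN hs hs1 hR
  have hS0 : ∀ j X, 0 ≤ S j X := fun j X => Finset.sum_nonneg fun l _ => norm_nonneg _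
  have hSb : ∀ j X, S j X ≤ (Finset.univ.erase j).card • (R ^ s)⁻¹ := fun j X =>
    Finset.sum_le_card_nsmul _ _ _ fun l _ => hC _
  have hbb : ∀ j k X, ‖b j k X‖ ≤ |β| * ((Finset.univ.erase j).card • (R ^ s)⁻¹) := by
    intro j k X
    have h1 : (b j k X) ^ 2 ≤ (|β| * S j X) ^ 2 := by
      have e1 : (|β| * S j X) ^ 2 = β ^ 2 * S j X ^ 2 := by rw [mul_pow, sq_abs]
      rw [e1]
      exact (Finset.single_le_sum (f := fun k => (b j k X) ^ 2) (fun _ _ => sq_nonneg _)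
        (Finset.mem_univ k)).trans (hbS j X)
    rw [Real.norm_eq_abs]
    refine (abs_le_of_sq_le_sq h1 (mul_nonneg (abs_nonneg _) (hS0 j X))).trans ?_
    exact mul_le_mul_of_nonneg_left (hSb j X) (abs_nonneg _)
  have hcov : ∀ j k, covDeriv (Pi.single j (e k)) (b j k) Ψ =ᵐ[volume]
      fun X => -Complex.I * D j k X + (b j k X : ℂ) * Ψ X := by
    intro j k
    filter_upwards [(hD j k).weakDeriv_ae_eq] with X hX
    rw [covDeriv, hX]
  have hcovm : ∀ j k, MemLp (fun X => -Complex.I * D j k X + (b j k X : ℂ) * Ψ X) 2 := by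
    intro j k
    refine ((hDm j k).const_mul _).add ?_
    refine MemLp.of_le_mul (c := |β| * ((Finset.univ.erase j).card • (R ^ s)⁻¹)) hΨ
      ((Complex.continuous_ofReal.comp (hbc j k)).aestronglyMeasurable.mul hΨ.1)
      (Eventually.of_forall fun X => ?_)
    rw [norm_mul, Complex.norm_real]
    exact mul_le_mul_of_nonneg_right (hbb j k X) (norm_nonneg _)
  have hcovi : ∀ j k, Integrable fun X => ‖covDeriv (Pi.single j (e k)) (b j k) Ψ X‖ ^ 2 := by
    intro j k
    refine ((hcovm j k).integrable_norm_pow (by norm_num)).congr ?_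
    filter_upwards [hcov j k] with X hX
    rw [hX]
  have hDi : ∀ j k, Integrable fun X => ‖D j k X‖ ^ 2 := fun j k =>
    (hDm j k).integrable_norm_pow (by norm_num)
  have hSi : ∀ j, Integrable fun X => (S j X) ^ 2 * ‖Ψ X‖ ^ 2 := by
    intro j
    refine hΨi.bdd_mul (c := ((Finset.univ.erase j).card • (R ^ s)⁻¹) ^ 2)
      ((hSm j).pow 2).aestronglyMeasurable (Eventually.of_forall fun X => ?_)
    rw [Real.norm_of_nonneg (sq_nonneg _)]
    exact pow_le_pow_left₀ (hS0 j X) (hSb j X) 2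
  have hj : ∀ j, (∑ k, ∫ X, ‖D j k X‖ ^ 2) / 2 - β ^ 2 * ∫ X, (S j X) ^ 2 * ‖Ψ X‖ ^ 2
      ≤ ∫ X, ∑ k, ‖covDeriv (Pi.single j (e k)) (b j k) Ψ X‖ ^ 2 := by
    intro j
    rw [← integral_finsetSum _ fun k _ => hDi j k, ← integral_div, ← integral_const_mul,
      ← integral_sub ((integrable_finsetSum _ fun k _ => hDi j k).div_const 2) ((hSi j).const_mul _)]
    refine integral_mono_ae (((integrable_finsetSum _ fun k _ => hDi j k).div_const 2).sub
      ((hSi j).const_mul _)) (integrable_finsetSum _ fun k _ => hcovi j k) ?_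
    filter_upwards [ae_all_iff.2 (hcov j)] with X hX
    simp only [hX]
    calc _ ≤ (∑ k, ‖D j k X‖ ^ 2) / 2 - (∑ k, (b j k X) ^ 2) * ‖Ψ X‖ ^ 2 := by
          have := mul_le_mul_of_nonneg_right (hbS j X) (sq_nonneg ‖Ψ X‖)
          linarith
      _ = ∑ k, (‖D j k X‖ ^ 2 / 2 - (b j k X) ^ 2 * ‖Ψ X‖ ^ 2) := by
          rw [Finset.sum_sub_distrib, Finset.sum_div, Finset.sum_mul]
      _ ≤ _ := Finset.sum_le_sum fun k _ => norm_neg_I_mul_add_sq_ge _ _ _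
  have hpair := sum_integral_pair_sq_slater_le ho (h := fun x => ‖aN N s R x‖)
    hac.norm.measurable (fun _ => norm_nonneg _) hC hB hQ
  have hkin : ∑ j, ∑ k, ∫ X, ‖D j k X‖ ^ 2 = ∑ j, ∑ k, ‖w j k‖ ^ 2 := by
    rw [Finset.sum_comm]
    simp only [D]
    simp_rw [sum_integral_norm_slaterDeriv_sq ho]
    rw [Finset.sum_comm]
  have hpos : 0 ≤ g / 2 * N * ∑ j : Fin N, ∑ l ∈ Finset.univ.erase j,
        ∫ X : Fin N → Plane, ‖aN N s R (X j - X l)‖ ^ 2 * ‖Ψ X‖ ^ 2 := by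
    refine mul_nonneg (by positivity) (Finset.sum_nonneg fun j _ => Finset.sum_nonneg fun l _ =>
      integral_nonneg fun X => by positivity)
  have hsum := Finset.sum_le_sum fun j (_ : j ∈ Finset.univ) => hj j
  rw [Finset.sum_sub_distrib, ← Finset.sum_div, hkin, ← Finset.mul_sum] at hsum
  have hmul := mul_le_mul_of_nonneg_left hpair (sq_nonneg β)
  rw [microEnergy]
  change _ ≤ (∑ j : Fin N, ∫ X : Fin N → Plane, ∑ k : Fin 2,
    ‖covDeriv (Pi.single j (e k)) (b j k) Ψ X‖ ^ 2) + _
  linarith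

/-! ### Products, convolutions and pairings of Lebesgue spaces -/

section Bilinear

open scoped ENNReal BoundedContinuousFunction

/-- The product of a bounded real function with a square-integrable function. -/
def mulL : Lp ℝ ∞ (volume : Measure Plane) →L[ℝ] L2Plane →L[ℝ] L2Plane :=
  (ContinuousLinearMap.lsmul ℝ ℝ : ℝ →L[ℝ] ℂ →L[ℝ] ℂ).holderL volume ∞ 2 2

/-- The real bilinear form `Re (z̄ w)` on the complex numbers. -/
def reInner : ℂ →L[ℝ] ℂ →L[ℝ] ℝ :=
  IsBoundedBilinearMap.toContinuousLinearMap (𝕜 := ℝ)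
    (f := fun p : ℂ × ℂ => (inner ℝ p.1 p.2 : ℝ)) isBoundedBilinearMap_inner

/-- The product `Re (f̄ g)` of square-integrable functions. -/
def crossL : L2Plane →L[ℝ] L2Plane →L[ℝ] Lp ℝ 1 (volume : Measure Plane) :=
  reInner.holderL volume 2 2 1

/-- The duality pairing of bounded and integrable functions. -/
def pairL : Lp ℝ ∞ (volume : Measure Plane) →L[ℝ] Lp ℝ 1 (volume : Measure Plane) →L[ℝ] ℝ :=
  (ContinuousLinearMap.mul ℝ ℝ).lpPairing volume ∞ 1

theorem mulL_ae (b : Lp ℝ ∞ (volume : Measure Plane)) (f : L2Plane) :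
    ∀ᵐ x, mulL b f x = (b x : ℂ) * f x := by
  filter_upwards [(ContinuousLinearMap.lsmul ℝ ℝ : ℝ →L[ℝ] ℂ →L[ℝ] ℂ).coeFn_holder (r := 2) b f]
    with x hx
  exact hx.trans (by simp)

theorem crossL_ae (f g : L2Plane) :
    ∀ᵐ x, crossL f g x = (starRingEnd ℂ (f x) * g x).re := by
  filter_upwards [reInner.coeFn_holder (r := 1) f g] with x hx
  refine hx.trans ?_
  change (inner ℝ (f x) (g x) : ℝ) = _
  rw [Complex.inner, mul_comm]

theorem pairL_apply (b : Lp ℝ ∞ (volume : Measure Plane)) (F : Lp ℝ 1 (volume : Measure Plane)) :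
    pairL b F = ∫ x, b x * F x :=
  (ContinuousLinearMap.mul ℝ ℝ).lpPairing_eq_integral b F

theorem crossL_comm (f g : L2Plane) : crossL f g = crossL g f := by
  refine Lp.ext ?_
  filter_upwards [crossL_ae f g, crossL_ae g f] with x h1 h2
  rw [h1, h2]
  simp [mul_comm]

theorem inner_mulL (b : Lp ℝ ∞ (volume : Measure Plane)) (f g : L2Plane) :
    inner ℂ (mulL b f) g = inner ℂ f (mulL b g) := by
  rw [← integral_conj_mul, ← integral_conj_mul]
  refine integral_congr_ae ?_
  filter_upwards [mulL_ae b f, mulL_ae b g] with x h1 h2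
  rw [h1, h2]
  simp
  ring

theorem pairL_crossL (b : Lp ℝ ∞ (volume : Measure Plane)) (f g : L2Plane) :
    pairL b (crossL f g) = (inner ℂ f (mulL b g)).re := by
  rw [← integral_conj_mul, pairL_apply]
  have := integral_re (integrable_conj_mul f (mulL b g))
  refine Eq.trans ?_ this
  refine integral_congr_ae ?_
  filter_upwards [mulL_ae b g, crossL_ae f g] with x h1 h2
  rw [h1, h2]
  simp
  ring

theorem integrable_conv (k : Plane →ᵇ ℝ) {F : Plane → ℝ} (hF : Integrable F) (x : Plane) :
    Integrable fun y => F y * k (x - y) := by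
  refine hF.mul_bdd (c := ‖k‖) ?_ (Eventually.of_forall fun y => k.norm_coe_le_norm _)
  exact (k.continuous.comp (continuous_const.sub continuous_id)).aestronglyMeasurable

theorem norm_conv_le (k : Plane →ᵇ ℝ) {F : Plane → ℝ} (hF : Integrable F) (x : Plane) :
    ‖∫ y, F y * k (x - y)‖ ≤ ‖k‖ * ∫ y, ‖F y‖ := by
  rw [← integral_const_mul]
  refine norm_integral_le_of_norm_le (hF.norm.const_mul _) (Eventually.of_forall fun y => ?_)
  rw [norm_mul, mul_comm]
  gcongr
  exact k.norm_coe_le_norm _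

theorem continuous_conv (k : Plane →ᵇ ℝ) {F : Plane → ℝ} (hF : Integrable F) :
    Continuous fun x => ∫ y, F y * k (x - y) := by
  refine continuous_of_dominated (bound := fun y => ‖F y‖ * ‖k‖)
    (fun x => (integrable_conv k hF x).1) (fun x => Eventually.of_forall fun y => ?_)
    (hF.norm.mul_const _) (Eventually.of_forall fun y => ?_)
  · rw [norm_mul]
    gcongr
    exact k.norm_coe_le_norm _
  · exact continuous_const.mul (k.continuous.comp (continuous_id.sub continuous_const))

theorem memLp_conv (k : Plane →ᵇ ℝ) {F : Plane → ℝ} (hF : Integrable F) :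
    MemLp (fun x => ∫ y, F y * k (x - y)) ∞ :=
  memLp_top_of_bound (continuous_conv k hF).aestronglyMeasurable _
    (Eventually.of_forall (norm_conv_le k hF))

/-- Convolution with a bounded continuous kernel. -/
def convL (k : Plane →ᵇ ℝ) :
    Lp ℝ 1 (volume : Measure Plane) →L[ℝ] Lp ℝ ∞ (volume : Measure Plane) :=
  LinearMap.mkContinuous
    { toFun := fun F => (memLp_conv k (L1.integrable_coeFn F)).toLp _
      map_add' := fun F G => by
        rw [← MemLp.toLp_add]
        refine MemLp.toLp_congr _ _ (Eventually.of_forall fun x => ?_)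
        simp only [Pi.add_apply]
        rw [← integral_add (integrable_conv k (L1.integrable_coeFn F) x)
          (integrable_conv k (L1.integrable_coeFn G) x)]
        refine integral_congr_ae ?_
        filter_upwards [Lp.coeFn_add F G] with y hy
        rw [hy, Pi.add_apply, add_mul]
      map_smul' := fun c F => by
        rw [RingHom.id_apply, ← MemLp.toLp_const_smul]
        refine MemLp.toLp_congr _ _ (Eventually.of_forall fun x => ?_)
        simp only [Pi.smul_apply, smul_eq_mul]
        rw [← integral_const_mul]
        refine integral_congr_ae ?_
        filter_upwards [Lp.coeFn_smul c F] with y hy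
        rw [hy, Pi.smul_apply, smul_eq_mul, mul_assoc] }
    ‖k‖ fun F => by
      change ‖(memLp_conv k (L1.integrable_coeFn F)).toLp _‖ ≤ _
      rw [Lp.norm_toLp, eLpNorm_exponent_top]
      refine ENNReal.toReal_le_of_le_ofReal (by positivity)
        (eLpNormEssSup_le_of_ae_bound (Eventually.of_forall fun x => ?_))
      refine (norm_conv_le k (L1.integrable_coeFn F) x).trans_eq ?_
      rw [L1.norm_eq_integral_norm]

theorem convL_ae (k : Plane →ᵇ ℝ) (F : Lp ℝ 1 (volume : Measure Plane)) :
    ∀ᵐ x, convL k F x = ∫ y, F y * k (x - y) :=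
  MemLp.coeFn_toLp (memLp_conv k (L1.integrable_coeFn F))

/-- Fubini. The parity `c` of the kernel is `-1` for the components of `a_N` and `1` for `|a_N|²`.
-/
theorem pairL_convL {k : Plane →ᵇ ℝ} {c : ℝ} (hk : ∀ x, k (-x) = c * k x)
    (F G : Lp ℝ 1 (volume : Measure Plane)) :
    pairL (convL k F) G = c * pairL (convL k G) F := by
  rw [pairL_apply, pairL_apply, ← integral_const_mul]
  have h1 : ∫ x, convL k F x * G x = ∫ x, ∫ y, F y * k (x - y) * G x := by
    refine integral_congr_ae ?_
    filter_upwards [convL_ae k F] with x hx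
    rw [hx, integral_mul_const]
  have h2 : ∫ x, c * (convL k G x * F x) = ∫ x, ∫ y, F x * k (y - x) * G y := by
    refine integral_congr_ae ?_
    filter_upwards [convL_ae k G] with x hx
    rw [hx, ← integral_mul_const, ← integral_const_mul]
    congr 1 with y
    rw [← neg_sub x y, hk]
    ring
  rw [h1, h2]
  refine integral_integral_swap ?_
  have h3 : Integrable (fun z : Plane × Plane => G z.1 * F z.2) (volume.prod volume) :=
    (L1.integrable_coeFn G).mul_prod (L1.integrable_coeFn F)
  have h4 : Integrable (fun z : Plane × Plane => G z.1 * F z.2 * k (z.1 - z.2))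
      (volume.prod volume) := by
    refine h3.mul_bdd (c := ‖k‖) ?_ (Eventually.of_forall fun y => k.norm_coe_le_norm _)
    exact (k.continuous.comp (continuous_fst.sub continuous_snd)).aestronglyMeasurable
  refine h4.congr (Eventually.of_forall fun z => ?_)
  simp only [Function.uncurry]
  ring

/-- The real inner product of square-integrable functions. -/
def reL : L2Plane →L[ℝ] L2Plane →L[ℝ] ℝ := reInner.lpPairing volume 2 2

theorem reL_apply (f g : L2Plane) : reL f g = (inner ℂ f g).re := by
  rw [← integral_conj_mul]
  refine (reInner.lpPairing_eq_integral f g).trans ?_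
  refine Eq.trans ?_ (integral_re (integrable_conj_mul f g))
  congr 1 with x
  change (inner ℝ (f x) (g x) : ℝ) = _
  rw [Complex.inner, mul_comm]
  rfl

theorem reL_comm (f g : L2Plane) : reL f g = reL g f := by
  rw [reL_apply, reL_apply, ← inner_conj_symm, Complex.conj_re]

theorem reL_self (f : L2Plane) : reL f f = ‖f‖ ^ 2 := by
  rw [reL_apply, inner_self_eq_norm_sq_to_K]
  norm_cast

theorem reL_mulL (b : Lp ℝ ∞ (volume : Measure Plane)) (f g : L2Plane) :
    reL (mulL b f) g = reL f (mulL b g) := by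
  rw [reL_apply, reL_apply, inner_mulL]

theorem reL_I_smul (f g : L2Plane) : reL (Complex.I • f) g = - reL f (Complex.I • g) := by
  rw [reL_apply, reL_apply, inner_smul_left, inner_smul_right]
  simp

theorem pairL_crossL_eq_reL (b : Lp ℝ ∞ (volume : Measure Plane)) (f g : L2Plane) :
    pairL b (crossL f g) = reL f (mulL b g) := by
  rw [reL_apply, pairL_crossL]

end Bilinear

/-! ### Lipschitz multipliers -/

theorem HasWeakDeriv.inner_eq_neg' {v : Plane} {f f' : L2Plane} {p p' : Plane → ℝ}
    (hf : HasWeakDeriv v f f') (hp : MemLp p 2) (hp' : MemLp p' 2)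
    (h : HasWeakDeriv v (fun x => (p x : ℂ)) fun x => (p' x : ℂ)) :
    ∫ x, (p' x : ℂ) * f x = - ∫ x, (p x : ℂ) * f' x := by
  have hC : ∀ {q : Plane → ℝ}, MemLp q 2 → MemLp (fun x => (q x : ℂ)) 2 := fun hq => hq.ofReal
  have e1 : HasWeakDeriv v (hC hp).toLp (hC hp').toLp :=
    h.congr (MemLp.coeFn_toLp _).symm (MemLp.coeFn_toLp _).symm
  have e2 := e1.inner_eq_neg hf
  rw [← integral_conj_mul, ← integral_conj_mul] at e2
  have e3 : ∀ {q : Plane → ℝ} (hq : MemLp q 2) (g : L2Plane),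
      ∫ x, starRingEnd ℂ ((hC hq).toLp (fun x => (q x : ℂ)) x) * g x = ∫ x, (q x : ℂ) * g x := by
    intro q hq g
    refine integral_congr_ae ?_
    filter_upwards [MemLp.coeFn_toLp (hC hq)] with x hx
    rw [hx]
    simp
  rwa [e3 hp', e3 hp] at e2

theorem exists_lipschitzWith_of_contDiff {φ : Plane → ℝ} (hφ : ContDiff ℝ ∞ φ)
    (hc : HasCompactSupport φ) : ∃ C, LipschitzWith C φ :=
  ContDiff.lipschitzWith_of_hasCompactSupport hc hφ (by simp)

theorem memLp_two_of_bdd_support {p : Plane → ℝ} (hp : AEStronglyMeasurable p) {M : ℝ}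
    (hM : ∀ x, ‖p x‖ ≤ M) (hc : HasCompactSupport p) : MemLp p 2 :=
  (memLp_top_of_bound hp M (Eventually.of_forall hM)).mono_exponent_of_measure_support_ne_top
    (s := tsupport p) (fun _ hx => image_eq_zero_of_notMem_tsupport hx)
    hc.measure_lt_top.ne le_top

/-- The product of a square-integrable function having a square-integrable weak derivative with
a bounded Lipschitz function has a square-integrable weak derivative. -/
theorem HasWeakDeriv.exists_mul_lipschitz {v : Plane} {f f' : L2Plane} (hf : HasWeakDeriv v f f')
    {b : Plane → ℝ} {K : NNReal} (hb : LipschitzWith K b) {M : ℝ} (hM : ∀ x, ‖b x‖ ≤ M) :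
    ∃ d : L2Plane, HasWeakDeriv v (fun x => (b x : ℂ) * f x) d := by
  have hbm : AEStronglyMeasurable b := hb.continuous.aestronglyMeasurable
  have hdm : AEStronglyMeasurable fun x => lineDeriv ℝ b x v :=
    (measurable_lineDeriv hb.continuous).aestronglyMeasurable
  have hdM : ∀ x, ‖lineDeriv ℝ b x v‖ ≤ K * ‖v‖ := fun x => norm_lineDeriv_le_of_lipschitz ℝ hb
  have hmul : ∀ {q : Plane → ℝ} {M : ℝ}, AEStronglyMeasurable q → (∀ x, ‖q x‖ ≤ M) →
      ∀ g : L2Plane, MemLp (fun x => (q x : ℂ) * g x) 2 := by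
    intro q M hq hM g
    exact (Lp.memLp g).mul (r := 2)
      (memLp_top_of_bound (f := fun x => (q x : ℂ)) (Complex.continuous_ofReal.comp_aestronglyMeasurable hq) M
        (Eventually.of_forall fun x => by simpa using hM x))
  have m1 := hmul hbm hM f
  have m2 := (hmul hbm hM f').add (hmul hdm hdM f)
  refine ⟨m2.toLp, HasWeakDeriv.congr (f := fun x => (b x : ℂ) * f x) ?_ EventuallyEq.rfl
    (MemLp.coeFn_toLp m2).symm⟩
  refine ⟨m1.locallyIntegrable (by norm_num), m2.locallyIntegrable (by norm_num),
    fun φ hφ hc => ?_⟩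
  obtain ⟨C, hC⟩ := exists_lipschitzWith_of_contDiff hφ hc
  have hφd : Differentiable ℝ φ := hφ.differentiable (by simp)
  have hdφc : Continuous fun x => fderiv ℝ φ x v :=
    (hφ.continuous_fderiv (by simp)).clm_apply continuous_const
  have hdφs : HasCompactSupport fun x => fderiv ℝ φ x v := hc.fderiv_apply ℝ v
  obtain ⟨A, hA⟩ := hφ.continuous.bounded_above_of_compact_support hc
  obtain ⟨A', hA'⟩ := hdφc.bounded_above_of_compact_support hdφs
  have hA0 : 0 ≤ A := (norm_nonneg _).trans (hA 0)
  have hA0' : 0 ≤ A' := (norm_nonneg _).trans (hA' 0)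
  -- The localized multiplier `φ b` becomes the test function for `f`. It is only Lipschitz, so
  -- integration by parts in `L²` is used in place of the definition of `HasWeakDeriv`.
  set p : Plane → ℝ := fun x => φ x * b x with hp
  set p' : Plane → ℝ := fun x => fderiv ℝ φ x v * b x + φ x * lineDeriv ℝ b x v with hp'
  have hpm : AEStronglyMeasurable p := hφ.continuous.aestronglyMeasurable.mul hbm
  have hpm1 : AEStronglyMeasurable (fun x => fderiv ℝ φ x v * b x) :=
    hdφc.aestronglyMeasurable.mul hbm
  have hpm2 : AEStronglyMeasurable (fun x => φ x * lineDeriv ℝ b x v) :=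
    hφ.continuous.aestronglyMeasurable.mul hdm
  have L1 : MemLp p 2 := memLp_two_of_bdd_support hpm (M := A * M)
    (fun x => by rw [hp, norm_mul]; exact mul_le_mul (hA x) (hM x) (norm_nonneg _) hA0)
    (hc.mul_right)
  have L2a : MemLp (fun x => fderiv ℝ φ x v * b x) 2 := memLp_two_of_bdd_support hpm1 (M := A' * M)
    (fun x => by rw [norm_mul]; exact mul_le_mul (hA' x) (hM x) (norm_nonneg _) hA0')
    (hdφs.mul_right)
  have L2b : MemLp (fun x => φ x * lineDeriv ℝ b x v) 2 :=
    memLp_two_of_bdd_support hpm2 (M := A * (K * ‖v‖))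
    (fun x => by rw [norm_mul]; exact mul_le_mul (hA x) (hdM x) (norm_nonneg _) hA0)
    (hc.mul_right)
  have L2 : MemLp p' 2 := L2a.add L2b
  have hw : HasWeakDeriv v (fun x => (p x : ℂ)) fun x => (p' x : ℂ) := by
    refine ⟨(L1.ofReal (K := ℂ)).locallyIntegrable (by norm_num),
      (L2.ofReal (K := ℂ)).locallyIntegrable (by norm_num), fun χ hχ hcχ => ?_⟩
    have hχd : Differentiable ℝ χ := hχ.differentiable (by simp)
    obtain ⟨D, hD⟩ := exists_lipschitzWith_of_contDiff (hχ.mul hφ) (hcχ.mul_right (f' := φ))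
    -- Integration by parts for Lipschitz functions, one of them compactly supported, replaces the
    -- smooth product rule.
    have key := LipschitzWith.integral_lineDeriv_mul_eq (μ := volume) hb hD (hcχ.mul_right (f' := φ)) v
    have e1 : ∀ x, lineDeriv ℝ (fun y => χ y * φ y) x (-v)
        = -(fderiv ℝ χ x v * φ x + χ x * fderiv ℝ φ x v) := by
      intro x
      have : DifferentiableAt ℝ (fun y => χ y * φ y) x := (hχd x).mul (hφd x)
      rw [this.lineDeriv_eq_fderiv, fderiv_fun_mul (hχd x) (hφd x)]
      simp
      ring
    obtain ⟨G, hG⟩ := hχ.continuous.bounded_above_of_compact_support hcχ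
    have hdχc : Continuous fun x => fderiv ℝ χ x v :=
      (hχ.continuous_fderiv (by simp)).clm_apply continuous_const
    have hint : ∀ {θ q : Plane → ℝ}, Continuous θ → HasCompactSupport θ → MemLp q 2 →
        Integrable fun x => θ x * q x := by
      intro θ q h1 h2 h3
      exact (h3.locallyIntegrable (by norm_num)).integrable_smul_left_of_hasCompactSupport h1 h2
    have i1 := hint hdχc (hcχ.fderiv_apply ℝ v) L1
    have i2 := hint hχ.continuous hcχ L2a
    have i3 := hint hχ.continuous hcχ L2b
    have real : ∫ x, fderiv ℝ χ x v * p x = - ∫ x, χ x * p' x := by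
      have k1 : ∫ x, lineDeriv ℝ b x v * (χ x * φ x) = ∫ x, χ x * (φ x * lineDeriv ℝ b x v) := by
        congr 1 with x
        ring
      have k2 : ∫ x, lineDeriv ℝ (fun y => χ y * φ y) x (-v) * b x
          = - ((∫ x, fderiv ℝ χ x v * p x) + ∫ x, χ x * (fderiv ℝ φ x v * b x)) := by
        rw [← integral_add i1 i2, ← integral_neg]
        congr 1 with x
        rw [e1]
        simp only [hp]; ring
      have k3 : ∫ x, χ x * p' x
          = (∫ x, χ x * (fderiv ℝ φ x v * b x)) + ∫ x, χ x * (φ x * lineDeriv ℝ b x v) := by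
        rw [← integral_add i2 i3]
        congr 1 with x
        simp only [hp']; ring
      rw [k1, k2] at key
      rw [k3, key]
      ring
    have r1 : ∀ q r : Plane → ℝ, ∫ x, q x • (r x : ℂ) = ((∫ x, q x * r x : ℝ) : ℂ) := by
      intro q r
      rw [← integral_complex_ofReal]
      congr 1 with x
      simp
    rw [r1, r1, real]
    simp
  have fin := hf.inner_eq_neg' L1 L2 hw
  have hI : ∀ {q : Plane → ℝ} (hq : MemLp q 2) (g : L2Plane), Integrable fun x => (q x : ℂ) * g x :=
    fun hq g => MemLp.integrable_mul (p := 2) (q := 2) (hq.ofReal (K := ℂ)) (Lp.memLp g)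
  have f1 : ∫ x, (p' x : ℂ) * f x = (∫ x, (fderiv ℝ φ x v) • ((b x : ℂ) * f x))
      + ∫ x, ((φ x * lineDeriv ℝ b x v : ℝ) : ℂ) * f x := by
    have : ∫ x, (fderiv ℝ φ x v) • ((b x : ℂ) * f x)
        = ∫ x, ((fderiv ℝ φ x v * b x : ℝ) : ℂ) * f x := by
      congr 1 with x
      simp; ring
    rw [this, ← integral_add (hI L2a f) (hI L2b f)]
    congr 1 with x
    simp only [hp']
    push_cast; ring
  have f2 : ∫ x, φ x • ((fun x => (b x : ℂ) * f' x) + fun x => ((lineDeriv ℝ b x v : ℝ) : ℂ) * f x) x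
      = (∫ x, (p x : ℂ) * f' x) + ∫ x, ((φ x * lineDeriv ℝ b x v : ℝ) : ℂ) * f x := by
    rw [← integral_add (hI L1 f') (hI L2b f)]
    congr 1 with x
    simp only [hp, Pi.add_apply]
    simp; ring
  rw [f2]
  linear_combination f1.symm.trans fin

open scoped ENNReal BoundedContinuousFunction

/-! ### The energy of the effective equation -/

/-- At a zero of `f` the difference quotient of `B (f, Y)` is `B` of the quotient of `f` and `Y`, so
`Y` need only be continuous. This is essential because gradients of the orbitals are continuous in
time but need not be differentiable. -/
theorem hasDerivWithinAt_bilin_of_eq_zero {E F : Type*} [NormedAddCommGroup E] [NormedSpace ℝ E]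
    [NormedAddCommGroup F] [NormedSpace ℝ F] (B : E →L[ℝ] F →L[ℝ] ℝ) {f : ℝ → E} {f' : E}
    {Y : ℝ → F} {I : Set ℝ} {t : ℝ} (hf : HasDerivWithinAt f f' I t) (h0 : f t = 0)
    (hY : ContinuousWithinAt Y I t) :
    HasDerivWithinAt (fun τ => B (f τ) (Y τ)) (B f' (Y t)) I t := by
  rw [hasDerivWithinAt_iff_tendsto_slope] at hf ⊢
  have h1 : slope (fun τ => B (f τ) (Y τ)) t = fun τ => B (slope f t τ) (Y τ) := by
    funext τ
    simp [slope_def_module, h0]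
  rw [h1]
  have h2 : Tendsto Y (𝓝[I \ {t}] t) (𝓝 (Y t)) := hY.mono Set.sdiff_subset
  exact (B.continuous₂.tendsto (f', Y t)).comp (hf.prodMk_nhds h2)

variable {N : ℕ}

/-- The density as an integrable function. -/
def rhoL (u : Fin N → L2Plane) : Lp ℝ 1 (volume : Measure Plane) := ∑ j, crossL (u j) (u j)

/-- A component of the vector potential generated by the density. -/
def magL (k : Plane →ᵇ ℝ) (u : Fin N → L2Plane) : Lp ℝ ∞ (volume : Measure Plane) :=
  convL k (rhoL u)

/-- The covariant derivative `-i w + β a f`. -/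
def covL (β : ℝ) (a : Lp ℝ ∞ (volume : Measure Plane)) (f w : L2Plane) : L2Plane :=
  β • mulL a f - Complex.I • w

/-- The scalar potential `∑ₖ aₖ * (∑ⱼ 2 Re (ūⱼ pⱼₖ))`. -/
def backL (a : Fin 2 → Plane →ᵇ ℝ) (u : Fin N → L2Plane) (p : Fin N → Fin 2 → L2Plane) :
    Lp ℝ ∞ (volume : Measure Plane) :=
  ∑ k, convL (a k) (∑ j, (2 : ℝ) • crossL (u j) (p j k))

/-- The energy functional, `w` being the gradients of the orbitals. -/
def energyL (β c : ℝ) (a : Fin 2 → Plane →ᵇ ℝ) (a2 : Plane →ᵇ ℝ) (u : Fin N → L2Plane)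
    (w : Fin N → Fin 2 → L2Plane) : ℝ :=
  (∑ j, ∑ k, ‖covL β (magL (a k) u) (u j) (w j k)‖ ^ 2)
    + c / 2 * pairL (magL a2 u) (rhoL u)

theorem hasDerivWithinAt_rhoL {u : Fin N → ℝ → L2Plane} {u' : Fin N → L2Plane} {I : Set ℝ} {t : ℝ}
    (hu : ∀ j, HasDerivWithinAt (u j) (u' j) I t) :
    HasDerivWithinAt (fun τ => rhoL fun j => u j τ) (∑ j, (2 : ℝ) • crossL (u j t) (u' j)) I t := by
  have := HasDerivWithinAt.fun_sum (u := Finset.univ) fun j _ =>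
    crossL.hasDerivWithinAt_of_bilinear (hu j) (hu j)
  refine this.congr_deriv ?_
  refine Finset.sum_congr rfl fun j _ => ?_
  rw [crossL_comm (u' j), two_smul]

theorem HasWeakDeriv.reL_eq_neg {v : Plane} {f f' g g' : L2Plane} (hf : HasWeakDeriv v f f')
    (hg : HasWeakDeriv v g g') : reL f' g = - reL f g' := by
  rw [reL_apply, reL_apply, hf.inner_eq_neg hg, Complex.neg_re]

theorem HasWeakDeriv.sub_L2 {v : Plane} {f f' g g' : L2Plane} (hf : HasWeakDeriv v f f')
    (hg : HasWeakDeriv v g g') : HasWeakDeriv v (f - g : L2Plane) (f' - g' : L2Plane) :=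
  (hf.sub hg).congr (Lp.coeFn_sub f g).symm (Lp.coeFn_sub f' g').symm

/-- Symmetry of the covariant derivative. -/
theorem inner_covL {v : Plane} {f f' g g' : L2Plane} (β : ℝ) (a : Lp ℝ ∞ (volume : Measure Plane))
    (hf : HasWeakDeriv v f f') (hg : HasWeakDeriv v g g') :
    inner ℂ (covL β a f f') g = inner ℂ f (covL β a g g') := by
  rw [covL, covL, inner_sub_left, inner_sub_right, inner_smul_left, inner_smul_right,
    hf.inner_eq_neg hg, inner_smul_left_eq_smul, inner_smul_right_eq_smul, inner_mulL]
  simp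

theorem reL_covL {v : Plane} {f f' g g' : L2Plane} (β : ℝ) (a : Lp ℝ ∞ (volume : Measure Plane))
    (hf : HasWeakDeriv v f f') (hg : HasWeakDeriv v g g') :
    reL (covL β a f f') g = reL f (covL β a g g') := by
  rw [reL_apply, reL_apply, inner_covL β a hf hg]

/-- The gradient `w` has no time derivative in `L²`, so the chain rule is unavailable. The square is
expanded exactly around time `t` in the increments of `f`, `w` and `A`. The terms linear and
quadratic in the increment of `w` are integrated by parts, so that every remaining term contains a
differentiable factor vanishing at `t`. This uses the second derivative `w'` and its continuity. -/
theorem hasDerivWithinAt_norm_covL_sq {v : Plane} {β : ℝ} {f w w' : ℝ → L2Plane} {f' d : L2Plane}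
    {A : ℝ → Lp ℝ ∞ (volume : Measure Plane)} {A' : Lp ℝ ∞ (volume : Measure Plane)}
    {I : Set ℝ} {t : ℝ} (ht : t ∈ I) (hf : HasDerivWithinAt f f' I t)
    (hA : HasDerivWithinAt A A' I t) (hw : ∀ τ ∈ I, HasWeakDeriv v (f τ) (w τ))
    (hw' : ∀ τ ∈ I, HasWeakDeriv v (w τ) (w' τ)) (hwc : ContinuousWithinAt w I t)
    (hwc' : ContinuousWithinAt w' I t)
    (hd : HasWeakDeriv v (covL β (A t) (f t) (w t)) d) :
    HasDerivWithinAt (fun τ => ‖covL β (A τ) (f τ) (w τ)‖ ^ 2)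
      (2 * reL f' (covL β (A t) (covL β (A t) (f t) (w t)) d)
        + 2 * β * reL (mulL A' (f t)) (covL β (A t) (f t) (w t))) I t := by
  set p := covL β (A t) (f t) (w t) with hp
  set q := covL β (A t) p d with hq
  set η : ℝ → L2Plane := fun τ => f τ - f t with hη
  set ζ : ℝ → L2Plane := fun τ => w τ - w t with hζ
  set b : ℝ → L2Plane := fun τ => β • mulL (A t) (η τ) with hb
  set r : ℝ → L2Plane := fun τ => β • mulL (A τ - A t) (f τ) with hr
  have dη : HasDerivWithinAt η f' I t := hf.sub_const _
  have db : HasDerivWithinAt b (β • mulL (A t) f') I t :=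
    (((mulL (A t)).hasFDerivAt.comp_hasDerivWithinAt t dη).const_smul β)
  have dr : HasDerivWithinAt r (β • mulL A' (f t)) I t := by
    have := (mulL.hasDerivWithinAt_of_bilinear (hA.sub_const (A t)) hf).const_smul β
    refine this.congr_deriv ?_
    simp
  have η0 : η t = 0 := sub_self _
  have ζ0 : ζ t = 0 := sub_self _
  have b0 : b t = 0 := by simp [hb, η0]
  have r0 : r t = 0 := by simp [hr]
  have cζ : ContinuousWithinAt ζ I t := hwc.sub continuousWithinAt_const
  have cD : ContinuousWithinAt (fun τ => b τ - Complex.I • ζ τ) I t :=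
    db.continuousWithinAt.sub (cζ.const_smul Complex.I)
  have expand : ∀ τ ∈ I, ‖covL β (A τ) (f τ) (w τ)‖ ^ 2 = ‖p‖ ^ 2 + 2 * reL (η τ) q
      - reL (η τ) (w' τ - w' t) - 2 * reL (b τ) (Complex.I • ζ τ) + reL (b τ) (b τ)
      + reL (r τ) ((2 : ℝ) • p + (2 : ℝ) • (b τ - Complex.I • ζ τ) + r τ) := by
    intro τ hτ
    have e1 : covL β (A τ) (f τ) (w τ) = p + (b τ - Complex.I • ζ τ) + r τ := by
      simp only [hp, covL, hb, hr, hη, hζ, map_sub, sub_apply, smul_sub]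
      abel
    have hη' := (hw τ hτ).sub_L2 (hw t ht)
    have hζ' := (hw' τ hτ).sub_L2 (hw' t ht)
    -- The linear term: symmetry of the covariant derivative moves it from the increment onto `p`.
    have e2 : reL (b τ - Complex.I • ζ τ) p = reL (η τ) q := reL_covL β (A t) hη' hd
    -- The quadratic term `‖ζ‖²` becomes a pairing of the differentiable increment `η` with an
    -- increment of `w'`, which tends to zero.
    have e3 : reL (Complex.I • ζ τ) (Complex.I • ζ τ) = - reL (η τ) (w' τ - w' t) := by
      rw [reL_I_smul, smul_smul, Complex.I_mul_I, neg_one_smul, map_neg, neg_neg]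
      exact hη'.reL_eq_neg hζ'
    rw [← reL_self, e1, ← reL_self, ← e2]
    have e4 : reL (p) (r τ) = reL (r τ) p := reL_comm _ _
    have e5 : reL p (b τ) = reL (b τ) p := reL_comm _ _
    have e6 : reL p (Complex.I • ζ τ) = reL (Complex.I • ζ τ) p := reL_comm _ _
    have e7 : reL (b τ) (r τ) = reL (r τ) (b τ) := reL_comm _ _
    have e8 : reL (Complex.I • ζ τ) (r τ) = reL (r τ) (Complex.I • ζ τ) := reL_comm _ _
    have e9 : reL (Complex.I • ζ τ) (b τ) = reL (b τ) (Complex.I • ζ τ) := reL_comm _ _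
    have e3' : reL (η τ) (w' τ - w' t) = - reL (Complex.I • ζ τ) (Complex.I • ζ τ) := by
      rw [e3, neg_neg]
    rw [e3']
    simp only [map_add, map_sub, map_smul, add_apply,
      sub_apply, smul_eq_mul, e4, e5, e6, e7, e8, e9]
    ring
  have D1 := hasDerivWithinAt_bilin_of_eq_zero reL dη η0 (continuousWithinAt_const (b := q))
  have D2 := hasDerivWithinAt_bilin_of_eq_zero reL dη η0 (hwc'.sub (continuousWithinAt_const (b := w' t)))
  have D3 := hasDerivWithinAt_bilin_of_eq_zero reL db b0 (cζ.const_smul Complex.I)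
  have D4 := hasDerivWithinAt_bilin_of_eq_zero reL db b0 db.continuousWithinAt
  have D5 := hasDerivWithinAt_bilin_of_eq_zero reL dr r0
    (((continuousWithinAt_const (b := (2 : ℝ) • p)).add (cD.const_smul (2 : ℝ))).add dr.continuousWithinAt)
  have D := (((((D1.const_mul 2).const_add (‖p‖ ^ 2)).sub D2).sub (D3.const_mul 2)).add D4).add D5
  refine (D.congr_deriv ?_).congr (fun τ hτ => expand τ hτ) (expand t ht)
  simp [ζ0, b0, r0]
  ring

theorem pairL_rho_deriv (b : Lp ℝ ∞ (volume : Measure Plane)) (u u' : Fin N → L2Plane) :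
    pairL b (∑ j, (2 : ℝ) • crossL (u j) (u' j)) = 2 * ∑ j, reL (u' j) (mulL b (u j)) := by
  rw [map_sum, Finset.mul_sum]
  refine Finset.sum_congr rfl fun j _ => ?_
  rw [map_smul, smul_eq_mul, pairL_crossL_eq_reL, ← reL_mulL, reL_comm]

/-- Varying the vector potential in the kinetic term yields the back-reaction potential of the
effective equation. Its minus sign comes from moving an odd kernel to the other factor. -/
theorem sum_reL_mulL_convL {a : Fin 2 → Plane →ᵇ ℝ} (ha : ∀ k x, a k (-x) = (-1) * a k x) (β : ℝ)
    (u : Fin N → L2Plane) (p : Fin N → Fin 2 → L2Plane) (F : Lp ℝ 1 (volume : Measure Plane)) :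
    ∑ j, ∑ k, 2 * β * reL (mulL (convL (a k) F) (u j)) (p j k) = - β * pairL (backL a u p) F := by
  rw [Finset.sum_comm, backL, map_sum, _root_.sum_apply, Finset.mul_sum]
  refine Finset.sum_congr rfl fun k _ => ?_
  have h1 := pairL_convL (ha k) (∑ j, (2 : ℝ) • crossL (u j) (p j k)) F
  rw [h1, map_sum, Finset.mul_sum, Finset.mul_sum]
  refine Finset.sum_congr rfl fun j _ => ?_
  rw [map_smul, smul_eq_mul, pairL_crossL_eq_reL, reL_mulL]
  ring

/-- The effective Hamiltonian applied to `u` appears as half the gradient of the energy. In the pair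
term both densities contribute equally because the kernel is even, which cancels the `1/2` in `c/2`.
-/
theorem hasDerivWithinAt_energyL {β c : ℝ} {a : Fin 2 → Plane →ᵇ ℝ} {a2 : Plane →ᵇ ℝ}
    (ha : ∀ k x, a k (-x) = (-1) * a k x) (ha2 : ∀ x, a2 (-x) = 1 * a2 x)
    {u : Fin N → ℝ → L2Plane} {u' : Fin N → L2Plane} {w w' : Fin N → Fin 2 → ℝ → L2Plane}
    {d : Fin N → Fin 2 → L2Plane} {I : Set ℝ} {t : ℝ} (ht : t ∈ I)
    (hu : ∀ j, HasDerivWithinAt (u j) (u' j) I t)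
    (hw : ∀ j k, ∀ τ ∈ I, HasWeakDeriv (e k) (u j τ) (w j k τ))
    (hw' : ∀ j k, ∀ τ ∈ I, HasWeakDeriv (e k) (w j k τ) (w' j k τ))
    (hwc : ∀ j k, ContinuousWithinAt (w j k) I t) (hwc' : ∀ j k, ContinuousWithinAt (w' j k) I t)
    {p : Fin N → Fin 2 → L2Plane}
    (hp : ∀ j k, p j k = covL β (magL (a k) fun l => u l t) (u j t) (w j k t))
    (hd : ∀ j k, HasWeakDeriv (e k) (p j k) (d j k)) :
    HasDerivWithinAt (fun τ => energyL β c a a2 (fun j => u j τ) fun j k => w j k τ)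
      (2 * ∑ j, reL (u' j) ((∑ k, covL β (magL (a k) fun l => u l t) (p j k) (d j k))
        + c • mulL (magL a2 fun l => u l t) (u j t)
        - β • mulL (backL a (fun l => u l t) p) (u j t))) I t := by
  have dρ := hasDerivWithinAt_rhoL hu
  set ρ' := ∑ j, (2 : ℝ) • crossL (u j t) (u' j) with hρ'
  have dA : ∀ k : Plane →ᵇ ℝ, HasDerivWithinAt (fun τ => magL k fun l => u l τ) (convL k ρ') I t :=
    fun k => (convL k).hasFDerivAt.comp_hasDerivWithinAt t dρ
  have D1 := HasDerivWithinAt.fun_sum (u := (Finset.univ : Finset (Fin N))) fun j _ =>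
    HasDerivWithinAt.fun_sum (u := (Finset.univ : Finset (Fin 2))) fun k _ =>
      hasDerivWithinAt_norm_covL_sq (β := β) ht (hu j) (dA (a k)) (hw j k) (hw' j k) (hwc j k)
        (hwc' j k) ((hp j k) ▸ hd j k)
  have D2 := (pairL.hasDerivWithinAt_of_bilinear (dA a2) dρ).const_mul (c / 2)
  refine (D1.add D2).congr_deriv ?_
  have hpair := fun b => pairL_rho_deriv b (fun j => u j t) u'
  rw [← hρ'] at hpair
  have g1 : pairL (convL a2 ρ') (rhoL fun l => u l t) = pairL (magL a2 fun l => u l t) ρ' := by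
    rw [pairL_convL ha2, one_mul, magL]
  have g2 := sum_reL_mulL_convL ha β (fun l => u l t) p ρ'
  clear_value ρ'
  simp only [← hp]
  simp only [Finset.sum_add_distrib] at g2 ⊢
  rw [g2, g1, hpair, hpair]
  simp only [map_add, map_sub, map_sum, map_smul, smul_eq_mul, Finset.sum_add_distrib,
    Finset.sum_sub_distrib, ← Finset.mul_sum]
  ring

/-! ### The kernel as a bounded Lipschitz function -/

theorem perp_sub (x y : Plane) : perp x - perp y = perp (x - y) := by
  ext k
  fin_cases k <;> simp [perp]
  ring

theorem aN_neg (N : ℕ) (s R : ℝ) (x : Plane) : aN N s R (-x) = - aN N s R x := by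
  have : perp (-x) = - perp x := by
    ext k
    fin_cases k <;> simp [perp]
  simp [aN, aR, this]

/-- With `t = m/m'`, this is the tangent-line bound `t^{-p} ≥ 1 - p(t - 1)`, obtained from `exp x ≥
1 + x` and `log t ≤ t - 1`. -/
theorem rpow_neg_sub_mul_le {p m m' : ℝ} (hp : 0 ≤ p) (hm' : 0 < m') (h : m' ≤ m) :
    (m' ^ (-p) - m ^ (-p)) * m' ≤ p * m' ^ (-p) * (m - m') := by
  have ht : 0 < m / m' := div_pos (hm'.trans_le h) hm'
  have h1 : m ^ (-p) = m' ^ (-p) * (m / m') ^ (-p) := by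
    rw [← Real.mul_rpow hm'.le ht.le, mul_div_cancel₀ _ hm'.ne']
  have h2 : 1 - p * (m / m' - 1) ≤ (m / m') ^ (-p) := by
    rw [Real.rpow_def_of_pos ht]
    have := Real.add_one_le_exp (Real.log (m / m') * -p)
    have := Real.log_le_sub_one_of_pos ht
    nlinarith
  have h3 : 0 < m' ^ (-p) := Real.rpow_pos_of_pos hm' _
  have h4 : (m / m' - 1) * m' = m - m' := by field_simp
  calc (m' ^ (-p) - m ^ (-p)) * m' = m' ^ (-p) * m' * (1 - (m / m') ^ (-p)) := by rw [h1]; ring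
    _ ≤ m' ^ (-p) * m' * (p * (m / m' - 1)) := by gcongr; linarith
    _ = p * m' ^ (-p) * ((m / m' - 1) * m') := by ring
    _ = _ := by rw [h4]

theorem norm_aR_sub_le {s R : ℝ} (hs : 0 ≤ s) (hR : 0 < R) (x y : Plane) :
    ‖aR s R x - aR s R y‖ ≤ (2 + s) * R ^ (-(1 + s)) * ‖x - y‖ := by
  wlog h : ‖y‖ ≤ ‖x‖ generalizing x y
  · rw [norm_sub_rev, norm_sub_rev x]
    exact this y x (le_of_not_ge h)
  set m := max ‖x‖ R with hm
  set m' := max ‖y‖ R with hm'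
  have hm'0 : 0 < m' := hR.trans_le (le_max_right _ _)
  have hmm : m' ≤ m := max_le_max_right _ h
  have hm0 : 0 < m := hm'0.trans_le hmm
  have hRm : R ≤ m' := le_max_right _ _
  have hdiff : m - m' ≤ ‖x - y‖ := by
    have h1 : |m - m'| ≤ |‖x‖ - ‖y‖| := by
      simpa using abs_max_sub_max_le_max ‖x‖ R ‖y‖ R
    exact (le_abs_self _).trans (h1.trans (abs_norm_sub_norm_le x y))
  -- The increment of the radial factor is placed next to `perp y`, the shorter vector, whose length
  -- is at most `m'`.
  have e1 : aR s R x - aR s R y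
      = m ^ (-(1 + s)) • perp (x - y) - (m' ^ (-(1 + s)) - m ^ (-(1 + s))) • perp y := by
    rw [aR, aR, ← hm, ← hm', ← perp_sub, Real.rpow_neg hm0.le, Real.rpow_neg hm'0.le]
    module
  have h0 : m ^ (-(1 + s)) ≤ m' ^ (-(1 + s)) :=
    Real.rpow_le_rpow_of_nonpos hm'0 hmm (by linarith)
  have h1 : m' ^ (-(1 + s)) ≤ R ^ (-(1 + s)) :=
    Real.rpow_le_rpow_of_nonpos hR hRm (by linarith)
  have h2 : 0 < m ^ (-(1 + s)) := Real.rpow_pos_of_pos hm0 _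
  have h3 := rpow_neg_sub_mul_le (p := 1 + s) (by linarith) hm'0 hmm
  have h4 : ‖y‖ ≤ m' := le_max_left _ _
  rw [e1]
  refine (norm_sub_le _ _).trans ?_
  rw [norm_smul, norm_smul, norm_perp, norm_perp, Real.norm_of_nonneg h2.le,
    Real.norm_of_nonneg (sub_nonneg.2 h0)]
  calc m ^ (-(1 + s)) * ‖x - y‖ + (m' ^ (-(1 + s)) - m ^ (-(1 + s))) * ‖y‖
      ≤ R ^ (-(1 + s)) * ‖x - y‖ + (m' ^ (-(1 + s)) - m ^ (-(1 + s))) * m' := by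
        exact add_le_add (mul_le_mul_of_nonneg_right (h0.trans h1) (norm_nonneg _))
          (mul_le_mul_of_nonneg_left h4 (sub_nonneg.2 h0))
    _ ≤ R ^ (-(1 + s)) * ‖x - y‖ + (1 + s) * R ^ (-(1 + s)) * ‖x - y‖ := by
        refine add_le_add le_rfl (h3.trans ?_)
        gcongr
    _ = _ := by ring

/-- A component of the vector potential of a point flux as a bounded continuous function. -/
def kerB (N : ℕ) {s R : ℝ} (hs : 0 ≤ s) (hR : 0 < R) (M : ℝ) (hM : ∀ x, ‖aN N s R x‖ ≤ M)
    (k : Fin 2) : Plane →ᵇ ℝ :=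
  BoundedContinuousFunction.ofNormedAddCommGroup (fun x => aN N s R x k)
    ((PiLp.continuous_apply 2 _ k).comp (continuous_aN N hs hR)) M
    fun x => (PiLp.norm_apply_le _ k).trans (hM x)

/-- The squared length of the vector potential of a point flux. -/
def kerB2 (N : ℕ) {s R : ℝ} (hs : 0 ≤ s) (hR : 0 < R) (M : ℝ) (hM : ∀ x, ‖aN N s R x‖ ≤ M) :
    Plane →ᵇ ℝ :=
  BoundedContinuousFunction.ofNormedAddCommGroup (fun x => ‖aN N s R x‖ ^ 2)
    ((continuous_aN N hs hR).norm.pow 2) (M ^ 2) fun x => by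
      rw [Real.norm_of_nonneg (by positivity)]
      gcongr
      exact hM x

theorem lipschitz_aN (N : ℕ) {s R : ℝ} (hs : 0 ≤ s) (hR : 0 < R) :
    ∃ K : NNReal, ∀ k, LipschitzWith K fun x => aN N s R x k := by
  have hN : 0 ≤ (N : ℝ) ^ (s / 2 - 1) := by positivity
  refine ⟨⟨(N : ℝ) ^ (s / 2 - 1) * ((2 + s) * R ^ (-(1 + s))), by positivity⟩, fun k => ?_⟩
  refine LipschitzWith.of_dist_le_mul fun x y => ?_
  rw [dist_eq_norm, dist_eq_norm]
  have : aN N s R x k - aN N s R y k = (aN N s R x - aN N s R y) k := rfl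
  rw [this]
  refine (PiLp.norm_apply_le _ k).trans ?_
  rw [aN, aN, ← smul_sub, norm_smul, Real.norm_of_nonneg hN]
  change _ ≤ (N : ℝ) ^ (s / 2 - 1) * ((2 + s) * R ^ (-(1 + s))) * ‖x - y‖
  rw [mul_assoc]
  exact mul_le_mul_of_nonneg_left (norm_aR_sub_le hs hR x y) hN

theorem lipschitz_conv {k : Plane →ᵇ ℝ} {K : NNReal} (hk : LipschitzWith K k) {F : Plane → ℝ}
    (hF : Integrable F) :
    LipschitzWith (K * ⟨∫ y, ‖F y‖, by positivity⟩) fun x => ∫ y, F y * k (x - y) := by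
  refine LipschitzWith.of_dist_le_mul fun x x' => ?_
  rw [dist_eq_norm, ← integral_sub (integrable_conv k hF x) (integrable_conv k hF x')]
  change _ ≤ K * (∫ y, ‖F y‖) * dist x x'
  have : (K : ℝ) * (∫ y, ‖F y‖) * dist x x' = ∫ y, ‖F y‖ * (K * dist x x') := by
    rw [integral_mul_const]; ring
  rw [this]
  refine norm_integral_le_of_norm_le (hF.norm.mul_const _) (Eventually.of_forall fun y => ?_)
  rw [← mul_sub, norm_mul]
  gcongr
  have := hk.dist_le_mul (x - y) (x' - y)
  rwa [dist_sub_right, dist_eq_norm] at this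

/-! ### Identification of the mean fields -/

section Identify

variable {N : ℕ}

theorem rhoL_ae (u : Fin N → L2Plane) : ∀ᵐ x, rhoL u x = density (fun j => u j) x := by
  have h : ∀ᵐ x, ∀ j, crossL (u j) (u j) x = (starRingEnd ℂ (u j x) * u j x).re :=
    ae_all_iff.2 fun j => crossL_ae _ _
  filter_upwards [h, Lp.coeFn_fun_finsetSum Finset.univ fun j => crossL (u j) (u j)] with x hx hs
  rw [rhoL, hs, density]
  refine Finset.sum_congr rfl fun j _ => ?_
  rw [hx j, mul_comm, Complex.mul_conj, Complex.normSq_eq_norm_sq]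
  exact Complex.ofReal_re _

theorem integrable_density (u : Fin N → L2Plane) : Integrable (density fun j => u j) :=
  (L1.integrable_coeFn (rhoL u)).congr (rhoL_ae u)

theorem integrable_smul_aN {s R : ℝ} (hs : 0 ≤ s) (hR : 0 < R) {M : ℝ}
    (hM : ∀ x, ‖aN N s R x‖ ≤ M) {F : Plane → ℝ} (hF : Integrable F) (x : Plane) :
    Integrable fun y => F y • aN N s R (x - y) := by
  refine hF.smul_bdd M ?_ (Eventually.of_forall fun y => hM _)
  exact ((continuous_aN N hs hR).comp (continuous_const.sub continuous_id)).aestronglyMeasurable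

variable {s R : ℝ} (hs : 0 ≤ s) (hR : 0 < R) {M : ℝ} (hM : ∀ x, ‖aN N s R x‖ ≤ M)

theorem potA_apply (u : Fin N → L2Plane) (x : Plane) (k : Fin 2) :
    potA s R (fun j => u j) x k = ∫ y, rhoL u y * kerB N hs hR M hM k (x - y) := by
  have h := (EuclideanSpace.proj (𝕜 := ℝ) k).integral_comp_comm
    (integrable_smul_aN hs hR hM (integrable_density u) x)
  change ((∫ y, density (fun j => u j) y • aN N s R (x - y)) : Plane) k = _
  refine Eq.trans h.symm (integral_congr_ae ?_)
  filter_upwards [rhoL_ae u] with y hy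
  rw [hy]
  rfl

theorem magL_kerB_ae (u : Fin N → L2Plane) (k : Fin 2) :
    ∀ᵐ x, magL (kerB N hs hR M hM k) u x = potA s R (fun j => u j) x k := by
  filter_upwards [convL_ae (kerB N hs hR M hM k) (rhoL u)] with x hx
  rw [magL, hx, potA_apply hs hR hM]

theorem magL_kerB2_ae (u : Fin N → L2Plane) :
    ∀ᵐ x, magL (kerB2 N hs hR M hM) u x = potA2 s R (fun j => u j) x := by
  filter_upwards [convL_ae (kerB2 N hs hR M hM) (rhoL u)] with x hx
  rw [magL, hx, potA2]
  refine integral_congr_ae ?_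
  filter_upwards [rhoL_ae u] with y hy
  rw [hy]
  rfl

theorem covL_ae {β : ℝ} (u : Fin N → L2Plane) {f w : L2Plane} (k : Fin 2) :
    ∀ᵐ x, covL β (magL (kerB N hs hR M hM k) u) f w x
      = -Complex.I * w x + ((β * potA s R (fun j => u j) x k : ℝ) : ℂ) * f x := by
  set A := magL (kerB N hs hR M hM k) u with hA
  filter_upwards [magL_kerB_ae hs hR hM u k, mulL_ae A f, Lp.coeFn_sub (β • mulL A f) (Complex.I • w),
    Lp.coeFn_smul β (mulL A f), Lp.coeFn_smul Complex.I w] with x h1 h2 h3 h4 h5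
  rw [covL, h3, Pi.sub_apply, h4, h5, Pi.smul_apply, Pi.smul_apply, h2, h1]
  simp
  ring

theorem covDeriv_ae {β : ℝ} (u : Fin N → L2Plane) {f w : L2Plane} {h : Plane → ℂ} {k : Fin 2}
    (hfh : f =ᵐ[volume] h)
    (hw : HasWeakDeriv (e k) f w) :
    covDeriv (e k) (fun y => β * potA s R (fun j => u j) y k) h
      =ᵐ[volume] covL β (magL (kerB N hs hR M hM k) u) f w := by
  filter_upwards [covL_ae hs hR hM (β := β) (f := f) (w := w) u k, hfh,
    (hw.congr hfh EventuallyEq.rfl).weakDeriv_ae_eq] with x h1 h2 h3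
  rw [h1, covDeriv, h3, h2]

/-- The regularized kernel is bounded and Lipschitz and `ρ` is integrable, so `a_N[ρ]` is bounded
and Lipschitz. Hence the covariant derivative of an orbital can be differentiated again, with no
regularity of `ρ` required. -/
theorem exists_hasWeakDeriv_covL (β : ℝ) (u : Fin N → L2Plane) {f w w' : L2Plane} (k : Fin 2)
    (hw : HasWeakDeriv (e k) f w) (hw' : HasWeakDeriv (e k) w w') :
    ∃ d : L2Plane, HasWeakDeriv (e k) (covL β (magL (kerB N hs hR M hM k) u) f w) d := by
  obtain ⟨K, hK⟩ := lipschitz_aN N hs hR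
  have hF := L1.integrable_coeFn (rhoL u)
  obtain ⟨d, hd⟩ := hw.exists_mul_lipschitz
    (lipschitz_conv (k := kerB N hs hR M hM k) (hK k) hF)
    (norm_conv_le (kerB N hs hR M hM k) hF)
  have h1 := (hw'.const_mul (-Complex.I)).add (hd.const_mul (β : ℂ))
  refine ⟨(-Complex.I) • w' + (β : ℂ) • d, h1.congr ?_ ?_⟩
  · filter_upwards [covL_ae hs hR hM (β := β) (f := f) (w := w) u k] with x hx
    rw [hx, potA_apply hs hR hM]
    push_cast
    ring
  · filter_upwards [Lp.coeFn_add ((-Complex.I) • w') ((β : ℂ) • d), Lp.coeFn_smul (-Complex.I) w',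
      Lp.coeFn_smul (β : ℂ) d] with x h1 h2 h3
    rw [h1, Pi.add_apply, h2, h3]
    rfl

/-- With `p = -i∂u + β a u` one has `2 Re(ū p) = 2β a |u|² + i(u ∂ū - ū ∂u)`. Summing over the
orbitals gives the components of `2β a_N[ρ] ρ + J`. -/
theorem backL_ae {β : ℝ} (u : Fin N → L2Plane) {w p : Fin N → Fin 2 → L2Plane}
    (hw : ∀ j k, HasWeakDeriv (e k) (u j) (w j k))
    (hp : ∀ j k, p j k = covL β (magL (kerB N hs hR M hM k) u) (u j) (w j k)) :
    ∀ᵐ x, backL (kerB N hs hR M hM) u p x = potJ β s R (fun j => u j) x := by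
  set F : Fin 2 → Lp ℝ 1 (volume : Measure Plane) :=
    fun k => ∑ j, (2 : ℝ) • crossL (u j) (p j k) with hF
  have hFae : ∀ᵐ y, ∀ k, F k y = (2 * β * density (fun j => u j) y) * potA s R (fun j => u j) y k
      + current (fun j => u j) y k := by
    refine ae_all_iff.2 fun k => ?_
    have h1 : ∀ᵐ y, ∀ j, crossL (u j) (p j k) y = (starRingEnd ℂ (u j y) * p j k y).re :=
      ae_all_iff.2 fun j => crossL_ae _ _
    have h2 : ∀ᵐ y, ∀ j, p j k y
        = -Complex.I * w j k y + ((β * potA s R (fun j => u j) y k : ℝ) : ℂ) * u j y :=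
      ae_all_iff.2 fun j => hp j k ▸ covL_ae hs hR hM u k
    have h3 : ∀ᵐ y, ∀ j, ((2 : ℝ) • crossL (u j) (p j k) : Lp ℝ 1 (volume : Measure Plane)) y
        = 2 * crossL (u j) (p j k) y :=
      ae_all_iff.2 fun j => Lp.coeFn_smul (2 : ℝ) (crossL (u j) (p j k))
    have h4 : ∀ᵐ y, ∀ j, weakDeriv (e k) (u j) y = w j k y :=
      ae_all_iff.2 fun j => (hw j k).weakDeriv_ae_eq
    filter_upwards [h1, h2, h3, h4, Lp.coeFn_fun_finsetSum Finset.univ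
      fun j => (2 : ℝ) • crossL (u j) (p j k)] with y h1 h2 h3 h4 h5
    have h6 : (current (fun j => u j) y) k = ∑ j, (Complex.I *
        (u j y * starRingEnd ℂ (weakDeriv (e k) (u j) y)
        - starRingEnd ℂ (u j y) * weakDeriv (e k) (u j) y)).re := rfl
    rw [hF, h5, h6, density, Finset.mul_sum, Finset.sum_mul, ← Finset.sum_add_distrib]
    refine Finset.sum_congr rfl fun j _ => ?_
    rw [h3, h1, h2, h4, ← Complex.normSq_eq_norm_sq, Complex.normSq_apply]
    simp
    ring
  have hconv : ∀ᵐ x, ∀ k, convL (kerB N hs hR M hM k) (F k) x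
      = ∫ y, F k y * kerB N hs hR M hM k (x - y) := ae_all_iff.2 fun k => convL_ae _ _
  filter_upwards [hconv, Lp.coeFn_fun_finsetSum Finset.univ
    fun k => convL (kerB N hs hR M hM k) (F k)] with x h1 h2
  rw [backL, h2, potJ]
  simp only [h1]
  rw [← integral_finsetSum _ fun k _ => integrable_conv _ (L1.integrable_coeFn (F k)) x]
  refine integral_congr_ae ?_
  filter_upwards [hFae] with y hy
  simp only [hy]
  rw [PiLp.inner_apply]
  refine Finset.sum_congr rfl fun k _ => ?_
  simp [kerB]

theorem effectiveRHS_ae {β g : ℝ} (u : Fin N → L2Plane) {w p d : Fin N → Fin 2 → L2Plane}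
    (hw : ∀ j k, HasWeakDeriv (e k) (u j) (w j k))
    (hp : ∀ j k, p j k = covL β (magL (kerB N hs hR M hM k) u) (u j) (w j k))
    (hd : ∀ j k, HasWeakDeriv (e k) (p j k) (d j k)) (j : Fin N) :
    ∀ᵐ x, effectiveRHS β g s R (fun l => u l) j x
      = ((∑ k, covL β (magL (kerB N hs hR M hM k) u) (p j k) (d j k))
        + (g * N) • mulL (magL (kerB2 N hs hR M hM) u) (u j)
        - β • mulL (backL (kerB N hs hR M hM) u p) (u j) : L2Plane) x := by
  set S := ∑ k, covL β (magL (kerB N hs hR M hM k) u) (p j k) (d j k)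
  set X := mulL (magL (kerB2 N hs hR M hM) u) (u j)
  set Y := mulL (backL (kerB N hs hR M hM) u p) (u j)
  have h1 : ∀ᵐ x, ∀ k, covDeriv (e k) (fun y => β * potA s R (fun j => u j) y k)
      (covDeriv (e k) (fun y => β * potA s R (fun j => u j) y k) (u j)) x
      = covL β (magL (kerB N hs hR M hM k) u) (p j k) (d j k) x := by
    refine ae_all_iff.2 fun k => covDeriv_ae hs hR hM u ?_ (hd j k)
    rw [hp]
    exact (covDeriv_ae hs hR hM u EventuallyEq.rfl (hw j k)).symm
  filter_upwards [h1, magL_kerB2_ae hs hR hM u, backL_ae hs hR hM u hw hp,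
    mulL_ae (magL (kerB2 N hs hR M hM) u) (u j), mulL_ae (backL (kerB N hs hR M hM) u p) (u j),
    Lp.coeFn_sub (S + (g * N) • X) (β • Y), Lp.coeFn_add S ((g * N) • X), Lp.coeFn_smul (g * N) X,
    Lp.coeFn_smul β Y, Lp.coeFn_fun_finsetSum Finset.univ fun k =>
      covL β (magL (kerB N hs hR M hM k) u) (p j k) (d j k)]
    with x h1 h2 h3 h4 h5 h6 h7 h8 h9 h10
  rw [h6, Pi.sub_apply, h7, Pi.add_apply, h8, h9, Pi.smul_apply, Pi.smul_apply, h10, h4, h5, h2, h3,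
    effectiveRHS]
  simp only [h1]
  simp
  ring

end Identify

/-! ### Gradients of curves in Sobolev spaces -/

theorem MemH.memLp {m : ℕ} {f : Plane → ℂ} (h : MemH m f) : MemLp f 2 := by
  cases m with
  | zero => exact h
  | succ m => exact h.1

theorem eLpNorm_le_normH (m : ℕ) (f : Plane → ℂ) : eLpNorm f 2 ≤ normH m f := by
  cases m with
  | zero => exact le_rfl
  | succ m => exact le_self_add

theorem normH_weakDeriv_le (m : ℕ) (f : Plane → ℂ) (k : Fin 2) :
    normH m (weakDeriv (e k) f) ≤ normH (m + 1) f :=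
  (Finset.single_le_sum (f := fun k => normH m (weakDeriv (e k) f)) (fun _ _ => zero_le)
    (Finset.mem_univ k)).trans le_add_self

theorem continuousWithinAt_of_eLpNorm_le {I : Set ℝ} {t : ℝ} {w : ℝ → L2Plane} {F : ℝ → ENNReal}
    (hF : Tendsto F (𝓝[I] t) (𝓝 0))
    (h : ∀ τ ∈ I, eLpNorm (fun x => w τ x - w t x) 2 ≤ F τ) : ContinuousWithinAt w I t := by
  refine (Lp.tendsto_Lp_iff_tendsto_eLpNorm' _ _).2 ?_
  refine tendsto_of_tendsto_of_tendsto_of_le_of_le' tendsto_const_nhds hF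
    (Eventually.of_forall fun _ => zero_le) ?_
  filter_upwards [self_mem_nhdsWithin] with τ hτ
  exact h τ hτ

/-- Only the unmixed second derivatives are needed, since each covariant component is applied twice
in the same direction. Continuity follows because the derivative of a difference is the difference
of the chosen derivatives. -/
theorem ContinuousInH.exists_gradients {m : ℕ} (hm : 2 ≤ m) {I : Set ℝ} {u : ℝ → L2Plane}
    (hu : ContinuousInH m I u) (k : Fin 2) :
    ∃ w w' : ℝ → L2Plane, (∀ τ ∈ I, HasWeakDeriv (e k) (u τ) (w τ)) ∧
      (∀ τ ∈ I, HasWeakDeriv (e k) (w τ) (w' τ)) ∧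
      (∀ t ∈ I, ContinuousWithinAt w I t) ∧ ∀ t ∈ I, ContinuousWithinAt w' I t := by
  obtain ⟨n, rfl⟩ : ∃ n, m = n + 2 := ⟨m - 2, by omega⟩
  have ex : ∀ τ, ∃ w w' : L2Plane, τ ∈ I →
      HasWeakDeriv (e k) (u τ) w ∧ HasWeakDeriv (e k) w w' := by
    intro τ
    by_cases hτ : τ ∈ I
    · obtain ⟨-, h1⟩ := hu.1 τ hτ
      obtain ⟨d1, m1, h2⟩ := h1 k
      obtain ⟨d2, m2⟩ := h2 k
      refine ⟨m1.toLp, m2.memLp.toLp, fun _ => ⟨?_, ?_⟩⟩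
      · exact (hasWeakDeriv_weakDeriv d1).congr EventuallyEq.rfl (MemLp.coeFn_toLp _).symm
      · exact (hasWeakDeriv_weakDeriv d2).congr (MemLp.coeFn_toLp _).symm (MemLp.coeFn_toLp _).symm
    · exact ⟨0, 0, fun h => absurd h hτ⟩
  choose w w' hw using ex
  have d1 : ∀ τ ∈ I, ∀ t ∈ I,
      weakDeriv (e k) (fun x => u τ x - u t x) =ᵐ[volume] fun x => w τ x - w t x :=
    fun τ hτ t ht => ((hw τ hτ).1.sub (hw t ht).1).weakDeriv_ae_eq
  have d2 : ∀ τ ∈ I, ∀ t ∈ I, weakDeriv (e k) (weakDeriv (e k) fun x => u τ x - u t x)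
      =ᵐ[volume] fun x => w' τ x - w' t x := fun τ hτ t ht =>
    (((hw τ hτ).2.sub (hw t ht).2).congr (d1 τ hτ t ht).symm EventuallyEq.rfl).weakDeriv_ae_eq
  refine ⟨w, w', fun τ hτ => (hw τ hτ).1, fun τ hτ => (hw τ hτ).2, fun t ht => ?_, fun t ht => ?_⟩
  · refine continuousWithinAt_of_eLpNorm_le (hu.2 t ht) fun τ hτ => ?_
    rw [← eLpNorm_congr_ae (d1 τ hτ t ht)]
    exact (eLpNorm_le_normH (n + 1) _).trans (normH_weakDeriv_le _ _ k)
  · refine continuousWithinAt_of_eLpNorm_le (hu.2 t ht) fun τ hτ => ?_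
    rw [← eLpNorm_congr_ae (d2 τ hτ t ht)]
    exact (eLpNorm_le_normH n _).trans
      ((normH_weakDeriv_le _ _ k).trans (normH_weakDeriv_le _ _ k))

/-! ### Conservation laws -/

theorem eq_of_hasDerivWithinAt_zero {E : Type*} [NormedAddCommGroup E] [NormedSpace ℝ E] {T : ℝ}
    (hT : 0 < T) {f : ℝ → E} (h : ∀ t ∈ Set.Icc 0 T, HasDerivWithinAt f 0 (Set.Icc 0 T) t) :
    ∀ t ∈ Set.Icc 0 T, f t = f 0 :=
  constant_of_derivWithin_zero (fun t ht => (h t ht).differentiableWithinAt) fun t ht =>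
    (h t (Set.Ico_subset_Icc_self ht)).derivWithin
      (uniqueDiffOn_Icc hT t (Set.Ico_subset_Icc_self ht))

section Conservation

variable {N : ℕ} {β g s R T : ℝ} (hs : 0 ≤ s) (hR : 0 < R) {M : ℝ} (hM : ∀ x, ‖aN N s R x‖ ≤ M)
  {m : ℕ} {u : Fin N → ℝ → L2Plane} {w w' : Fin N → Fin 2 → ℝ → L2Plane}

/-- The effective equation in `L²`, with the covariant derivatives as elements of `L²`. -/
theorem IsSolution.exists_deriv (h : IsSolution β g s R m T u)
    (hw : ∀ j k, ∀ τ ∈ Set.Icc 0 T, HasWeakDeriv (e k) (u j τ) (w j k τ))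
    (hw' : ∀ j k, ∀ τ ∈ Set.Icc 0 T, HasWeakDeriv (e k) (w j k τ) (w' j k τ))
    {t : ℝ} (ht : t ∈ Set.Icc 0 T) :
    ∃ (v : Fin N → L2Plane) (p d : Fin N → Fin 2 → L2Plane),
      (∀ j, HasDerivWithinAt (u j) (v j) (Set.Icc 0 T) t) ∧
      (∀ j k, p j k = covL β (magL (kerB N hs hR M hM k) fun l => u l t) (u j t) (w j k t)) ∧
      (∀ j k, HasWeakDeriv (e k) (p j k) (d j k)) ∧
      ∀ j, (∑ k, covL β (magL (kerB N hs hR M hM k) fun l => u l t) (p j k) (d j k))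
        + (g * N) • mulL (magL (kerB2 N hs hR M hM) fun l => u l t) (u j t)
        - β • mulL (backL (kerB N hs hR M hM) (fun l => u l t) p) (u j t) = Complex.I • v j := by
  choose v hv hv' using fun j => h.equation t ht j
  choose d hd using fun j k => exists_hasWeakDeriv_covL hs hR hM β (fun l => u l t) k
    (hw j k t ht) (hw' j k t ht)
  refine ⟨v, _, d, hv, fun j k => rfl, hd, fun j => Lp.ext ?_⟩
  filter_upwards [hv' j, Lp.coeFn_smul Complex.I (v j), effectiveRHS_ae hs hR hM (β := β) (g := g)
    (fun l => u l t) (fun j k => hw j k t ht) (fun j k => rfl) hd j] with x h1 h2 h3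
  rw [← h3, h2, ← h1]
  rfl

/-- The Hamiltonian at time `t` is the same for all orbitals and symmetric: multiplications by real
functions are, and the squared covariant derivative is by applying `inner_covL` twice. So every
inner product of two orbitals has zero time derivative. -/
theorem IsSolution.orthonormal (hN : ∀ x, ‖aN N s R x‖ ≤ M) (hs : 0 ≤ s) (hR : 0 < R) (hT : 0 < T)
    (h : IsSolution β g s R m T u)
    (hw : ∀ j k, ∀ τ ∈ Set.Icc 0 T, HasWeakDeriv (e k) (u j τ) (w j k τ))
    (hw' : ∀ j k, ∀ τ ∈ Set.Icc 0 T, HasWeakDeriv (e k) (w j k τ) (w' j k τ))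
    {t : ℝ} (ht : t ∈ Set.Icc 0 T) : Orthonormal ℂ fun j => u j t := by
  have key : ∀ i j, (inner ℂ (u i t) (u j t) : ℂ) = inner ℂ (u i 0) (u j 0) := by
    intro i j
    refine eq_of_hasDerivWithinAt_zero (f := fun t => (inner ℂ (u i t) (u j t) : ℂ)) hT
      (fun t ht => ?_) t ht
    obtain ⟨v, p, d, hv, hp, hd, heq⟩ := h.exists_deriv hs hR hN hw hw' ht
    refine ((hv i).inner ℂ (hv j)).congr_deriv ?_
    have hk : ∀ k, (inner ℂ (u i t)
        (covL β (magL (kerB N hs hR M hN k) fun l => u l t) (p j k) (d j k)) : ℂ)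
        = inner ℂ (covL β (magL (kerB N hs hR M hN k) fun l => u l t) (p i k) (d i k)) (u j t) := by
      intro k
      rw [inner_covL β _ (hd i k) (hw j k t ht), ← inner_covL β _ (hw i k t ht) (hd j k),
        ← hp, ← hp]
    have hsymm : (inner ℂ (u i t) (Complex.I • v j) : ℂ) = inner ℂ (Complex.I • v i) (u j t) := by
      rw [← heq, ← heq]
      simp only [inner_add_left, inner_add_right, inner_sub_left, inner_sub_right, sum_inner,
        inner_sum, inner_smul_left_eq_smul, inner_smul_right_eq_smul, inner_mulL, hk]
    rw [inner_smul_left, inner_smul_right, Complex.conj_I] at hsymm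
    have hI : Complex.I ≠ 0 := Complex.I_ne_zero
    refine mul_left_cancel₀ hI ?_
    linear_combination hsymm
  have h0 := orthonormal_iff_ite.1 h.orthonormal_init
  exact orthonormal_iff_ite.2 fun i j => (key i j).trans (h0 i j)

/-- By the equation, the gradient of the energy is paired with `v j` as `Re ⟨v j, i v j⟩ = 0`. -/
theorem IsSolution.energyL_eq (hT : 0 < T)
    (h : IsSolution β g s R m T u)
    (hw : ∀ j k, ∀ τ ∈ Set.Icc 0 T, HasWeakDeriv (e k) (u j τ) (w j k τ))
    (hw' : ∀ j k, ∀ τ ∈ Set.Icc 0 T, HasWeakDeriv (e k) (w j k τ) (w' j k τ))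
    (hwc : ∀ j k, ∀ t ∈ Set.Icc 0 T, ContinuousWithinAt (w j k) (Set.Icc 0 T) t)
    (hwc' : ∀ j k, ∀ t ∈ Set.Icc 0 T, ContinuousWithinAt (w' j k) (Set.Icc 0 T) t)
    {t : ℝ} (ht : t ∈ Set.Icc 0 T) :
    energyL β (g * N) (kerB N hs hR M hM) (kerB2 N hs hR M hM) (fun j => u j t) (fun j k => w j k t)
      = energyL β (g * N) (kerB N hs hR M hM) (kerB2 N hs hR M hM) (fun j => u j 0)
        fun j k => w j k 0 := by
  refine eq_of_hasDerivWithinAt_zero (f := fun t => energyL β (g * N) (kerB N hs hR M hM)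
    (kerB2 N hs hR M hM) (fun j => u j t) (fun j k => w j k t)) hT (fun t ht => ?_) t ht
  obtain ⟨v, p, d, hv, hp, hd, heq⟩ := h.exists_deriv hs hR hM hw hw' ht
  have D := hasDerivWithinAt_energyL (β := β) (c := g * N) (a := kerB N hs hR M hM)
    (a2 := kerB2 N hs hR M hM) (fun k x => ?_) (fun x => ?_) ht hv hw hw'
    (fun j k => hwc j k t ht) (fun j k => hwc' j k t ht) hp hd
  · refine D.congr_deriv ?_
    rw [Finset.sum_eq_zero fun j _ => ?_, mul_zero]
    rw [heq, reL_apply, inner_smul_right, inner_self_eq_norm_sq_to_K]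
    simp [← Complex.ofReal_pow]
  · change aN N s R (-x) k = (-1) * aN N s R x k
    rw [aN_neg]
    simp
  · change ‖aN N s R (-x)‖ ^ 2 = 1 * ‖aN N s R x‖ ^ 2
    rw [aN_neg, norm_neg, one_mul]

end Conservation

/-! ### Bounds in terms of the kinetic energy -/

section Bounds

variable {N : ℕ} {u : Fin N → L2Plane}

theorem density_nonneg (u : Fin N → Plane → ℂ) (x : Plane) : 0 ≤ density u x :=
  Finset.sum_nonneg fun _ _ => by positivity

theorem measurable_density (u : Fin N → L2Plane) : Measurable (density fun j => u j) :=
  Finset.measurable_fun_sum _ fun j _ => (Lp.stronglyMeasurable (u j)).measurable.norm.pow_const 2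

theorem integral_density (ho : Orthonormal ℂ u) : ∫ x, density (fun j => u j) x = N := by
  simp only [density]
  rw [integral_finsetSum _ fun j _ => integrable_norm_sq (u j)]
  simp [integral_norm_sq, ho.1]

theorem integrable_density_sq (ho : Orthonormal ℂ u) {w : Fin N → Fin 2 → L2Plane}
    (hw : ∀ j k, HasWeakDeriv (e k) (u j) (w j k)) :
    Integrable fun x => density (fun j => u j) x ^ 2 := by
  refine ⟨((measurable_density u).pow_const 2).aestronglyMeasurable, ?_⟩
  rw [hasFiniteIntegral_iff_ofReal (Eventually.of_forall fun x => by positivity)]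
  exact (lintegral_density_sq_le ho hw).trans_lt ENNReal.ofReal_lt_top

theorem integral_density_sq_le (ho : Orthonormal ℂ u) {w : Fin N → Fin 2 → L2Plane}
    (hw : ∀ j k, HasWeakDeriv (e k) (u j) (w j k)) :
    ∫ x, density (fun j => u j) x ^ 2 ≤ 2 * ∑ j, ∑ k, ‖w j k‖ ^ 2 := by
  have h := lintegral_density_sq_le ho hw
  rw [← ofReal_integral_eq_lintegral_ofReal (integrable_density_sq ho hw)
    (Eventually.of_forall fun x => by positivity)] at h
  exact (ENNReal.ofReal_le_ofReal_iff (by positivity)).1 h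

theorem lintegral_ofReal_density (ho : Orthonormal ℂ u) :
    ∫⁻ x, ENNReal.ofReal (density (fun j => u j) x) = N := by
  rw [← ofReal_integral_eq_lintegral_ofReal (integrable_density u)
    (Eventually.of_forall fun x => density_nonneg _ x), integral_density ho]
  simp

theorem lintegral_ofReal_density_sq (ho : Orthonormal ℂ u) {w : Fin N → Fin 2 → L2Plane}
    (hw : ∀ j k, HasWeakDeriv (e k) (u j) (w j k)) :
    ∫⁻ x, ENNReal.ofReal (density (fun j => u j) x) ^ 2
      = ENNReal.ofReal (∫ x, density (fun j => u j) x ^ 2) := by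
  rw [ofReal_integral_eq_lintegral_ofReal (integrable_density_sq ho hw)
    (Eventually.of_forall fun x => by positivity)]
  simp only [ENNReal.ofReal_pow (density_nonneg _ _)]

variable {s R : ℝ}

theorem integral_norm_aN_mul_density_sq_le (hN : 1 ≤ N) (hs : 0 ≤ s) (hs1 : s ≤ 1 / 2) (hR : 0 < R)
    (ho : Orthonormal ℂ u) {w : Fin N → Fin 2 → L2Plane}
    (hw : ∀ j k, HasWeakDeriv (e k) (u j) (w j k)) (x : Plane) :
    (∫ y, ‖aN N s R (x - y)‖ * density (fun j => u j) y) ^ 2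
      ≤ 2 + 4 * Real.pi / N * ∫ x, density (fun j => u j) x ^ 2 := by
  have h := lintegral_mul_enorm_aN_sq_le hN hs hs1 R
    (ρ := fun y => ENNReal.ofReal (density (fun j => u j) y))
    (measurable_density u).ennreal_ofReal.aemeasurable (lintegral_ofReal_density ho).le x
  rw [lintegral_ofReal_density_sq ho hw] at h
  have hi : Integrable fun y => ‖aN N s R (x - y)‖ * density (fun j => u j) y :=
    (integrable_smul_aN hs hR (norm_aN_le hN hs hs1 hR) (integrable_density u) x).norm.congr
      (Eventually.of_forall fun y => by
        beta_reduce
        rw [norm_smul, Real.norm_of_nonneg (density_nonneg _ y), mul_comm])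
  have h0 : ∀ y, 0 ≤ ‖aN N s R (x - y)‖ * density (fun j => u j) y :=
    fun y => mul_nonneg (norm_nonneg _) (density_nonneg _ y)
  have e1 : ∫⁻ y, ENNReal.ofReal (density (fun j => u j) y) * ‖aN N s R (x - y)‖ₑ
      = ENNReal.ofReal (∫ y, ‖aN N s R (x - y)‖ * density (fun j => u j) y) := by
    rw [ofReal_integral_eq_lintegral_ofReal hi (Eventually.of_forall h0)]
    refine lintegral_congr fun y => ?_
    rw [ENNReal.ofReal_mul (norm_nonneg _), ofReal_norm, mul_comm]
  have hD : 0 ≤ ∫ x, density (fun j => u j) x ^ 2 := integral_nonneg fun x => by positivity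
  rw [e1, ← ENNReal.ofReal_pow (integral_nonneg h0), ← ENNReal.ofReal_mul (by positivity)] at h
  refine (ENNReal.ofReal_le_ofReal_iff (by positivity)).1 ?_
  rwa [ENNReal.ofReal_add (by norm_num) (by positivity), ENNReal.ofReal_ofNat]

theorem integral_density_mul_integral_aN_sq_le (hN : 1 ≤ N) (hs : 0 ≤ s) (hs1 : s ≤ 1 / 2)
    (hR : 0 < R) (ho : Orthonormal ℂ u) {w : Fin N → Fin 2 → L2Plane}
    (hw : ∀ j k, HasWeakDeriv (e k) (u j) (w j k)) :
    ∫ x, density (fun j => u j) x * ∫ y, ‖aN N s R (x - y)‖ ^ 2 * density (fun j => u j) y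
      ≤ 1 + 4 * Real.pi / N * ∫ x, density (fun j => u j) x ^ 2 := by
  have h := lintegral_lintegral_aN_sq_le hN hs hs1 R
    (ρ := fun y => ENNReal.ofReal (density (fun j => u j) y))
    (measurable_density u).ennreal_ofReal (lintegral_ofReal_density ho).le
  rw [lintegral_ofReal_density_sq ho hw] at h
  set k := kerB2 N hs hR _ (norm_aN_le hN hs hs1 hR) with hk
  have hi : ∀ x, Integrable fun y => ‖aN N s R (x - y)‖ ^ 2 * density (fun j => u j) y :=
    fun x => (integrable_conv k (integrable_density u) x).congr
      (Eventually.of_forall fun y => mul_comm _ _)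
  have h0 : ∀ x y, 0 ≤ ‖aN N s R (x - y)‖ ^ 2 * density (fun j => u j) y :=
    fun x y => mul_nonneg (by positivity) (density_nonneg _ y)
  have hcont : Continuous fun x => ∫ y, ‖aN N s R (x - y)‖ ^ 2 * density (fun j => u j) y :=
    (continuous_conv k (integrable_density u)).congr fun x => by
      congr 1 with y
      exact mul_comm _ _
  have e1 : ∫⁻ x, ∫⁻ y, ENNReal.ofReal (density (fun j => u j) x)
        * ENNReal.ofReal (density (fun j => u j) y) * ‖aN N s R (x - y)‖ₑ ^ 2
      = ∫⁻ x, ENNReal.ofReal (density (fun j => u j) x *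
        ∫ y, ‖aN N s R (x - y)‖ ^ 2 * density (fun j => u j) y) := by
    refine lintegral_congr fun x => ?_
    rw [ENNReal.ofReal_mul (density_nonneg _ x),
      ofReal_integral_eq_lintegral_ofReal (hi x) (Eventually.of_forall (h0 x)),
      ← lintegral_const_mul' _ _ ENNReal.ofReal_ne_top]
    refine lintegral_congr fun y => ?_
    rw [ENNReal.ofReal_mul (by positivity), ENNReal.ofReal_pow (norm_nonneg _), ofReal_norm]
    ring
  have hD : 0 ≤ ∫ x, density (fun j => u j) x ^ 2 := integral_nonneg fun x => by positivity
  rw [e1, ← ENNReal.ofReal_mul (by positivity), ← ENNReal.ofReal_one,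
    ← ENNReal.ofReal_add (by norm_num) (by positivity)] at h
  rw [integral_eq_lintegral_of_nonneg_ae
    (Eventually.of_forall fun x => mul_nonneg (density_nonneg _ x) (integral_nonneg (h0 x)))
    ((measurable_density u).mul hcont.measurable).aestronglyMeasurable]
  exact ENNReal.toReal_le_of_le_ofReal (by positivity) h

variable (hs : 0 ≤ s) (hR : 0 < R) {M : ℝ} (hM : ∀ x, ‖aN N s R x‖ ≤ M)

/-- Pointwise `|a_N[ρ]|² ≤ (|a_N| * ρ)² ≤ B`, and the orbitals are normalized. -/
theorem sum_norm_mulL_magL_sq_le (ho : Orthonormal ℂ u) {B : ℝ}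
    (hB : ∀ x, (∫ y, ‖aN N s R (x - y)‖ * density (fun j => u j) y) ^ 2 ≤ B) :
    ∑ j, ∑ k, ‖mulL (magL (kerB N hs hR M hM k) u) (u j)‖ ^ 2 ≤ N * B := by
  have hpot : ∀ x, ‖potA s R (fun j => u j) x‖ ^ 2 ≤ B := by
    intro x
    refine le_trans (pow_le_pow_left₀ (norm_nonneg _) ?_ 2) (hB x)
    refine (norm_integral_le_integral_norm _).trans_eq ?_
    congr 1 with y
    rw [norm_smul, Real.norm_of_nonneg (density_nonneg _ y), mul_comm]
  have hj : ∀ j, ∑ k, ‖mulL (magL (kerB N hs hR M hM k) u) (u j)‖ ^ 2 ≤ B := by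
    intro j
    have e1 : ∀ᵐ x, ∀ k, mulL (magL (kerB N hs hR M hM k) u) (u j) x
        = ((potA s R (fun j => u j) x k : ℝ) : ℂ) * u j x := by
      refine ae_all_iff.2 fun k => ?_
      filter_upwards [mulL_ae (magL (kerB N hs hR M hM k) u) (u j), magL_kerB_ae hs hR hM u k]
        with x h1 h2
      rw [h1, h2]
    simp only [← integral_norm_sq]
    rw [← integral_finsetSum _ fun k _ => integrable_norm_sq _]
    calc _ ≤ ∫ x, B * ‖u j x‖ ^ 2 := by
          refine integral_mono_ae (integrable_finsetSum _ fun k _ => integrable_norm_sq _)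
            ((integrable_norm_sq (u j)).const_mul B) ?_
          filter_upwards [e1] with x hx
          simp only [hx, norm_mul, mul_pow, ← Finset.sum_mul, Complex.norm_real]
          rw [← EuclideanSpace.norm_sq_eq]
          exact mul_le_mul_of_nonneg_right (hpot x) (by positivity)
      _ = B := by rw [integral_const_mul, integral_norm_sq, ho.1 j]; ring
  calc _ ≤ ∑ _j : Fin N, B := Finset.sum_le_sum fun j _ => hj j
    _ = _ := by simp

theorem pairL_magL_kerB2 (u : Fin N → L2Plane) :
    pairL (magL (kerB2 N hs hR M hM) u) (rhoL u)
      = ∫ x, density (fun j => u j) x * ∫ y, ‖aN N s R (x - y)‖ ^ 2 * density (fun j => u j) y := by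
  rw [pairL_apply]
  refine integral_congr_ae ?_
  filter_upwards [magL_kerB2_ae hs hR hM u, rhoL_ae u] with x h1 h2
  rw [h1, h2, potA2, mul_comm]
  congr 2 with y
  exact mul_comm _ _

theorem norm_sub_sq_le {E : Type*} [SeminormedAddCommGroup E] (x y : E) :
    ‖x - y‖ ^ 2 ≤ 2 * ‖x‖ ^ 2 + 2 * ‖y‖ ^ 2 := by
  have := pow_le_pow_left₀ (norm_nonneg _) (norm_sub_le x y) 2
  nlinarith [sq_nonneg (‖x‖ - ‖y‖)]

/-- The kinetic energy and the energy of the effective equation control each other. -/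
theorem energyL_bounds (ho : Orthonormal ℂ u) {β c : ℝ} (hc : 0 ≤ c) {w : Fin N → Fin 2 → L2Plane}
    {B Q : ℝ} (hB : ∀ x, (∫ y, ‖aN N s R (x - y)‖ * density (fun j => u j) y) ^ 2 ≤ B)
    (hQ : ∫ x, density (fun j => u j) x *
      ∫ y, ‖aN N s R (x - y)‖ ^ 2 * density (fun j => u j) y ≤ Q) :
    energyL β c (kerB N hs hR M hM) (kerB2 N hs hR M hM) u w
        ≤ 2 * (∑ j, ∑ k, ‖w j k‖ ^ 2) + 2 * β ^ 2 * (N * B) + c / 2 * Q ∧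
      ∑ j, ∑ k, ‖w j k‖ ^ 2
        ≤ 2 * energyL β c (kerB N hs hR M hM) (kerB2 N hs hR M hM) u w + 2 * β ^ 2 * (N * B) := by
  have hA := sum_norm_mulL_magL_sq_le hs hR hM ho hB
  set A : Fin N → Fin 2 → L2Plane := fun j k => mulL (magL (kerB N hs hR M hM k) u) (u j)
  have hI : ∀ f : L2Plane, ‖Complex.I • f‖ = ‖f‖ := fun f => by simp [norm_smul]
  have hβ : ∀ f : L2Plane, ‖β • f‖ ^ 2 = β ^ 2 * ‖f‖ ^ 2 := fun f => by
    rw [norm_smul, mul_pow, Real.norm_eq_abs, sq_abs]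
  have hP0 : 0 ≤ pairL (magL (kerB2 N hs hR M hM) u) (rhoL u) := by
    rw [pairL_magL_kerB2]
    exact integral_nonneg fun x => mul_nonneg (density_nonneg _ x)
      (integral_nonneg fun y => mul_nonneg (by positivity) (density_nonneg _ y))
  have hP : pairL (magL (kerB2 N hs hR M hM) u) (rhoL u) ≤ Q := by rwa [pairL_magL_kerB2]
  have u1 : ∑ j, ∑ k, ‖covL β (magL (kerB N hs hR M hM k) u) (u j) (w j k)‖ ^ 2
      ≤ ∑ j, ∑ k, (2 * β ^ 2 * ‖A j k‖ ^ 2 + 2 * ‖w j k‖ ^ 2) := by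
    refine Finset.sum_le_sum fun j _ => Finset.sum_le_sum fun k _ => ?_
    refine (norm_sub_sq_le _ _).trans_eq ?_
    rw [hI, hβ]
    ring
  have u2 : ∑ j, ∑ k, ‖w j k‖ ^ 2 ≤ ∑ j, ∑ k, (2 * β ^ 2 * ‖A j k‖ ^ 2
      + 2 * ‖covL β (magL (kerB N hs hR M hM k) u) (u j) (w j k)‖ ^ 2) := by
    refine Finset.sum_le_sum fun j _ => Finset.sum_le_sum fun k _ => ?_
    -- The gradient is recovered, up to the phase `i`, as the potential term minus the covariant
    -- derivative.
    have h := norm_sub_sq_le (β • A j k) (covL β (magL (kerB N hs hR M hM k) u) (u j) (w j k))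
    rw [covL, sub_sub_cancel, hI, hβ] at h
    rw [covL]
    linarith
  simp only [Finset.sum_add_distrib, ← Finset.mul_sum] at u1 u2
  have hβA := mul_le_mul_of_nonneg_left hA (by positivity : 0 ≤ 2 * β ^ 2)
  rw [energyL]
  constructor
  · have := mul_le_mul_of_nonneg_left hP (by positivity : 0 ≤ c / 2)
    linarith
  · have := mul_nonneg (by positivity : 0 ≤ c / 2) hP0
    linarith

theorem kinetic_eq {w : Fin N → Fin 2 → L2Plane}
    (hw : ∀ j k, HasWeakDeriv (e k) (u j) (w j k)) :
    kinetic (fun j => u j) = ∑ j, ∑ k, ‖w j k‖ ^ 2 := by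
  refine Finset.sum_congr rfl fun j _ => ?_
  simp only [← integral_norm_sq]
  rw [← integral_finsetSum _ fun k _ => integrable_norm_sq _]
  refine integral_congr_ae ?_
  have h : ∀ᵐ x, ∀ k, weakDeriv (e k) (u j) x = w j k x :=
    ae_all_iff.2 fun k => (hw j k).weakDeriv_ae_eq
  filter_upwards [h] with x hx
  simp only [hx]

end Bounds

end ChernSimonsHartree
end

open ChernSimonsHartree in
theorem lemma3p2 :
    ∃ βs : ℝ, 0 < βs ∧ ∀ g : ℝ, 0 ≤ g → ∀ C : ℝ, 0 < C → ∃ C' : ℝ, 0 < C' ∧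
      ∀ β : ℝ, 0 ≤ β → β ≤ βs →
      ∀ N : ℕ, 1 ≤ N →
      ∀ s : ℝ, 0 ≤ s → s ≤ 1 / 2 →
      ∀ r : ℝ, 0 ≤ r → r ≤ 1 / 2 →
      ∀ m : ℕ, 2 ≤ m →
      ∀ T : ℝ, 0 < T →
      ∀ u : Fin N → ℝ → ChernSimonsHartree.L2Plane,
        ChernSimonsHartree.IsSolution β g s ((N : ℝ) ^ (-r)) m T u →
        ChernSimonsHartree.microEnergy β g s ((N : ℝ) ^ (-r))
          (ChernSimonsHartree.slater (fun j => ⇑(u j 0))) ≤ C * N →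
        ∀ t ∈ Set.Icc 0 T,
          ChernSimonsHartree.kinetic (fun j => ⇑(u j t)) ≤ C' * N ∧
          MeasureTheory.Integrable
            (fun x => ChernSimonsHartree.density (fun j => ⇑(u j t)) x ^ 2) ∧
          ∫ x, ChernSimonsHartree.density (fun j => ⇑(u j t)) x ^ 2 ≤ C' * N := by
  -- With `β² ≤ 10⁻⁴`, the terms to be absorbed are `6β² · 64 K(0) ≤ 0.0384 K(0)` against `K(0)/2`,
  -- and `2β² · 32 K(t) ≤ 0.0064 K(t)` against `K(t)`.
  refine ⟨1 / 100, by norm_num, fun g hg C hC => ?_⟩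
  -- The bracket bounds `E(0)/N`, given `K(0) ≤ 4(C+1)N`: it contains `2K(0)` with room to spare,
  -- and the pair term `(g/2)(N + 32 K(0))`.
  set K' := 4 * (12 * (C + 1) + 1 + g / 2 + 64 * g * (C + 1)) + 1 with hK'
  have hK'0 : 0 < K' := by positivity
  -- The factor `2` is the Lieb-Thirring constant, needed for `∫ ρ²`.
  refine ⟨2 * K', by positivity, ?_⟩
  intro β hβ0 hβ N hN s hs hs1 r hr hr1 m hm T hT u h hE t ht
  have hN' : (1 : ℝ) ≤ N := by exact_mod_cast hN
  have hN0 : (0 : ℝ) < N := by linarith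
  have hR : 0 < (N : ℝ) ^ (-r) := Real.rpow_pos_of_pos hN0 _
  -- Only `R > 0` matters from here on; the estimates are uniform in `R`.
  generalize (N : ℝ) ^ (-r) = R at h hE hR
  have hM := norm_aN_le hN hs hs1 hR
  choose w w' hw hw' hwc hwc' using fun j k => (h.continuous j).exists_gradients hm k
  have h0 : (0 : ℝ) ∈ Set.Icc 0 T := ⟨le_rfl, hT.le⟩
  have ho : ∀ τ ∈ Set.Icc 0 T, Orthonormal ℂ fun j => u j τ :=
    fun τ hτ => h.orthonormal hM hs hR hT hw hw' hτ
  set K : ℝ → ℝ := fun τ => ∑ j, ∑ k, ‖w j k τ‖ ^ 2 with hK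
  set D : ℝ → ℝ := fun τ => ∫ x, density (fun j => u j τ) x ^ 2 with hD
  have hK0 : ∀ τ, 0 ≤ K τ := fun τ => by positivity
  have hDK : ∀ τ ∈ Set.Icc 0 T, D τ ≤ 2 * K τ :=
    fun τ hτ => integral_density_sq_le (ho τ hτ) fun j k => hw j k τ hτ
  have hπ := Real.pi_le_four
  -- The constant `32` is `4π · 2` with `π ≤ 4`.
  have hDN : ∀ τ ∈ Set.Icc 0 T, 4 * Real.pi / N * D τ ≤ 32 * K τ / N := by
    intro τ hτ
    rw [div_mul_eq_mul_div]
    refine div_le_div_of_nonneg_right ?_ hN0.le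
    have h1 := mul_le_mul_of_nonneg_left (hDK τ hτ) Real.pi_pos.le
    have h2 := mul_le_mul_of_nonneg_right hπ (hK0 τ)
    linarith
  have hB : ∀ τ ∈ Set.Icc 0 T, ∀ x, (∫ y, ‖aN N s R (x - y)‖ * density (fun j => u j τ) y) ^ 2
      ≤ 2 + 32 * K τ / N := fun τ hτ x =>
    (integral_norm_aN_mul_density_sq_le hN hs hs1 hR (ho τ hτ) (fun j k => hw j k τ hτ) x).trans
      (by linarith [hDN τ hτ])
  have hQ : ∀ τ ∈ Set.Icc 0 T, ∫ x, density (fun j => u j τ) x *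
      ∫ y, ‖aN N s R (x - y)‖ ^ 2 * density (fun j => u j τ) y ≤ 1 + 32 * K τ / N := fun τ hτ =>
    (integral_density_mul_integral_aN_sq_le hN hs hs1 hR (ho τ hτ) (fun j k => hw j k τ hτ)).trans
      (by linarith [hDN τ hτ])
  have hNB : ∀ τ, (N : ℝ) * (2 + 32 * K τ / N) = 2 * N + 32 * K τ := fun τ => by
    field_simp
  have hNQ : ∀ τ, (N : ℝ) * (1 + 32 * K τ / N) = N + 32 * K τ := fun τ => by
    field_simp
  have hQle : ∀ τ, 1 + 32 * K τ / N ≤ N + 32 * K τ := fun τ => by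
    have : 32 * K τ / N ≤ 32 * K τ := div_le_self (by linarith [hK0 τ]) hN'
    linarith
  have hβ2 : β ^ 2 ≤ 1 / 10000 := by nlinarith
  have hβ20 : 0 ≤ β ^ 2 := sq_nonneg β
  have hmicro := microEnergy_slater_ge hN (β := β) hg hs hs1 hR (ho 0 h0)
    (fun j k => hw j k 0 h0) (hB 0 h0) (hQ 0 h0)
  change K 0 / 2 - _ ≤ _ at hmicro
  rw [hNB] at hmicro
  have hKinit : K 0 ≤ 4 * (C + 1) * N := by
    have h1 : β ^ 2 * (6 * (1 + 32 * K 0 / N + (2 * N + 32 * K 0)))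
        ≤ 1 / 10000 * (6 * (N + 32 * K 0 + (2 * N + 32 * K 0))) := by
      refine mul_le_mul hβ2 (by linarith [hQle 0]) ?_ (by norm_num)
      have := hK0 0
      positivity
    linarith [hK0 0]
  obtain ⟨hE0, -⟩ := energyL_bounds hs hR hM (ho 0 h0) (β := β) (c := g * N) (by positivity)
    (w := fun j k => w j k 0) (hB 0 h0) (hQ 0 h0)
  obtain ⟨-, hEt⟩ := energyL_bounds hs hR hM (ho t ht) (β := β) (c := g * N) (by positivity)
    (w := fun j k => w j k t) (hB t ht) (hQ t ht)
  rw [h.energyL_eq hs hR hM hT hw hw' hwc hwc' ht] at hEt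
  set E := energyL β (g * N) (kerB N hs hR _ hM) (kerB2 N hs hR _ hM) (fun j => u j 0)
    fun j k => w j k 0
  change E ≤ 2 * K 0 + _ + _ at hE0
  change K t ≤ _ at hEt
  -- The coupling `gN` is compensated by the `1/N` in the pair bound, so this contribution is of
  -- order `N` too.
  have hsplit : g * N / 2 * (1 + 32 * K 0 / N) = g / 2 * (N + 32 * K 0) := by
    rw [← hNQ]; ring
  rw [hNB, hsplit] at hE0
  rw [hNB] at hEt
  have b0 : 2 * β ^ 2 * (2 * N + 32 * K 0) ≤ 2 * (1 / 10000) * (2 * N + 32 * K 0) :=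
    mul_le_mul_of_nonneg_right (by linarith) (by linarith [hK0 0])
  have bt : 2 * β ^ 2 * (2 * N + 32 * K t) ≤ 2 * (1 / 10000) * (2 * N + 32 * K t) :=
    mul_le_mul_of_nonneg_right (by linarith) (by linarith [hK0 t])
  have hgK : g * K 0 ≤ g * (4 * (C + 1) * N) := mul_le_mul_of_nonneg_left hKinit hg
  have hKt : K t ≤ K' * N := by
    have : E ≤ (12 * (C + 1) + 1 + g / 2 + 64 * g * (C + 1)) * N := by
      have := hK0 0
      nlinarith
    rw [hK']
    nlinarith [hK0 t]
  have hfin : K' * N ≤ 2 * K' * N := by nlinarith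
  refine ⟨?_, integrable_density_sq (ho t ht) fun j k => hw j k t ht, ?_⟩
  · rw [kinetic_eq fun j k => hw j k t ht]
    exact hKt.trans hfin
  · exact (hDK t ht).trans (by linarith)
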